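/- **Setting.** Let $\mathfrak h$ be a finite-dimensional complex vector space with a non-degenerate symmetric bilinear form $(\cdot|\cdot)$, identified with $\mathfrak h^*$ by this form; write $\lambda(z)=(\lambda|z)$, $|x|^2=(x|x)$ and $\gamma^\vee=2\gamma/|\gamma|^2$. Let $L\subset\mathfrak h$ be a lattice of rank $m>0$, on which the form is real-valued and positive definite, with $\mathbb Z$-basis $\gamma_1,\dots,\gamma_m$, and let $T=\{\beta_1,\dots,\beta_n\}\subset\mathfrak h$, $n\le m$, be such that $(\beta_i|\beta_j)=0$ for all $i,j$; $(\gamma_i|\beta_j)=-\delta_{ij}$; $(\gamma_i^\vee|\gamma_j)\in\mathbb Z$ for $1\le i\le n$, $i\le j\le m$; and $\dim\mathfrak h=m+n$. Fix a real number $k>0$ such that $k(L|L)\subset\mathbb Z$, and let $L_{\rm even}$ (resp. $L_{\rm odd}$) be the set of $\gamma\in L$ such that $k|\gamma|^2$ is an even (resp. odd) integer. Let $\hat{\mathfrak h}^*=\mathfrak h^*\oplus\mathbb C\Lambda_0\oplus\mathbb C\delta$; for $\lambda=\bar\lambda+\ell\Lambda_0+a\delta$ the level of $\lambda$ is $\ell$,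 and $(\lambda|x)=(\bar\lambda|x)$ for $x\in\mathfrak h$. Let $P_{k,T}$ be the set of $\lambda\in\hat{\mathfrak h}^*$ of level $k$ with $(\bar\lambda|L)\subset\mathbb Z$ and $(\bar\lambda|T)=0$. For $0\le s\le n$ put $L_s=\mathbb Z\{\gamma_i+\sum_{p\le s}(\gamma_i|\gamma_p)\beta_p \mid s<i\le m\}$, $T_s=\{\beta_{s+1},\dots,\beta_n\}$, $\lambda_s=\lambda+\sum_{i\le s}(\lambda|\gamma_i)\beta_i$, and $M=L_n$. Let $M^\perp=\{h\in\mathfrak h\mid (h|M)=0\}$, let $M^*$ be the dual lattice of $M$ in $\mathbb CM$, and let $z^{(1)}$ be the orthogonal projection of $z\in\mathfrak h$ to $\mathbb CM$. **Rank one functions.** Let $\operatorname{Im}\tau>0$, $q=e^{2\pi i\tau}$. For $\mathsf m\in\frac12\mathbb Z_{>0}$ and $s,j\in\frac12\mathbb Z$ put $$\Phi^{\pm[\mathsf m;s]}(\tau,z_1,z_2)=\sum_{r\in\mathbb Z}(\pm1)^r\frac{e^{2\pi i\mathsf m r(z_1+z_2)+2\pi i s z_1}q^{\mathsf m r^2+sr}}{1-e^{2\pi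 i z_1}q^r},\qquad \Theta^\pm_{j,\mathsf m}(\tau,z)=\sum_{r\in\mathbb Z}(\pm1)^r e^{2\pi i\mathsf m z(r+\frac j{2\mathsf m})}q^{\mathsf m(r+\frac j{2\mathsf m})^2},$$ $$R^\pm_{j,\mathsf m}(\tau,z)=\sum_{r\in j+2\mathsf m\mathbb Z}(\pm1)^{\frac{r-j}{2\mathsf m}}\Big\{\operatorname{sign}(r-\tfrac12-j+2\mathsf m)-E\Big(\big(r-2\mathsf m\tfrac{\operatorname{Im}z}{\operatorname{Im}\tau}\big)\sqrt{\tfrac{\operatorname{Im}\tau}{\mathsf m}}\Big)\Big\}e^{-\frac{\pi i r^2}{2\mathsf m}\tau+2\pi i r z},\qquad E(x)=2\int_0^x e^{-\pi u^2}du,$$ $$\tilde\Phi^{\pm[\mathsf m;s]}(\tau,z_1,z_2)=\Phi^{\pm[\mathsf m;s]}(\tau,z_1,z_2)-\tfrac12\sum_{j\in s+\mathbb Z,\ s\le j<s+2\mathsf m}R^\pm_{j,\mathsf m}\big(\tau,\tfrac{z_1-z_2}2\big)\,\Theta^\pm_{j,\mathsf m}(\tau,z_1+z_2).$$ **Modified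 functions.** For a weight $\lambda$ of level $k$, orthogonal to $T$, and $0\le s\le n$ let $$\Theta^{\pm;L_s}_{\lambda_s,T_s}(\tau,z,t)=e^{2\pi i kt}\sum_{\gamma\in L_s}\epsilon^\pm_k(\gamma)\frac{q^{|\bar\lambda_s+k\gamma|^2/2k}\,e^{2\pi i(\bar\lambda_s+k\gamma)(z)}}{\prod_{\beta\in T_s}(1-q^{-(\gamma|\beta)}e^{-2\pi i\beta(z)})},\qquad \epsilon_k^\pm(\gamma)=(\pm1)^{\sum_{i\le n}(\gamma|\beta_i)+k|\gamma+\sum_{i\le n}(\beta_i|\gamma)\gamma_i|^2}.$$ For $T_s=\emptyset$ and any weight $\mu$ of level $k$ let $\Theta^{\pm;L_n}_\mu$ be the signed theta function given by the same series over $L_n=M$ with $\bar\lambda_s$ replaced by $\bar\mu$, no denominators, and the sign $(\pm1)^{k|\gamma|^2}$. Summing over the multiples of $\gamma':=\gamma_{s+1}+\sum_{p\le s}(\gamma_{s+1}|\gamma_p)\beta_p$ one has for $s<n$ $$\Theta^{\pm;L_s}_{\lambda_s,T_s}=e^{2\pi i kt}\sum_\gamma\epsilon^\pm_k(\gamma)\frac{q^{|\bar\lambda_s+k\gamma|^2/2k}e^{2\pi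 i(\bar\lambda_{s+1}+k\gamma)(z)}}{\prod_{\beta\in T_{s+1}}(1-q^{-(\gamma|\beta)}e^{-2\pi i\beta(z)})}\,\Phi^{\pm[\frac k2|\gamma'|^2;(\lambda_s|\gamma')]}\big(\tau,-\beta_{s+1}(z),(\beta_{s+1}+\gamma'^\vee)(z)+\tau(\gamma|\gamma'^\vee+2\beta_{s+1})\big),$$ where $\gamma$ runs over the $\mathbb Z$-span of the $\gamma_i+\sum_{p\le s}(\gamma_i|\gamma_p)\beta_p$, $s+2\le i\le m$. Put, for $1\le p\le n$, $$F^\pm_{\lambda,p}(\tau,z)=\tilde\Phi^{\pm[\frac k2|\gamma_p|^2;(\lambda|\gamma_p)]}\Big(\tau,-\beta_p(z),\beta_p(z)+\gamma_p^\vee(z)+\sum_{i<p}(\gamma_p^\vee|\gamma_i)\beta_i(z)\Big).$$ Let $\tilde\Theta^{\pm;0;L}_{\lambda,T}=\Theta^{\pm;L}_{\lambda,T}$ and, for $0\le s<n$, let $\tilde\Theta^{\pm;s+1;L}_{\lambda,T}$ be the product of $\prod_{p\le s}F^\pm_{\lambda,p}$ and the series obtained from the last expression for $\Theta^{\pm;L_s}_{\lambda_s,T_s}$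 by replacing $\Phi$ by $\tilde\Phi$. The signed modified mock theta function is $\tilde\Theta^{\pm;L}_{\lambda,T}=\tilde\Theta^{\pm;n;L}_{\lambda,T}$. **Proposition 3.3.** Suppose that $\gamma_1,\dots,\gamma_n\in L_{\rm odd}$. Let $\xi_0\in\mathfrak h^*$ be such that, for $1\le i\le m$, $(\xi_0|\gamma_i)\in\mathbb Z$ if $\gamma_i\in L_{\rm even}$ and $(\xi_0|\gamma_i)\in\frac12+\mathbb Z$ if $\gamma_i\in L_{\rm odd}$, and such that $(\xi_0|T)=0$. Let $\lambda\in P_{k,T}$. Then the projection $z^{(1)}$ exists and is unique for all $z\in\mathfrak h$, the set $P_{k,T}$ modulo $kM+M^\perp+\mathbb C\delta$ is finite, and for all $t\in\mathbb C$ and all $(\tau,z)$ with $\operatorname{Im}\tau>0$ and $\beta_p(z)\notin\mathbb Z+\mathbb Z\tau$ for $p=1,\dots,n$ (i.e. off the poles) we have: (a) $\displaystyle \tilde\Theta^{\pm;L}_{\lambda,T}(\tau,z,t)=\Theta^{\pm;L_n}_{\lambda_n}(\tau,z^{(1)},t)\prod_{p=1}^nF^\pm_{\lambda,p}(\tau,z),\qquad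 \tilde\Theta^{\pm;L}_{\lambda+\xi_0,T}(\tau,z,t)=\Theta^{\pm;L_n}_{\lambda_n+\xi_0}(\tau,z^{(1)},t)\prod_{p=1}^nF^\pm_{\lambda+\xi_0,p}(\tau,z).$ (b) With $C(\tau)=i^n(-i\tau)^{\frac{\dim\mathfrak h}2}|M^*/kM|^{-\frac12}$ (principal branch) and each sum over $\mu\in P_{k,T}$ modulo $kM+M^\perp+\mathbb C\delta$, for an arbitrary choice of representatives, $$\tilde\Theta^{+;L}_{\lambda,T}\big(-\tfrac1\tau,\tfrac z\tau,t-\tfrac{|z|^2}{2\tau}\big)=C(\tau)\sum_\mu e^{-\frac{2\pi i}k(\bar\lambda|\bar\mu)}\,\tilde\Theta^{+;L}_{\mu,T}(\tau,z,t),$$ $$\tilde\Theta^{-;L}_{\lambda,T}\big(-\tfrac1\tau,\tfrac z\tau,t-\tfrac{|z|^2}{2\tau}\big)=C(\tau)\sum_\mu e^{-\frac{2\pi i}k(\bar\lambda|\bar\mu+\xi_0)}\,\tilde\Theta^{+;L}_{\mu+\xi_0,T}(\tau,z,t),$$ $$\tilde\Theta^{+;L}_{\lambda+\xi_0,T}\big(-\tfrac1\tau,\tfrac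 z\tau,t-\tfrac{|z|^2}{2\tau}\big)=C(\tau)\sum_\mu e^{-\frac{2\pi i}k(\bar\lambda+\xi_0|\bar\mu)}\,\tilde\Theta^{-;L}_{\mu,T}(\tau,z,t),$$ $$\tilde\Theta^{-;L}_{\lambda+\xi_0,T}\big(-\tfrac1\tau,\tfrac z\tau,t-\tfrac{|z|^2}{2\tau}\big)=C(\tau)\sum_\mu e^{-\frac{2\pi i}k(\bar\lambda+\xi_0|\bar\mu+\xi_0)}\,\tilde\Theta^{-;L}_{\mu+\xi_0,T}(\tau,z,t).$$ (c) $\displaystyle \tilde\Theta^{\pm;L}_{\lambda,T}(\tau+1,z,t)=e^{\frac{\pi i}k|\bar\lambda|^2}\,\tilde\Theta^{\mp;L}_{\lambda,T}(\tau,z,t),\qquad \tilde\Theta^{\pm;L}_{\lambda+\xi_0,T}(\tau+1,z,t)=e^{\frac{\pi i}k|\bar\lambda+\xi_0|^2}\,\tilde\Theta^{\pm;L}_{\lambda+\xi_0,T}(\tau,z,t).$ -/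

import Mathlib

open Complex

noncomputable section

namespace SignedMock

/-! ### Rank one signed theta and mock theta functions

The sign `±` is a unit `σ : ℤˣ`; `q ^ x` is `exp (2 π i τ x)`. -/

/-- `Θ^±_{j,m}(τ, z) = ∑_n (±1)^n e^{2πi m z (n + j/2m)} q^{m (n + j/2m)²}`. -/
def theta1 (σ : ℤˣ) (j m : ℝ) (τ z : ℂ) : ℂ :=
  ∑' n : ℤ, ((σ : ℤ) : ℂ) ^ n *
    exp (2 * Real.pi * I * (m * z * (n + j / (2 * m)) + τ * m * (n + j / (2 * m)) ^ 2))

/-- `Φ^{±[m;s]}(τ, z₁, z₂)`. -/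
def Phi (σ : ℤˣ) (m s : ℝ) (τ z₁ z₂ : ℂ) : ℂ :=
  ∑' n : ℤ, ((σ : ℤ) : ℂ) ^ n *
    exp (2 * Real.pi * I * (m * n * (z₁ + z₂) + s * z₁ + τ * (m * n ^ 2 + s * n))) /
      (1 - exp (2 * Real.pi * I * (z₁ + n * τ)))

/-- `E(x) = 2 ∫₀ˣ e^{-π u²} du`. -/
def E (x : ℝ) : ℝ := 2 * ∫ u in (0 : ℝ)..x, Real.exp (-Real.pi * u ^ 2)

/-- `ψ_{m,n}(τ, z) = (n - 2m Im z / Im τ) √(Im τ / m)`. -/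
def psi (m n : ℝ) (τ z : ℂ) : ℝ := (n - 2 * m * (z.im / τ.im)) * Real.sqrt (τ.im / m)

/-- `R^±_{j,m}(τ, z)`. The indices `n ≡ j mod 2m` are written `n = j + 2 m l`, `l ∈ ℤ`,
so that `(n - j) / 2m = l`. -/
def R (σ : ℤˣ) (j m : ℝ) (τ z : ℂ) : ℂ :=
  ∑' l : ℤ, ((σ : ℤ) : ℂ) ^ l *
    ((Real.sign ((j + 2 * m * l) - 1 / 2 - j + 2 * m) - E (psi m (j + 2 * m * l) τ z) : ℝ) : ℂ) *
    exp (-(Real.pi * I * ((j + 2 * m * l : ℝ) : ℂ) ^ 2 / (2 * m)) * τ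
      + 2 * Real.pi * I * ((j + 2 * m * l : ℝ) : ℂ) * z)

/-- The modifier `Φ^{±[m;s]}_add`: the sum over `j ∈ s + ℤ`, `s ≤ j < s + 2m`. -/
def PhiAdd (σ : ℤˣ) (m s : ℝ) (τ z₁ z₂ : ℂ) : ℂ :=
  ∑ i ∈ Finset.range ⌈2 * m⌉₊,
    R σ (s + i) m τ ((z₁ - z₂) / 2) * theta1 σ (s + i) m τ (z₁ + z₂)

/-- The modified function `Φ̃^{±[m;s]} = Φ^{±[m;s]} - ½ Φ^{±[m;s]}_add`. -/
def PhiMod (σ : ℤˣ) (m s : ℝ) (τ z₁ z₂ : ℂ) : ℂ :=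
  Phi σ m s τ z₁ z₂ - 1 / 2 * PhiAdd σ m s τ z₁ z₂

/-! ### Affine weights and mock theta functions attached to a lattice -/

/-- `ĥ* = h* ⊕ ℂ Λ₀ ⊕ ℂ δ`, where `h*` is identified with `h = V` by the bilinear form:
`(x, k, a)` is `x + k Λ₀ + a δ`. -/
abbrev AffineDual (V : Type*) := V × ℂ × ℂ

/-- The projection of a weight to `h*`. -/
abbrev AffineDual.bar {V : Type*} (lam : AffineDual V) : V := lam.1

/-- The level `λ(K)`. -/
abbrev AffineDual.level {V : Type*} (lam : AffineDual V) : ℂ := lam.2.1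

section General

variable {V : Type*} [AddCommGroup V] [Module ℂ V]

/-- The signed mock theta function `Θ^L_{λ,T,ε}(τ, z, t)`, `T = {β_j | j ∈ J}`, in the coordinates
`h = 2πi (z + t K - τ d)`:
`e^{2πikt} ∑_{γ ∈ L} ε(γ) q^{|λ̄ + kγ|²/2k} e^{2πi (λ̄ + kγ)(z)} /`
`∏_{β ∈ T} (1 - q^{-(γ|β)} e^{-2πi β(z)})`, with `k = λ(K)`. -/
def mockTheta (B : LinearMap.BilinForm ℂ V) (L : Submodule ℤ V) (ε : V → ℂ) {ι : Type*}
    (J : Finset ι) (β : ι → V) (lam : AffineDual V) (τ : ℂ) (z : V) (t : ℂ) : ℂ :=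
  exp (2 * Real.pi * I * lam.level * t) *
    ∑' γ : L, ε γ *
      exp (2 * Real.pi * I * (τ *
        (B (lam.bar + lam.level • (γ : V)) (lam.bar + lam.level • (γ : V)) / (2 * lam.level)))) *
      exp (2 * Real.pi * I * B (lam.bar + lam.level • (γ : V)) z) /
      ∏ j ∈ J, (1 - exp (-(2 * Real.pi * I * (τ * B γ (β j)))) *
        exp (-(2 * Real.pi * I * B (β j) z)))

/-- `γ^∨ = 2γ / (γ|γ)`. -/
def coroot (B : LinearMap.BilinForm ℂ V) (x : V) : V := (2 / B x x) • x

end General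

/-! ### The setting -/

/-- The lattice `L` with basis `γ₁, …, γ_m`, the isotropic vectors `T = {β₁, …, β_n}`, the level `k`,
and the standing assumptions on them. -/
structure Setting (V : Type*) [AddCommGroup V] [Module ℂ V] (m n : ℕ) where
  /-- the bilinear form `( . | . )` on `h = V` -/
  form : LinearMap.BilinForm ℂ V
  form_symm : form.IsSymm
  form_nondegenerate : form.Nondegenerate
  /-- the `ℤ`-basis of `L` -/
  gamma : Fin m → V
  gamma_indep : LinearIndependent ℤ gamma
  rank_pos : 0 < m
  /-- the form is real valued and positive definite on `L` -/
  form_real : ∀ x ∈ Submodule.span ℤ (Set.range gamma), ∀ y ∈ Submodule.span ℤ (Set.range gamma),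
    (form x y).im = 0
  form_pos : ∀ x ∈ Submodule.span ℤ (Set.range gamma), x ≠ 0 → 0 < (form x x).re
  /-- the elements of `T` -/
  beta : Fin n → V
  beta_isotropic : ∀ i j, form (beta i) (beta j) = 0
  n_le : n ≤ m
  gamma_beta : ∀ (i : Fin m) (j : Fin n),
    form (gamma i) (beta j) = if (i : ℕ) = (j : ℕ) then -1 else 0
  coroot_gamma : ∀ (i : Fin n) (j : Fin m), (i : ℕ) ≤ (j : ℕ) →
    ∃ a : ℤ, form (coroot form (gamma (Fin.castLE n_le i))) (gamma j) = a
  dim_eq : Module.finrank ℂ V = m + n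
  /-- the level -/
  k : ℝ
  k_pos : 0 < k
  k_integral : ∀ x ∈ Submodule.span ℤ (Set.range gamma),
    ∀ y ∈ Submodule.span ℤ (Set.range gamma), ∃ a : ℤ, (k : ℂ) * form x y = a

namespace Setting

variable {V : Type*} [AddCommGroup V] [Module ℂ V] {m n : ℕ} (S : Setting V m n)

/-- The lattice `L`. -/
def L : Submodule ℤ V := Submodule.span ℤ (Set.range S.gamma)

/-- `γ_p` for `p ≤ n`. -/
def gam (p : Fin n) : V := S.gamma (Fin.castLE S.n_le p)

/-- `L_even = {γ ∈ L | k (γ|γ) ∈ 2ℤ}`. -/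
def Leven : Set V := {x | x ∈ S.L ∧ ∃ a : ℤ, (S.k : ℂ) * S.form x x = 2 * a}

/-- `L_odd = {γ ∈ L | k (γ|γ) ∈ 1 + 2ℤ}`. -/
def Lodd : Set V := {x | x ∈ S.L ∧ ∃ a : ℤ, (S.k : ℂ) * S.form x x = 1 + 2 * a}

/-- `P_k`: the weights `λ` of level `k` with `(λ̄|γ) ∈ ℤ` for all `γ ∈ L`. -/
def P : Set (AffineDual V) :=
  {lam | lam.level = S.k ∧ ∀ x ∈ S.L, ∃ a : ℤ, S.form lam.bar x = a}

/-- `P_{k,T} = {λ ∈ P_k | (λ|T) = 0}`. -/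
def PT : Set (AffineDual V) := {lam | lam ∈ S.P ∧ ∀ j, S.form lam.bar (S.beta j) = 0}

/-- The basis vectors `γ_i + ∑_{p ≤ s} (γ_i|γ_p) β_p` (`i > s`) of the lattice `L_s`. -/
def stageVec (s : ℕ) (i : Fin m) : V :=
  S.gamma i + ∑ p ∈ Finset.univ.filter (fun p : Fin n => (p : ℕ) < s),
    S.form (S.gamma i) (S.gam p) • S.beta p

/-- The lattice `L_s`; indices start at `0`, so `i > s` reads `s ≤ i`. -/
def stageLattice (s : ℕ) : Submodule ℤ V :=
  Submodule.span ℤ (S.stageVec s '' {i | s ≤ (i : ℕ)})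

/-- The sublattice of `L_s` spanned by all its basis vectors but the first one. -/
def stageRest (s : ℕ) : Submodule ℤ V :=
  Submodule.span ℤ (S.stageVec s '' {i | s + 1 ≤ (i : ℕ)})

/-- `λ_s = λ + ∑_{i ≤ s} (λ|γ_i) β_i`. -/
def stageWeight (s : ℕ) (lam : AffineDual V) : AffineDual V :=
  (lam.bar + ∑ p ∈ Finset.univ.filter (fun p : Fin n => (p : ℕ) < s),
    S.form lam.bar (S.gam p) • S.beta p, lam.2)

/-- The indices of the elements of `T_s = {β_{s+1}, …, β_n}`. -/
def stageT (_S : Setting V m n) (s : ℕ) : Finset (Fin n) :=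
  Finset.univ.filter fun p => s ≤ (p : ℕ)

/-- The sign
`ε_k^±(γ) = (±1)^{∑_i (γ|β_i) + k |γ + ∑_i (β_i|γ) γ_i|²}`; the exponent is an integer on `L`. -/
def eps (σ : ℤˣ) (x : V) : ℂ :=
  ((σ : ℤ) : ℂ) ^ ((∑ i, S.form x (S.beta i)) +
    (S.k : ℂ) * S.form (x + ∑ i, S.form (S.beta i) x • S.gam i)
      (x + ∑ i, S.form (S.beta i) x • S.gam i))

/-- The signed mock theta function `Θ^{±;L}_{λ,T}`. -/
def signedMockTheta (σ : ℤˣ) (lam : AffineDual V) (τ : ℂ) (z : V) (t : ℂ) : ℂ :=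
  mockTheta S.form S.L (S.eps σ) Finset.univ S.beta lam τ z t

/-- The factor
`Φ̃^{±[k|γ_p|²/2; (λ|γ_p)]}(τ, -β_p, β_p + γ_p^∨ + ∑_{i<p} (γ_p^∨|γ_i) β_i)`, evaluated at `z`. -/
def factor (σ : ℤˣ) (lam : AffineDual V) (p : Fin n) (τ : ℂ) (z : V) : ℂ :=
  PhiMod σ (S.k / 2 * (S.form (S.gam p) (S.gam p)).re) (S.form lam.bar (S.gam p)).re τ
    (-S.form (S.beta p) z)
    (S.form (S.beta p) z + S.form (coroot S.form (S.gam p)) z +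
      ∑ i ∈ Finset.univ.filter (fun i : Fin n => i < p),
        S.form (coroot S.form (S.gam p)) (S.gam i) * S.form (S.beta i) z)

/-- The mock theta function `Θ^{±;L_s}_{λ_s,T_s}` (here `s < n` is the index `p`), written with the
summation over multiples of the first basis vector `γ' := γ_{s+1} + ∑_{p ≤ s} (γ_{s+1}|γ_p) β_p`
of `L_s` carried out:
the sum over `γ` in the span of the other basis vectors of
`ε(γ) q^{|λ_s + kγ|²/2k} e^{2πi (λ_{s+1} + kγ)(z)} / ∏_{β ∈ T_{s+1}} (1 - q^{-(γ|β)} e^{-2πi β(z)})`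
times
`Ψ^{±[k|γ'|²/2; (λ_s|γ')]}(τ, -β_{s+1}, β_{s+1} + γ'^∨ + τ (γ|γ'^∨ + 2β_{s+1}))`.
For `Ψ = Phi` this series is `Θ^{±;L_s}_{λ_s,T_s}` itself; the modification step is to replace
`Phi` by `PhiMod`. -/
def expansion (Ψ : ℤˣ → ℝ → ℝ → ℂ → ℂ → ℂ → ℂ) (σ : ℤˣ) (lam : AffineDual V) (p : Fin n)
    (τ : ℂ) (z : V) (t : ℂ) : ℂ :=
  let γ' := S.stageVec p (Fin.castLE S.n_le p)
  let lam₀ := S.stageWeight p lam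
  let lam₁ := S.stageWeight (p + 1) lam
  exp (2 * Real.pi * I * lam.level * t) *
    ∑' γ : S.stageRest p, S.eps σ γ *
      exp (2 * Real.pi * I * (τ *
        (S.form (lam₀.bar + lam.level • (γ : V)) (lam₀.bar + lam.level • (γ : V)) /
          (2 * lam.level)))) *
      exp (2 * Real.pi * I * S.form (lam₁.bar + lam.level • (γ : V)) z) /
      (∏ j ∈ S.stageT (p + 1), (1 - exp (-(2 * Real.pi * I * (τ * S.form γ (S.beta j)))) *
        exp (-(2 * Real.pi * I * S.form (S.beta j) z)))) *
      Ψ σ (S.k / 2 * (S.form γ' γ').re) (S.form lam₀.bar γ').re τ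
        (-S.form (S.beta p) z)
        (S.form (S.beta p) z + S.form (coroot S.form γ') z +
          τ * S.form γ (coroot S.form γ' + (2 : ℂ) • S.beta p))

/-- The function `Θ̃^{±;s;L}_{λ,T}` obtained after `s` modification steps. After `s` steps it is the
product of `s` factors `Φ̃` and of `Θ^{±;L_s}_{λ_s,T_s}`; the next step modifies the latter. -/
def modStage (σ : ℤˣ) (lam : AffineDual V) (s : ℕ) (τ : ℂ) (z : V) (t : ℂ) : ℂ :=
  match s with
  | 0 => S.signedMockTheta σ lam τ z t
  | s + 1 =>
    if h : s < n then
      S.expansion PhiMod σ lam ⟨s, h⟩ τ z t *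
        ∏ p ∈ Finset.univ.filter (fun p : Fin n => (p : ℕ) < s), S.factor σ lam p τ z
    else 0

/-- The signed modified mock theta function `Θ̃^{±;L}_{λ,T}`, obtained after `n = |T|` steps. -/
def modTheta (σ : ℤˣ) (lam : AffineDual V) (τ : ℂ) (z : V) (t : ℂ) : ℂ :=
  S.modStage σ lam n τ z t

/-- The lattice `M = L_n`. -/
def M : Submodule ℤ V := S.stageLattice n

/-- The signed theta function `Θ^{±;L_n}_λ`, with the sign `(±1)^{k|γ|²}`. -/
def signedTheta (σ : ℤˣ) (lam : AffineDual V) (τ : ℂ) (z : V) (t : ℂ) : ℂ :=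
  mockTheta S.form S.M (fun x => ((σ : ℤ) : ℂ) ^ ((S.k : ℂ) * S.form x x)) (∅ : Finset (Fin n))
    S.beta lam τ z t

/-- `w` is the orthogonal projection `z^{(1)}` of `z` to `ℂM`. -/
def IsProjM (z w : V) : Prop :=
  w ∈ Submodule.span ℂ (S.M : Set V) ∧ ∀ x ∈ S.M, S.form (z - w) x = 0

/-- The dual lattice `M* ⊂ ℂM`. -/
def Mdual : AddSubgroup V where
  carrier := {x | x ∈ Submodule.span ℂ (S.M : Set V) ∧ ∀ y ∈ S.M, ∃ a : ℤ, S.form x y = a}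
  zero_mem' := ⟨Submodule.zero_mem _, fun y _ => ⟨0, by simp⟩⟩
  add_mem' := by
    rintro x x' ⟨hx, hx'⟩ ⟨hy, hy'⟩
    refine ⟨Submodule.add_mem _ hx hy, fun y hM => ?_⟩
    obtain ⟨a, ha⟩ := hx' y hM
    obtain ⟨b, hb⟩ := hy' y hM
    exact ⟨a + b, by simp [ha, hb]⟩
  neg_mem' := by
    rintro x ⟨hx, hx'⟩
    refine ⟨Submodule.neg_mem _ hx, fun y hM => ?_⟩
    obtain ⟨a, ha⟩ := hx' y hM
    exact ⟨-a, by simp [ha]⟩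

/-- The lattice `kM`. -/
def kM : AddSubgroup V :=
  S.M.toAddSubgroup.map (DistribSMul.toAddMonoidHom V (S.k : ℂ))

/-- `|M* / kM|`. -/
def index : ℕ := S.kM.relIndex S.Mdual

/-- Congruence of weights modulo `kM + M^⊥ + ℂδ`. -/
def Congruent (mu nu : AffineDual V) : Prop :=
  ∃ x ∈ S.kM, ∃ y : V, (∀ w ∈ S.M, S.form y w = 0) ∧ ∃ a : ℂ, mu - nu = (x + y, 0, a)

/-- `A` is a system of representatives of `P_{k,T}` modulo `kM + M^⊥ + ℂδ`. -/
def IsRepresentatives (A : Finset (AffineDual V)) : Prop :=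
  (∀ mu ∈ A, mu ∈ S.PT) ∧ ∀ nu ∈ S.PT, ∃! mu, mu ∈ A ∧ S.Congruent nu mu

/-- The points `(τ, z)`, `Im τ > 0`, off the poles `β_p(z) ∈ ℤ + ℤτ` of the functions
`Φ̃(τ, -β_p, ·)`, i.e. the points at which the modified mock theta functions are defined. -/
def Regular (τ : ℂ) (z : V) : Prop :=
  0 < τ.im ∧ ∀ (p : Fin n) (a b : ℤ), S.form (S.beta p) z ≠ a + b * τ

/-- The factor `i^n (-iτ)^{dim h / 2} |M* / kM|^{-1/2}`. -/
def sFactor (τ : ℂ) : ℂ :=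
  I ^ n * (-I * τ) ^ ((Module.finrank ℂ V : ℂ) / 2) * ((Real.sqrt (S.index : ℝ))⁻¹ : ℝ)

end Setting

end SignedMock

end

open Complex

noncomputable section

namespace SignedMock

/-! ### Signs -/

/-! Everything rests on the product formula (a), that is `modTheta_eq`. In the last modification
step the series runs over vectors x in the span of the γ_i with i > n, and the second variable of
`PhiMod` is displaced by bτ, where m b = k(x|γ_p) is an integer (here m = k|γ_p|²/2). `PhiMod` is
quasi-periodic under such a displacement, so it leaves the sum with a factor e^{-2πi k(x|γ_p) z₁},
z₁ = -β_p(z). This factor is exactly what turns the partially shifted vector into its image in M,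
and a theta series of M remains.

Quasi-periodicity is the gain from the modification. For `Phi` the displacement replaces the index s
by s + a, and raising s by one changes `Phi` by an exponential times a theta function. The window s
≤ j < s + 2m of the modifier slides at the same time, and the corresponding change of the modifier
compensates (`PhiMod_index_add_one`).

The inversion τ ↦ -1/τ of `PhiMod` (`PhiMod_S`) is proved by fixing z₁ and studying the difference D
of both sides as a function of z₂. Only R depends on z₂ non-holomorphically, and its ∂̄-derivative
is a Gaussian times a conjugate theta function; hence ∂̄ of `PhiMod` is a Gaussian times a hermitian
pairing of theta functions. That pairing is covariant because the transformation matrix of the theta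
functions is unitary up to a scalar. So D is entire, with multipliers 1 and e^{-2πi z₁} for the
periods 1/m and τ/m, and Liouville's theorem gives D = 0 when z₁ is off the lattice.

The theta series of M is inverted by multidimensional Poisson summation (`tsum_quad_S`, `thetaM_S`).
The dual sum over M* is sorted by classes modulo kM, which correspond to the classes of P_{k,T}; the
determinant of the Gram matrix of k(·|·) on M is |M*/kM|. The exponentials of the rank one factors
add up to the part of |z|² orthogonal to M (`IsProjM.sum_factorArg`), and the powers of τ combine
through n + (m - n)/2 = dim h/2.

The sign variants are handled together by `HasType`: a weight has type σ' if it induces on L the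
character (σ')^{k|γ|²}. Weights in P_{k,T} have type 1, and adding ξ₀ gives type -1. Inversion
exchanges the sign of the function with the type of the weight, which yields the four formulas of
(b) at once; τ ↦ τ + 1 keeps the weight and multiplies the sign by minus the type, which yields (c).
-/

theorem sign_ne_zero (σ : ℤˣ) : ((σ : ℤ) : ℂ) ≠ 0 := by simp

theorem sign_mul_self (σ : ℤˣ) : ((σ : ℤ) : ℂ) * ((σ : ℤ) : ℂ) = 1 := by
  rcases Int.units_eq_one_or σ with rfl | rfl <;> simp

theorem norm_sign_zpow (σ : ℤˣ) (n : ℤ) : ‖((σ : ℤ) : ℂ) ^ n‖ = 1 := by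
  rcases Int.units_eq_one_or σ with rfl | rfl <;> simp

theorem conj_sign_zpow (σ : ℤˣ) (n : ℤ) :
    (starRingEnd ℂ) (((σ : ℤ) : ℂ) ^ n) = ((σ : ℤ) : ℂ) ^ n := by
  simp

theorem sign_zpow_neg (σ : ℤˣ) (n : ℤ) : ((σ : ℤ) : ℂ) ^ (-n) = ((σ : ℤ) : ℂ) ^ n := by
  rw [zpow_neg, ← inv_zpow, inv_eq_of_mul_eq_one_left (sign_mul_self σ)]

theorem sign_zpow_add_one (σ : ℤˣ) (n : ℤ) :
    ((σ : ℤ) : ℂ) ^ (n + 1) = ((σ : ℤ) : ℂ) * ((σ : ℤ) : ℂ) ^ n := by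
  rw [zpow_add_one₀ (sign_ne_zero σ), mul_comm]

/-! ### Translation of the second variable -/

/-- Completing the square recentres the index at j + mb. No integrality of b is needed, as the index
is allowed to be real. -/
theorem theta1_add_mul (σ : ℤˣ) (j : ℝ) {m : ℝ} (hm : m ≠ 0) (b : ℝ) (τ z : ℂ) :
    theta1 σ j m τ (z + b * τ) =
      exp (-(Real.pi * I * (m * b * z + m * b ^ 2 / 2 * τ))) * theta1 σ (j + m * b) m τ z := by
  have hm' : (m : ℂ) ≠ 0 := by exact_mod_cast hm
  rw [theta1, theta1, ← tsum_mul_left]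
  refine tsum_congr fun n => ?_
  rw [mul_left_comm, ← Complex.exp_add]
  congr 2
  push_cast
  field_simp
  ring

theorem R_sub_mul (σ : ℤˣ) (j : ℝ) {m : ℝ} (hm : m ≠ 0) (b : ℝ) {τ : ℂ} (hτ : τ.im ≠ 0) (u : ℂ) :
    R σ j m τ (u - b * τ / 2) =
      exp (Real.pi * I * m * b ^ 2 / 2 * τ - 2 * Real.pi * I * m * b * u) *
        R σ (j + m * b) m τ u := by
  have hm' : (m : ℂ) ≠ 0 := by exact_mod_cast hm
  rw [R, R, ← tsum_mul_left]
  refine tsum_congr fun l => ?_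
  have h1 : psi m (j + 2 * m * l) τ (u - b * τ / 2) = psi m (j + m * b + 2 * m * l) τ u := by
    have : (u - b * τ / 2).im = u.im - b * τ.im / 2 := by
      simp
    rw [psi, psi, this]
    congr 1
    field_simp
    ring
  -- The sign depends on l only, not on j, so recentring j leaves it alone.
  have h2 : j + m * b + 2 * m * l - 1 / 2 - (j + m * b) + 2 * m
      = j + 2 * m * l - 1 / 2 - j + 2 * m := by ring
  rw [h1, h2, mul_left_comm, ← Complex.exp_add]
  congr 2
  push_cast
  field_simp
  ring

theorem Phi_add_mul (σ : ℤˣ) (m s b : ℝ) (τ z₁ z₂ : ℂ) :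
    Phi σ m s τ z₁ (z₂ + b * τ) =
      exp (-(2 * Real.pi * I * m * b * z₁)) * Phi σ m (s + m * b) τ z₁ z₂ := by
  rw [Phi, Phi, ← tsum_mul_left]
  refine tsum_congr fun n => ?_
  rw [← mul_div_assoc, mul_left_comm, ← Complex.exp_add]
  congr 3
  push_cast
  ring

/-- The arguments (z₁ - z₂)/2 and z₁ + z₂ move in opposite directions, so the quadratic factors in b
produced by `R` and `theta1` cancel; what is left depends on z₁ only and agrees with the factor of
`Phi`. -/
theorem PhiMod_add_mul (σ : ℤˣ) {m : ℝ} (hm : m ≠ 0) (s b : ℝ) {τ : ℂ} (hτ : τ.im ≠ 0)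
    (z₁ z₂ : ℂ) :
    PhiMod σ m s τ z₁ (z₂ + b * τ) =
      exp (-(2 * Real.pi * I * m * b * z₁)) * PhiMod σ m (s + m * b) τ z₁ z₂ := by
  rw [PhiMod, PhiMod, Phi_add_mul, PhiAdd, PhiAdd, mul_sub, mul_left_comm _ (1 / 2 : ℂ)]
  congr 2
  rw [Finset.mul_sum]
  refine Finset.sum_congr rfl fun i _ => ?_
  have h1 : (z₁ - (z₂ + b * τ)) / 2 = (z₁ - z₂) / 2 - b * τ / 2 := by ring
  have h2 : s + m * b + (i : ℝ) = s + i + m * b := by ring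
  rw [h1, R_sub_mul σ _ hm b hτ, ← add_assoc, theta1_add_mul σ _ hm, h2, mul_mul_mul_comm,
    ← Complex.exp_add]
  congr 2
  ring

/-! ### Periodicity in the second variable -/

theorem exp_two_pi_mul_I_int (n : ℤ) : exp (2 * Real.pi * I * n) = 1 := by
  rw [mul_comm]
  exact Complex.exp_int_mul_two_pi_mul_I n

theorem exp_eq_of_sub_int {x y : ℂ} (n : ℤ) (h : x = y + 2 * Real.pi * I * n) :
    exp x = exp y := by
  rw [h, Complex.exp_add, exp_two_pi_mul_I_int, mul_one]

theorem theta1_add_inv (σ : ℤˣ) (j : ℝ) {m : ℝ} (hm : m ≠ 0) (τ z : ℂ) :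
    theta1 σ j m τ (z + 1 / m) = exp (Real.pi * I * j / m) * theta1 σ j m τ z := by
  have hm' : (m : ℂ) ≠ 0 := by exact_mod_cast hm
  rw [theta1, theta1, ← tsum_mul_left]
  refine tsum_congr fun n => ?_
  rw [mul_left_comm, ← Complex.exp_add]
  congr 1
  refine exp_eq_of_sub_int n ?_
  field_simp
  ring

theorem R_sub_inv (σ : ℤˣ) (j : ℝ) {m : ℝ} (hm : m ≠ 0) (τ u : ℂ) :
    R σ j m τ (u - 1 / (2 * m)) = exp (-(Real.pi * I * j / m)) * R σ j m τ u := by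
  have hm' : (m : ℂ) ≠ 0 := by exact_mod_cast hm
  rw [R, R, ← tsum_mul_left]
  refine tsum_congr fun l => ?_
  have h1 : psi m (j + 2 * m * l) τ (u - 1 / (2 * m)) = psi m (j + 2 * m * l) τ u := by
    have : (u - 1 / (2 * m)).im = u.im := by
      have : (1 / (2 * m) : ℂ) = ((1 / (2 * m) : ℝ) : ℂ) := by push_cast; rfl
      rw [this, Complex.sub_im, Complex.ofReal_im, sub_zero]
    rw [psi, psi, this]
  rw [h1, mul_left_comm, ← Complex.exp_add]
  congr 1
  refine exp_eq_of_sub_int (-l) ?_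
  push_cast
  field_simp
  ring

/-- `Phi` is periodic term by term; in the modifier the factors e^{πij/m} of `theta1` and e^{-πij/m}
of `R` are inverse to each other. -/
theorem PhiMod_add_inv (σ : ℤˣ) {m : ℝ} (hm : m ≠ 0) (s : ℝ) (τ z₁ z₂ : ℂ) :
    PhiMod σ m s τ z₁ (z₂ + 1 / m) = PhiMod σ m s τ z₁ z₂ := by
  have hm' : (m : ℂ) ≠ 0 := by exact_mod_cast hm
  rw [PhiMod, PhiMod]
  congr 1
  · refine tsum_congr fun n => ?_
    congr 2
    refine exp_eq_of_sub_int n ?_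
    field_simp
    ring
  · rw [PhiAdd, PhiAdd]
    congr 1
    refine Finset.sum_congr rfl fun i _ => ?_
    have h1 : (z₁ - (z₂ + 1 / m)) / 2 = (z₁ - z₂) / 2 - 1 / (2 * m) := by
      field_simp
      ring
    rw [h1, R_sub_inv σ _ hm, ← add_assoc, theta1_add_inv σ _ hm, mul_mul_mul_comm,
      ← Complex.exp_add, neg_add_cancel, Complex.exp_zero, one_mul]

/-! ### The transformation `τ ↦ τ + 1` -/

section Translation

variable {σ' : ℤˣ} {N : ℕ} {m s : ℝ}

/-- For odd N the integers N n² and n have the same parity, hence e^{2πi m n²} = (-1)^n. This is the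
source of the change of sign under τ ↦ τ + 1. -/
theorem exp_quadratic (hN : Odd N) (hm : 2 * m = N)
    (hs : ∀ n : ℤ, exp (2 * Real.pi * I * (n * s)) = ((σ' : ℤ) : ℂ) ^ n) (n : ℤ) :
    exp (2 * Real.pi * I * (m * n ^ 2 + s * n)) = (((-σ' : ℤˣ) : ℤ) : ℂ) ^ n := by
  have hm' : (2 : ℂ) * m = N := by exact_mod_cast hm
  have h1 : (2 * Real.pi * I * (m * n ^ 2 + s * n) : ℂ)
      = ((N * n ^ 2 : ℤ) : ℂ) * (Real.pi * I) + 2 * Real.pi * I * (n * s) := by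
    push_cast
    rw [← hm']
    ring
  have h2 : Odd (N : ℤ) := by exact_mod_cast hN
  rw [h1, Complex.exp_add, hs, Complex.exp_int_mul, Complex.exp_pi_mul_I]
  have h3 : ((-1 : ℂ)) ^ (N * n ^ 2 : ℤ) = (-1) ^ n := by
    rcases Int.even_or_odd n with h | h
    · rw [h.neg_one_zpow, Even.neg_one_zpow]
      exact (h.pow_of_ne_zero two_ne_zero).mul_left _
    · rw [h.neg_one_zpow, Odd.neg_one_zpow]
      exact h2.mul h.pow
  rw [h3, ← mul_zpow]
  simp

theorem Phi_add_one (hN : Odd N) (hm : 2 * m = N)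
    (hs : ∀ n : ℤ, exp (2 * Real.pi * I * (n * s)) = ((σ' : ℤ) : ℂ) ^ n) (σ : ℤˣ) (τ z₁ z₂ : ℂ) :
    Phi σ m s (τ + 1) z₁ z₂ = Phi (σ * -σ') m s τ z₁ z₂ := by
  refine tsum_congr fun n => ?_
  have h1 : exp (2 * Real.pi * I * (z₁ + n * (τ + 1))) = exp (2 * Real.pi * I * (z₁ + n * τ)) :=
    exp_eq_of_sub_int n (by ring)
  have h2 : (2 * Real.pi * I * (m * n * (z₁ + z₂) + s * z₁ + (τ + 1) * (m * n ^ 2 + s * n)) : ℂ)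
      = 2 * Real.pi * I * (m * n ^ 2 + s * n)
        + 2 * Real.pi * I * (m * n * (z₁ + z₂) + s * z₁ + τ * (m * n ^ 2 + s * n)) := by ring
  rw [h1, h2, Complex.exp_add, exp_quadratic hN hm hs, ← mul_assoc, ← mul_zpow]
  simp

theorem theta1_add_one (hN : Odd N) (hm : 2 * m = N)
    (hs : ∀ n : ℤ, exp (2 * Real.pi * I * (n * s)) = ((σ' : ℤ) : ℂ) ^ n) (σ : ℤˣ) (i : ℕ)
    (τ z : ℂ) :
    theta1 σ (s + i) m (τ + 1) z =
      exp (Real.pi * I * (s + i) ^ 2 / (2 * m)) * theta1 (σ * -σ') (s + i) m τ z := by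
  have hm0 : (m : ℂ) ≠ 0 := by
    rintro h
    have : m = 0 := by exact_mod_cast h
    rw [this, mul_zero, eq_comm, Nat.cast_eq_zero] at hm
    rw [hm] at hN
    exact absurd hN (by decide)
  rw [theta1, theta1, ← tsum_mul_left]
  refine tsum_congr fun n => ?_
  have h2 : exp (2 * Real.pi * I * (m * z * (n + ((s + i : ℝ) : ℂ) / (2 * m))
        + (τ + 1) * m * (n + ((s + i : ℝ) : ℂ) / (2 * m)) ^ 2) : ℂ)
      = exp (2 * Real.pi * I * (m * n ^ 2 + s * n) + (Real.pi * I * (s + i) ^ 2 / (2 * m)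
        + 2 * Real.pi * I * (m * z * (n + ((s + i : ℝ) : ℂ) / (2 * m))
        + τ * m * (n + ((s + i : ℝ) : ℂ) / (2 * m)) ^ 2))) := by
    -- The cross term of m(n + (s+i)/2m)² is n(s + i); its part n i is an integer and drops out.
    refine exp_eq_of_sub_int (i * n) ?_
    push_cast
    field_simp
    ring
  rw [h2, Complex.exp_add, exp_quadratic hN hm hs, Complex.exp_add, mul_left_comm (exp _),
    ← mul_assoc, ← mul_zpow]
  simp

theorem R_add_one (hN : Odd N) (hm : 2 * m = N)
    (hs : ∀ n : ℤ, exp (2 * Real.pi * I * (n * s)) = ((σ' : ℤ) : ℂ) ^ n) (σ : ℤˣ) (i : ℕ)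
    (τ u : ℂ) :
    R σ (s + i) m (τ + 1) u =
      exp (-(Real.pi * I * (s + i) ^ 2 / (2 * m))) * R (σ * -σ') (s + i) m τ u := by
  have hm0 : (m : ℂ) ≠ 0 := by
    rintro h
    have : m = 0 := by exact_mod_cast h
    rw [this, mul_zero, eq_comm, Nat.cast_eq_zero] at hm
    rw [hm] at hN
    exact absurd hN (by decide)
  rw [R, R, ← tsum_mul_left]
  refine tsum_congr fun n => ?_
  have h1 : psi m (s + i + 2 * m * n) (τ + 1) u = psi m (s + i + 2 * m * n) τ u := by
    simp [psi]
  have h2 : exp (-(Real.pi * I * ((s + i + 2 * m * n : ℝ) : ℂ) ^ 2 / (2 * m)) * (τ + 1)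
        + 2 * Real.pi * I * ((s + i + 2 * m * n : ℝ) : ℂ) * u)
      = exp (2 * Real.pi * I * (m * ((-n : ℤ) : ℂ) ^ 2 + s * ((-n : ℤ) : ℂ))
        + (-(Real.pi * I * (s + i) ^ 2 / (2 * m))
        + (-(Real.pi * I * ((s + i + 2 * m * n : ℝ) : ℂ) ^ 2 / (2 * m)) * τ
        + 2 * Real.pi * I * ((s + i + 2 * m * n : ℝ) : ℂ) * u))) := by
    -- The power of q in `R` is negative. Its term -m n² becomes m n² at the cost of the integer N
    -- n², and `exp_quadratic` then applies at -n; the sign does not distinguish n from -n.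
    refine exp_eq_of_sub_int (-(N * n ^ 2 + i * n)) ?_
    have hm' : (N : ℂ) = 2 * m := by exact_mod_cast hm.symm
    push_cast
    rw [hm']
    field_simp
    ring
  rw [h1, h2, Complex.exp_add, exp_quadratic hN hm hs, sign_zpow_neg, Complex.exp_add]
  have h3 : (((σ * -σ' : ℤˣ) : ℤ) : ℂ) ^ n = ((σ : ℤ) : ℂ) ^ n * (((-σ' : ℤˣ) : ℤ) : ℂ) ^ n := by
    rw [← mul_zpow]
    simp
  rw [h3]
  ring

theorem PhiMod_add_one (hN : Odd N) (hm : 2 * m = N)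
    (hs : ∀ n : ℤ, exp (2 * Real.pi * I * (n * s)) = ((σ' : ℤ) : ℂ) ^ n) (σ : ℤˣ) (τ z₁ z₂ : ℂ) :
    PhiMod σ m s (τ + 1) z₁ z₂ = PhiMod (σ * -σ') m s τ z₁ z₂ := by
  rw [PhiMod, PhiMod, Phi_add_one hN hm hs, PhiAdd, PhiAdd]
  congr 2
  refine Finset.sum_congr rfl fun i _ => ?_
  rw [theta1_add_one hN hm hs, R_add_one hN hm hs, mul_mul_mul_comm, ← Complex.exp_add,
    neg_add_cancel, Complex.exp_zero, one_mul]

end Translation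

/-! ### The error function -/

theorem continuous_gaussian : Continuous fun u : ℝ => Real.exp (-Real.pi * u ^ 2) := by
  fun_prop

theorem hasDerivAt_E (x : ℝ) : HasDerivAt E (2 * Real.exp (-Real.pi * x ^ 2)) x :=
  (continuous_gaussian.integral_hasStrictDerivAt 0 x).hasDerivAt.const_mul 2

theorem E_sub (x y : ℝ) : E y - E x = 2 * ∫ u in x..y, Real.exp (-Real.pi * u ^ 2) := by
  rw [E, E, ← mul_sub, intervalIntegral.integral_interval_sub_left] <;>
  exact continuous_gaussian.intervalIntegrable _ _

theorem E_neg (x : ℝ) : E (-x) = -E x := by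
  have := intervalIntegral.integral_comp_neg (a := 0) (b := x)
    (fun u : ℝ => Real.exp (-Real.pi * u ^ 2))
  simp only [neg_sq, neg_zero] at this
  rw [E, E, this, intervalIntegral.integral_symm]
  ring

theorem E_mono : Monotone E := by
  intro x y h
  have : 0 ≤ E y - E x := by
    rw [E_sub]
    exact mul_nonneg two_pos.le (intervalIntegral.integral_nonneg h fun u _ => (Real.exp_pos _).le)
  linarith

theorem tendsto_E : Filter.Tendsto E Filter.atTop (nhds 1) := by
  have h := (MeasureTheory.intervalIntegral_tendsto_integral_Ioi 0
    ((integrable_exp_neg_mul_sq Real.pi_pos).integrableOn) Filter.tendsto_id).const_mul 2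
  rwa [integral_gaussian_Ioi, div_self Real.pi_ne_zero, Real.sqrt_one,
    mul_div_cancel₀ _ two_ne_zero] at h

theorem E_le_one (x : ℝ) : E x ≤ 1 := E_mono.ge_of_tendsto tendsto_E x

/-- For u ≥ x ≥ 0 one has u² ≥ x² + (u - x)², so the tail beyond x is at most e^{-πx²} times the
tail beyond 0. -/
theorem one_sub_E_le {x : ℝ} (hx : 0 ≤ x) : 1 - E x ≤ Real.exp (-Real.pi * x ^ 2) := by
  have h1 : Filter.Tendsto (fun X => E X - E x) Filter.atTop (nhds (1 - E x)) :=
    tendsto_E.sub_const _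
  refine le_of_tendsto h1 ((Filter.eventually_ge_atTop x).mono fun X hX => ?_)
  have h2 : ∫ u in x..X, Real.exp (-Real.pi * u ^ 2) ≤
      ∫ u in x..X, Real.exp (-Real.pi * x ^ 2) * Real.exp (-Real.pi * (u - x) ^ 2) := by
    refine intervalIntegral.integral_mono_on hX (continuous_gaussian.intervalIntegrable _ _)
      (Continuous.intervalIntegrable (by fun_prop) _ _) fun u hu => ?_
    rw [← Real.exp_add, Real.exp_le_exp]
    nlinarith [mul_nonneg Real.pi_pos.le (mul_nonneg hx (sub_nonneg.2 hu.1))]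
  rw [intervalIntegral.integral_const_mul,
    intervalIntegral.integral_comp_sub_right (fun u => Real.exp (-Real.pi * u ^ 2)),
    sub_self] at h2
  have h3 := E_le_one (X - x)
  rw [E] at h3
  rw [E_sub]
  nlinarith [Real.exp_pos (-Real.pi * x ^ 2)]

/-- The slack c covers the finitely many indices at which the sign in `R` and the sign of `psi`
disagree; there the trivial bound 2 is absorbed by the constant e^{πc²}. -/
theorem abs_one_sub_E_le {c x : ℝ} (hx : -c ≤ x) :
    |1 - E x| ≤ 2 * Real.exp (Real.pi * c ^ 2) * Real.exp (-Real.pi * x ^ 2) := by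
  rw [abs_of_nonneg (sub_nonneg.2 (E_le_one x))]
  rcases le_total 0 x with h | h
  · have h1 := one_sub_E_le h
    have h2 : 1 ≤ Real.exp (Real.pi * c ^ 2) := Real.one_le_exp (by positivity)
    nlinarith [Real.exp_pos (-Real.pi * x ^ 2)]
  · have h1 : 1 - E x ≤ 2 := by
      have := E_le_one (-x)
      rw [E_neg] at this
      linarith
    have h2 : 1 ≤ Real.exp (Real.pi * c ^ 2) * Real.exp (-Real.pi * x ^ 2) := by
      rw [← Real.exp_add]
      refine Real.one_le_exp ?_
      have : x ^ 2 ≤ c ^ 2 := by nlinarith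
      nlinarith [Real.pi_pos]
    linarith

/-- The sign occurring in `R`. -/
theorem sign_eq {N : ℕ} (hN : 0 < N) {m : ℝ} (hm : 2 * m = N) (j : ℝ) (l : ℤ) :
    Real.sign ((j + 2 * m * l) - 1 / 2 - j + 2 * m) = if 0 ≤ l then 1 else -1 := by
  -- The half separates l = -1, with value -1/2, from l = 0, with value 2m - 1/2, which is positive
  -- because 2m ≥ 1.
  have h1 : (j + 2 * m * l) - 1 / 2 - j + 2 * m = 2 * m * (l + 1) - 1 / 2 := by ring
  have hN' : (1 : ℝ) ≤ N := by exact_mod_cast hN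
  rw [h1, hm]
  split_ifs with h
  · have h' : (0 : ℝ) ≤ l := by exact_mod_cast h
    rw [Real.sign_of_pos]
    nlinarith
  · have h' : (l : ℝ) ≤ -1 := by exact_mod_cast (by lia : l ≤ -1)
    rw [Real.sign_of_neg]
    nlinarith

/-! ### The terms of the series `R` -/

/-- The exponential in the term of index `l` of `R`. -/
def rExp (j m : ℝ) (τ : ℂ) (l : ℤ) (u : ℂ) : ℂ :=
  exp (-(Real.pi * I * ((j + 2 * m * l : ℝ) : ℂ) ^ 2 / (2 * m)) * τ
    + 2 * Real.pi * I * ((j + 2 * m * l : ℝ) : ℂ) * u)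

/-- The term of index `l` of `R`, without its sign. -/
def rTerm (j m : ℝ) (τ : ℂ) (l : ℤ) (u : ℂ) : ℂ :=
  ((Real.sign ((j + 2 * m * l) - 1 / 2 - j + 2 * m) - E (psi m (j + 2 * m * l) τ u) : ℝ) : ℂ) *
    rExp j m τ l u

theorem R_eq_tsum (σ : ℤˣ) (j m : ℝ) (τ u : ℂ) :
    R σ j m τ u = ∑' l : ℤ, ((σ : ℤ) : ℂ) ^ l * rTerm j m τ l u :=
  tsum_congr fun _ => mul_assoc _ _ _

/-- The bound for the terms of theta series used throughout. -/
def gaussBound (S T : ℝ) (l : ℤ) : ℝ := Real.exp (-Real.pi * (T * l ^ 2 - 2 * S * |l|))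

theorem summable_gaussBound (S : ℝ) {T : ℝ} (hT : 0 < T) : Summable (gaussBound S T) :=
  (summable_pow_mul_jacobiTheta₂_term_bound S hT 0).congr fun l => by rw [gaussBound, pow_zero, one_mul]

theorem summable_abs_mul_gaussBound (S : ℝ) {T : ℝ} (hT : 0 < T) :
    Summable fun l : ℤ => (|l| : ℝ) * gaussBound S T l :=
  (summable_pow_mul_jacobiTheta₂_term_bound S hT 1).congr fun l => by
    rw [gaussBound, pow_one, Int.cast_abs]

section Bounds

variable {m : ℝ} {τ : ℂ} {S : ℝ}

/-- With r = j + 2ml, the exponential grows like e^{π r² Im τ/2m}, but the Gaussian in `psi` decays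
at twice that rate. The bound is uniform on horizontal strips, as termwise differentiation requires.
-/
theorem norm_gauss_mul_rExp_le (hm : 0 < m) (j : ℝ) (hτ : 0 < τ.im)
    {u : ℂ} (hu : |u.im| ≤ S) (l : ℤ) :
    Real.exp (-Real.pi * psi m (j + 2 * m * l) τ u ^ 2) * ‖rExp j m τ l u‖ ≤
      gaussBound (|j| * τ.im + 2 * m * S) (2 * m * τ.im) l := by
  have hy := hτ.ne'
  have hm' := hm.ne'
  have h1 : (-(Real.pi * I * ((j + 2 * m * l : ℝ) : ℂ) ^ 2 / (2 * m)) * τ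
      + 2 * Real.pi * I * ((j + 2 * m * l : ℝ) : ℂ) * u).re
      = Real.pi * (j + 2 * m * l) ^ 2 / (2 * m) * τ.im
        - 2 * Real.pi * (j + 2 * m * l) * u.im := by
    have : (-(Real.pi * I * ((j + 2 * m * l : ℝ) : ℂ) ^ 2 / (2 * m)) * τ
        + 2 * Real.pi * I * ((j + 2 * m * l : ℝ) : ℂ) * u)
        = (((-(Real.pi * (j + 2 * m * l) ^ 2 / (2 * m)) : ℝ) : ℂ) * τ
          + ((2 * Real.pi * (j + 2 * m * l) : ℝ) : ℂ) * u) * I := by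
      push_cast
      ring
    rw [this, Complex.mul_I_re, Complex.add_im, Complex.im_ofReal_mul, Complex.im_ofReal_mul]
    ring
  rw [rExp, Complex.norm_exp, ← Real.exp_add, gaussBound, Real.exp_le_exp, h1, psi, mul_pow,
    Real.sq_sqrt (by positivity)]
  obtain ⟨a, ha⟩ : ∃ a, a = u.im / τ.im := ⟨_, rfl⟩
  have hua : u.im = a * τ.im := by rw [ha]; field_simp
  rw [← ha, hua]
  -- The last two summands are nonnegative and are discarded below; the middle one is linear in l.
  have e1 : -Real.pi * ((j + 2 * m * l - 2 * m * a) ^ 2 * (τ.im / m))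
      + (Real.pi * (j + 2 * m * l) ^ 2 / (2 * m) * τ.im
        - 2 * Real.pi * (j + 2 * m * l) * (a * τ.im))
      = -Real.pi * (2 * m * τ.im * l ^ 2 + 2 * (l * (j * τ.im - 2 * m * (a * τ.im)))
        + τ.im * (j - 2 * m * a) ^ 2 / (2 * m) + 2 * m * a ^ 2 * τ.im) := by
    field_simp
    ring
  have e2 : -(|(l : ℝ)| * (|j| * τ.im + 2 * m * S)) ≤ l * (j * τ.im - 2 * m * (a * τ.im)) := by
    refine le_trans ?_ (neg_abs_le _)
    rw [abs_mul, neg_le_neg_iff]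
    refine mul_le_mul_of_nonneg_left ?_ (abs_nonneg _)
    refine (abs_sub _ _).trans ?_
    rw [← hua, abs_mul, abs_mul, abs_of_pos hτ, abs_of_pos (by positivity : 0 < 2 * m)]
    gcongr
  have e3 : 0 ≤ τ.im * (j - 2 * m * a) ^ 2 / (2 * m) := by positivity
  have e4 : 0 ≤ 2 * m * a ^ 2 * τ.im := by positivity
  rw [e1, Int.cast_abs]
  refine mul_le_mul_of_nonpos_left ?_ (by linarith [Real.pi_pos])
  linarith

/-- The constant in the bound for the terms of `R`. -/
theorem exists_norm_rTerm_le (hm : 0 < m) (j : ℝ) (hτ : 0 < τ.im)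
    {N : ℕ} (hN : 0 < N) (hmN : 2 * m = N) (S : ℝ) :
    ∃ C : ℝ, 0 ≤ C ∧ ∀ (u : ℂ), |u.im| ≤ S → ∀ l : ℤ, ‖rTerm j m τ l u‖ ≤
      C * gaussBound (|j| * τ.im + 2 * m * S) (2 * m * τ.im) l := by
  -- The squared number bounds how far `psi` can lie on the wrong side of 0, given the sign attached
  -- to l and |Im u| ≤ S.
  refine ⟨2 * Real.exp (Real.pi * ((|j| + 2 * m * S / τ.im) * Real.sqrt (τ.im / m)) ^ 2),
    by positivity, fun u hu l => ?_⟩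
  have key : |Real.sign ((j + 2 * m * l) - 1 / 2 - j + 2 * m) - E (psi m (j + 2 * m * l) τ u)| ≤
      2 * Real.exp (Real.pi * ((|j| + 2 * m * S / τ.im) * Real.sqrt (τ.im / m)) ^ 2) *
        Real.exp (-Real.pi * psi m (j + 2 * m * l) τ u ^ 2) := by
    have hua : |2 * m * (u.im / τ.im)| ≤ 2 * m * S / τ.im := by
      rw [abs_mul, abs_of_pos (by positivity : 0 < 2 * m), abs_div, abs_of_pos hτ, mul_div_assoc]
      gcongr
    have hua' := abs_le.1 hua
    have hj := abs_le.1 (le_refl |j|)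
    rw [sign_eq hN hmN]
    split_ifs with hl
    · refine abs_one_sub_E_le ?_
      rw [psi, ← neg_mul]
      refine mul_le_mul_of_nonneg_right ?_ (Real.sqrt_nonneg _)
      have : 0 ≤ 2 * m * (l : ℝ) := by
        have : (0 : ℝ) ≤ l := by exact_mod_cast hl
        positivity
      linarith
    · have h1 : |-1 - E (psi m (j + 2 * m * l) τ u)| = |1 - E (-psi m (j + 2 * m * l) τ u)| := by
        rw [E_neg, ← abs_neg]
        congr 1
        ring
      rw [h1, ← neg_sq (psi m (j + 2 * m * l) τ u)]
      refine abs_one_sub_E_le ?_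
      rw [psi, ← neg_mul, ← neg_mul]
      refine mul_le_mul_of_nonneg_right ?_ (Real.sqrt_nonneg _)
      have : 2 * m * (l : ℝ) ≤ 0 := by
        have : (l : ℝ) ≤ 0 := by exact_mod_cast (by lia : l ≤ 0)
        exact mul_nonpos_of_nonneg_of_nonpos (by positivity) this
      linarith
  rw [rTerm, norm_mul, Complex.norm_real, Real.norm_eq_abs]
  refine (mul_le_mul_of_nonneg_right key (norm_nonneg _)).trans ?_
  rw [mul_assoc]
  exact mul_le_mul_of_nonneg_left (norm_gauss_mul_rExp_le hm j hτ hu l) (by positivity)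

theorem summable_rTerm (hm : 0 < m) (j : ℝ) (hτ : 0 < τ.im)
    {N : ℕ} (hN : 0 < N) (hmN : 2 * m = N) (σ : ℤˣ) (u : ℂ) :
    Summable fun l : ℤ => ((σ : ℤ) : ℂ) ^ l * rTerm j m τ l u := by
  obtain ⟨C, -, hC⟩ := exists_norm_rTerm_le hm j hτ hN hmN |u.im|
  refine Summable.of_norm_bounded (((summable_gaussBound (|j| * τ.im + 2 * m * |u.im|)
    (by positivity : 0 < 2 * m * τ.im))).mul_left C) fun l => ?_
  rw [norm_mul, norm_sign_zpow, one_mul]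
  exact hC u le_rfl l

end Bounds

/-- Raising j by 2m amounts to shifting l by one. The exponentials and error functions follow, but
the place where the sign jumps does not, so one single term changes, by twice its exponential. -/
theorem R_add_two_mul {N : ℕ} (hN : 0 < N) {m : ℝ} (hmN : 2 * m = N) (σ : ℤˣ) (j : ℝ) {τ : ℂ}
    (hτ : 0 < τ.im) (u : ℂ) :
    R σ (j + 2 * m) m τ u = ((σ : ℤ) : ℂ) * (R σ j m τ u - 2 * rExp j m τ 0 u) := by
  have hm : 0 < m := by
    have : (0 : ℝ) < N := by exact_mod_cast hN
    linarith
  have h0 := hasSum_ite_eq (0 : ℤ) (2 * rExp j m τ 0 u)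
  rw [R_eq_tsum, R_eq_tsum, ← h0.tsum_eq, ← (summable_rTerm hm j hτ hN hmN σ u).tsum_sub
    h0.summable, ← tsum_mul_left, ← (Equiv.addRight (1 : ℤ)).tsum_eq
      (fun l => ((σ : ℤ) : ℂ) * (((σ : ℤ) : ℂ) ^ l * rTerm j m τ l u - _))]
  refine tsum_congr fun l => ?_
  have h1 : j + 2 * m + 2 * m * (l : ℝ) = j + 2 * m * ((l + 1 : ℤ) : ℝ) := by
    push_cast
    ring
  have h2 : rTerm (j + 2 * m) m τ l u =
      (((if 0 ≤ l then 1 else -1) - E (psi m (j + 2 * m * ((l + 1 : ℤ) : ℝ)) τ u) : ℝ) : ℂ) *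
        rExp j m τ (l + 1) u := by
    rw [rTerm, sign_eq hN hmN, rExp, rExp, h1]
  rw [Equiv.coe_addRight, h2, rTerm, sign_eq hN hmN, sign_zpow_add_one, mul_sub, ← mul_assoc _ (_ * _),
    ← mul_assoc _ _ (_ ^ _), sign_mul_self, one_mul]
  simp only []
  -- l = -1 is the only index for which l and l + 1 lie on different sides of the jump.
  rcases eq_or_ne (l + 1) 0 with h | h
  · have hl : l = -1 := by lia
    subst hl
    have h3 : (((σ : ℤ) : ℂ)) ^ (-1 : ℤ) = ((σ : ℤ) : ℂ) := by rw [sign_zpow_neg, zpow_one]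
    rw [h3]
    norm_num
    ring
  · have h4 : (0 ≤ l + 1) ↔ (0 ≤ l) := by lia
    simp [h, h4]

/-! ### Summability of `Phi` and independence of `PhiMod` of the class of `s` -/

/-- The summand of `theta1`, as a summand of the Jacobi theta function. -/
theorem theta1_term_eq {m : ℝ} (hm : m ≠ 0) (j : ℝ) (τ z : ℂ) (n : ℤ) :
    exp (2 * Real.pi * I * (m * z * (n + j / (2 * m)) + τ * m * (n + j / (2 * m)) ^ 2)) =
      exp (Real.pi * I * (z * j + τ * j ^ 2 / (2 * m))) *
        jacobiTheta₂_term n (m * z + j * τ) (2 * m * τ) := by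
  have hm' : (m : ℂ) ≠ 0 := by exact_mod_cast hm
  rw [jacobiTheta₂_term, ← Complex.exp_add]
  congr 1
  field_simp
  ring

/-- Denominators `1 - e^{2πi z₁} q^n` vanish nowhere off the lattice. -/
theorem one_sub_exp_ne_zero {τ z : ℂ} (hz : ∀ a b : ℤ, z ≠ a + b * τ) (n : ℤ) :
    1 - exp (2 * Real.pi * I * (z + n * τ)) ≠ 0 := by
  intro h
  have h1 : exp (2 * Real.pi * I * (z + n * τ)) = 1 := (sub_eq_zero.1 h).symm
  obtain ⟨k, hk⟩ := Complex.exp_eq_one_iff.1 h1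
  refine hz k (-n) ?_
  have h2 : (2 * Real.pi * I : ℂ) ≠ 0 := Complex.two_pi_I_ne_zero
  have h3 : z + n * τ = k := mul_left_cancel₀ h2 (by rw [hk]; ring)
  push_cast
  linear_combination h3

/-- For large |n| the exponential has modulus at most 1/2 or at least 2, and finitely many n remain.
At a pole the inverse is 0 by convention, so no condition on z is required. -/
theorem exists_norm_inv_one_sub_exp_le {τ : ℂ} (hτ : 0 < τ.im) (z : ℂ) :
    ∃ C : ℝ, 0 ≤ C ∧ ∀ n : ℤ, ‖(1 - exp (2 * Real.pi * I * (z + n * τ)))⁻¹‖ ≤ C := by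
  -- Outside [-K, K] the imaginary part of z + nτ has absolute value at least 1.
  set K : ℤ := ⌈(1 + |z.im|) / τ.im⌉ with hK
  refine ⟨2 + ∑ n ∈ Finset.Icc (-K) K, ‖(1 - exp (2 * Real.pi * I * (z + n * τ)))⁻¹‖,
    by positivity, fun n => ?_⟩
  by_cases hn : n ∈ Finset.Icc (-K) K
  · have := Finset.single_le_sum (f := fun n : ℤ => ‖(1 - exp (2 * Real.pi * I * (z + n * τ)))⁻¹‖)
      (fun i _ => norm_nonneg _) hn
    linarith
  have hK' : 1 + |z.im| ≤ K * τ.im := (div_le_iff₀ hτ).1 (Int.le_ceil _)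
  have hzi := abs_le.1 (le_refl |z.im|)
  have h1 : ‖exp (2 * Real.pi * I * (z + n * τ))‖ = Real.exp (-(2 * Real.pi * (z.im + n * τ.im))) := by
    have : 2 * Real.pi * I * (z + n * τ) = ((2 * Real.pi : ℝ) : ℂ) * (z + (n : ℝ) * τ) * I := by
      push_cast
      ring
    rw [Complex.norm_exp, this, Complex.mul_I_re, Complex.im_ofReal_mul, Complex.add_im,
      Complex.im_ofReal_mul]
  have h2 : (1 : ℝ) / 2 ≤ ‖1 - exp (2 * Real.pi * I * (z + n * τ))‖ := by
    have h3 := abs_norm_sub_norm_le (1 : ℂ) (exp (2 * Real.pi * I * (z + n * τ)))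
    rw [norm_one, h1] at h3
    refine le_trans ?_ h3
    have hpi := Real.pi_gt_three
    rw [Finset.mem_Icc, not_and_or, not_le, not_le] at hn
    rcases hn with hn | hn
    · have hn' : (n : ℝ) ≤ -K := by exact_mod_cast hn.le
      have h4 : z.im + n * τ.im ≤ -1 := by nlinarith
      have h5 := Real.add_one_le_exp (-(2 * Real.pi * (z.im + n * τ.im)))
      rw [abs_sub_comm]
      refine le_trans ?_ (le_abs_self _)
      nlinarith
    · have hn' : (K : ℝ) ≤ n := by exact_mod_cast hn.le
      have h4 : 1 ≤ z.im + n * τ.im := by nlinarith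
      have h5 := Real.add_one_le_exp (2 * Real.pi * (z.im + n * τ.im))
      have h6 : (2 : ℝ) ≤ Real.exp (2 * Real.pi * (z.im + n * τ.im)) := by nlinarith
      have h7 : Real.exp (-(2 * Real.pi * (z.im + n * τ.im))) ≤ 1 / 2 := by
        rw [Real.exp_neg, one_div]
        gcongr
      refine le_trans ?_ (le_abs_self _)
      linarith
  have h8 : ‖(1 - exp (2 * Real.pi * I * (z + n * τ)))⁻¹‖ ≤ 2 := by
    rw [norm_inv]
    refine inv_le_of_inv_le₀ two_pos ?_
    linarith
  have : 0 ≤ ∑ n ∈ Finset.Icc (-K) K, ‖(1 - exp (2 * Real.pi * I * (z + n * τ)))⁻¹‖ := by positivity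
  linarith

/-- The numerators are Jacobi theta terms and the denominators are bounded away from 0 where they do
not vanish. Uniformity in z₂ on a strip gives holomorphy in z₂. -/
theorem exists_Phi_term_le {m : ℝ} (hm : 0 < m) {τ : ℂ} (hτ : 0 < τ.im) (σ : ℤˣ) (s : ℝ) (z₁ : ℂ)
    (B : ℝ) : ∃ C S : ℝ, ∀ z₂ : ℂ, |z₂.im| ≤ B → ∀ n : ℤ,
    ‖((σ : ℤ) : ℂ) ^ n *
      exp (2 * Real.pi * I * (m * n * (z₁ + z₂) + s * z₁ + τ * (m * n ^ 2 + s * n))) /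
      (1 - exp (2 * Real.pi * I * (z₁ + n * τ)))‖ ≤ C * gaussBound S (2 * m * τ.im) n := by
  obtain ⟨C, hC0, hC⟩ := exists_norm_inv_one_sub_exp_le hτ z₁
  refine ⟨‖exp (2 * Real.pi * I * (s * z₁))‖ * C, m * (|z₁.im| + B) + |s| * τ.im,
    fun z₂ hz n => ?_⟩
  have h1 : exp (2 * Real.pi * I * (m * n * (z₁ + z₂) + s * z₁ + τ * (m * n ^ 2 + s * n)))
      = exp (2 * Real.pi * I * (s * z₁)) *
        jacobiTheta₂_term n (m * (z₁ + z₂) + s * τ) ((2 * m : ℝ) * τ) := by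
    rw [jacobiTheta₂_term, ← Complex.exp_add]
    congr 1
    push_cast
    ring
  have h2 : |((m : ℂ) * (z₁ + z₂) + s * τ).im| ≤ m * (|z₁.im| + B) + |s| * τ.im := by
    rw [Complex.add_im, Complex.im_ofReal_mul, Complex.im_ofReal_mul]
    refine (abs_add_le _ _).trans ?_
    rw [abs_mul, abs_mul, abs_of_pos hm, abs_of_pos hτ, Complex.add_im]
    gcongr
    exact (abs_add_le _ _).trans (by gcongr)
  have h3 : 2 * m * τ.im ≤ (((2 * m : ℝ) : ℂ) * τ).im := by rw [Complex.im_ofReal_mul]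
  have h4 := norm_jacobiTheta₂_term_le (by positivity : 0 < 2 * m * τ.im) h2 h3 n
  rw [div_eq_mul_inv, norm_mul, norm_mul, norm_sign_zpow, one_mul, h1, norm_mul, gaussBound,
    mul_assoc ‖_‖, mul_assoc ‖_‖, mul_comm C]
  gcongr
  exact hC n

theorem summable_Phi {m : ℝ} (hm : 0 < m) {τ : ℂ} (hτ : 0 < τ.im) (σ : ℤˣ) (s : ℝ) (z₁ z₂ : ℂ) :
    Summable fun n : ℤ => ((σ : ℤ) : ℂ) ^ n *
      exp (2 * Real.pi * I * (m * n * (z₁ + z₂) + s * z₁ + τ * (m * n ^ 2 + s * n))) /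
      (1 - exp (2 * Real.pi * I * (z₁ + n * τ))) := by
  obtain ⟨C, S, h⟩ := exists_Phi_term_le hm hτ σ s z₁ |z₂.im|
  exact Summable.of_norm_bounded ((summable_gaussBound S (by positivity : 0 < 2 * m * τ.im)).mul_left C)
    (h z₂ le_rfl)

/-- Raising s by one multiplies the n-th numerator by e^{2πi z₁}q^n, so the difference of numerators
contains the denominator, which cancels off the poles. -/
theorem Phi_sub_add_one {m : ℝ} (hm : 0 < m) {τ : ℂ} (hτ : 0 < τ.im) (σ : ℤˣ) (s : ℝ) {z₁ : ℂ}
    (hz : ∀ a b : ℤ, z₁ ≠ a + b * τ) (z₂ : ℂ) :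
    Phi σ m s τ z₁ z₂ - Phi σ m (s + 1) τ z₁ z₂ =
      rExp s m τ 0 ((z₁ - z₂) / 2) * theta1 σ s m τ (z₁ + z₂) := by
  have hm' : (m : ℂ) ≠ 0 := by exact_mod_cast hm.ne'
  rw [Phi, Phi, ← (summable_Phi hm hτ σ s z₁ z₂).tsum_sub (summable_Phi hm hτ σ (s + 1) z₁ z₂),
    theta1, ← tsum_mul_left]
  refine tsum_congr fun n => ?_
  have h1 : exp (2 * Real.pi * I * (m * n * (z₁ + z₂) + ((s + 1 : ℝ) : ℂ) * z₁
        + τ * (m * n ^ 2 + ((s + 1 : ℝ) : ℂ) * n))) =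
      exp (2 * Real.pi * I * (m * n * (z₁ + z₂) + s * z₁ + τ * (m * n ^ 2 + s * n))) *
        exp (2 * Real.pi * I * (z₁ + n * τ)) := by
    rw [← Complex.exp_add]
    congr 1
    push_cast
    ring
  rw [h1, ← sub_div, ← mul_assoc, ← mul_one_sub, mul_div_assoc,
    div_self (one_sub_exp_ne_zero hz n), mul_one, rExp, mul_left_comm, ← Complex.exp_add]
  congr 2
  push_cast
  field_simp
  ring

theorem theta1_add_two_mul {m : ℝ} (hm : m ≠ 0) (σ : ℤˣ) (j : ℝ) (τ z : ℂ) :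
    theta1 σ (j + 2 * m) m τ z = ((σ : ℤ) : ℂ) * theta1 σ j m τ z := by
  have hm' : (m : ℂ) ≠ 0 := by exact_mod_cast hm
  rw [theta1, theta1, ← tsum_mul_left, ← (Equiv.addRight (1 : ℤ)).tsum_eq
      (fun n => ((σ : ℤ) : ℂ) * _)]
  refine tsum_congr fun n => ?_
  rw [Equiv.coe_addRight, sign_zpow_add_one, ← mul_assoc, ← mul_assoc, sign_mul_self, one_mul]
  congr 2
  push_cast
  field_simp
  ring

section Index

variable {N : ℕ} {m : ℝ} {τ z₁ : ℂ}

theorem PhiAdd_eq (hmN : 2 * m = N) (σ : ℤˣ) (s : ℝ) (τ z₁ z₂ : ℂ) :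
    PhiAdd σ m s τ z₁ z₂ = ∑ i ∈ Finset.range N,
      R σ (s + i) m τ ((z₁ - z₂) / 2) * theta1 σ (s + i) m τ (z₁ + z₂) := by
  rw [PhiAdd, hmN, Nat.ceil_natCast]

/-- The modifier loses the term j = s and gains the term j = s + 2m. The signs of `R` and `theta1`
multiply to 1, so the two terms differ by -2 times the change of `Phi`, and the factor 1/2 makes
everything cancel. -/
theorem PhiMod_index_add_one (hN : 0 < N) (hmN : 2 * m = N) (hτ : 0 < τ.im) (σ : ℤˣ) (s : ℝ)
    (hz : ∀ a b : ℤ, z₁ ≠ a + b * τ) (z₂ : ℂ) :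
    PhiMod σ m (s + 1) τ z₁ z₂ = PhiMod σ m s τ z₁ z₂ := by
  have hm : 0 < m := by
    have : (0 : ℝ) < N := by exact_mod_cast hN
    linarith
  have h1 := Phi_sub_add_one hm hτ σ s hz z₂
  set f : ℕ → ℂ := fun i => R σ (s + i) m τ ((z₁ - z₂) / 2) * theta1 σ (s + i) m τ (z₁ + z₂)
    with hf
  have h2 : PhiAdd σ m (s + 1) τ z₁ z₂ = ∑ i ∈ Finset.range N, f (i + 1) := by
    rw [PhiAdd_eq hmN]
    refine Finset.sum_congr rfl fun i _ => ?_
    have : s + 1 + (i : ℝ) = s + ((i + 1 : ℕ) : ℝ) := by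
      push_cast
      ring
    rw [hf, this]
  have h3 := Finset.sum_range_succ f N
  rw [Finset.sum_range_succ'] at h3
  have h4 : f N = f 0 - 2 * rExp s m τ 0 ((z₁ - z₂) / 2) * theta1 σ s m τ (z₁ + z₂) := by
    simp only [hf, Nat.cast_zero, add_zero]
    rw [← hmN, R_add_two_mul hN hmN σ s hτ, theta1_add_two_mul hm.ne', mul_mul_mul_comm,
      sign_mul_self]
    ring
  rw [PhiMod, PhiMod, h2, PhiAdd_eq hmN]
  linear_combination -h1 - 1 / 2 * h3 - 1 / 2 * h4

theorem PhiMod_index_add_int (hN : 0 < N) (hmN : 2 * m = N) (hτ : 0 < τ.im) (σ : ℤˣ) (s : ℝ)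
    (hz : ∀ a b : ℤ, z₁ ≠ a + b * τ) (z₂ : ℂ) (a : ℤ) :
    PhiMod σ m (s + a) τ z₁ z₂ = PhiMod σ m s τ z₁ z₂ := by
  induction a using Int.induction_on with
  | zero => simp
  | succ i ih =>
    rw [← ih, ← PhiMod_index_add_one hN hmN hτ σ (s + (i : ℤ)) hz]
    push_cast
    rw [add_assoc]
  | pred i ih =>
    rw [← ih, ← PhiMod_index_add_one hN hmN hτ σ (s + (-i - 1 : ℤ)) hz]
    push_cast
    congr 1
    ring

/-- Quasi-periodicity of `PhiMod` in its second variable. -/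
theorem PhiMod_add_mul_of_int (hN : 0 < N) (hmN : 2 * m = N) (hτ : 0 < τ.im) (σ : ℤˣ) (s : ℝ)
    (hz : ∀ a b : ℤ, z₁ ≠ a + b * τ) (z₂ : ℂ) {b : ℝ} {a : ℤ} (hb : m * b = a) :
    PhiMod σ m s τ z₁ (z₂ + b * τ) = exp (-(2 * Real.pi * I * a * z₁)) * PhiMod σ m s τ z₁ z₂ := by
  have hm : m ≠ 0 := by
    have : (0 : ℝ) < N := by exact_mod_cast hN
    rintro rfl
    linarith
  have hb' : (m : ℂ) * b = a := by exact_mod_cast hb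
  rw [PhiMod_add_mul σ hm s b hτ.ne', hb, PhiMod_index_add_int hN hmN hτ σ s hz, ← hb']
  simp only [mul_assoc]

end Index

/-! ### The Cauchy–Riemann operator -/

/-- `f` is real differentiable at `z` with `∂f/∂z̄ = b`. -/
def HasDbarAt (f : ℂ → ℂ) (b z : ℂ) : Prop :=
  ∃ a : ℂ, HasFDerivAt f (a • ContinuousLinearMap.id ℝ ℂ + b • (conjCLE : ℂ →L[ℝ] ℂ)) z

namespace HasDbarAt

variable {f g : ℂ → ℂ} {b b' z : ℂ}

theorem add (hf : HasDbarAt f b z) (hg : HasDbarAt g b' z) :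
    HasDbarAt (fun w => f w + g w) (b + b') z := by
  obtain ⟨a, ha⟩ := hf
  obtain ⟨a', ha'⟩ := hg
  refine ⟨a + a', (ha.add ha').congr_fderiv ?_⟩
  refine ContinuousLinearMap.ext fun v => ?_
  simp
  ring

theorem sum {ι : Type*} (s : Finset ι) {f : ι → ℂ → ℂ} {b : ι → ℂ}
    (h : ∀ i ∈ s, HasDbarAt (f i) (b i) z) :
    HasDbarAt (fun w => ∑ i ∈ s, f i w) (∑ i ∈ s, b i) z := by
  classical
  induction s using Finset.induction_on with
  | empty => exact ⟨0, (hasFDerivAt_const (0 : ℂ) z).congr_fderiv (by ext; simp)⟩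
  | insert i s hi ih =>
    simp only [Finset.sum_insert hi]
    exact (h i (Finset.mem_insert_self i s)).add
      (ih fun k hk => h k (Finset.mem_insert_of_mem hk))

/-- Multiplication by a holomorphic function. -/
theorem mul_holo (hf : HasDbarAt f b z) (hg : DifferentiableAt ℂ g z) :
    HasDbarAt (fun w => f w * g w) (b * g z) z := by
  obtain ⟨a, ha⟩ := hf
  have h2 := (hg.hasDerivAt.hasFDerivAt).restrictScalars ℝ
  refine ⟨f z * deriv g z + g z * a, (ha.mul h2).congr_fderiv ?_⟩
  refine ContinuousLinearMap.ext fun v => ?_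
  simp
  ring

theorem of_holo (hf : DifferentiableAt ℂ f z) : HasDbarAt f 0 z := by
  refine ⟨deriv f z, ((hf.hasDerivAt.hasFDerivAt).restrictScalars ℝ).congr_fderiv ?_⟩
  ext
  simp [mul_comm]

theorem const_mul (c : ℂ) (hf : HasDbarAt f b z) : HasDbarAt (fun w => c * f w) (c * b) z := by
  have := hf.mul_holo (differentiableAt_const (x := z) c)
  simpa only [mul_comm c] using this

theorem comp_affine (c d : ℂ) (hf : HasDbarAt f b (c * z + d)) :
    HasDbarAt (fun w => f (c * w + d)) ((starRingEnd ℂ) c * b) z := by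
  obtain ⟨a, ha⟩ := hf
  have h2 : HasFDerivAt (fun w : ℂ => c * w + d) (c • ContinuousLinearMap.id ℝ ℂ) z :=
    ((hasFDerivAt_id (𝕜 := ℝ) z).const_mul c).add_const d
  refine ⟨c * a, (ha.comp z h2).congr_fderiv ?_⟩
  refine ContinuousLinearMap.ext fun v => ?_
  simp
  ring

theorem differentiableAt (hf : HasDbarAt f 0 z) : DifferentiableAt ℂ f z := by
  obtain ⟨a, ha⟩ := hf
  have h : HasFDerivAt f (a • ContinuousLinearMap.id ℂ ℂ) z := by
    refine hasFDerivAt_of_restrictScalars ℝ ha ?_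
    ext
    simp
  exact h.differentiableAt

/-- Termwise differentiation of a series. -/
theorem tsum {ι : Type*} {f : ι → ℂ → ℂ} {A B : ι → ℂ → ℂ} {u : ι → ℝ} (hu : Summable u) (z : ℂ)
    (hf : ∀ n, ∀ w ∈ Metric.ball z 1, HasFDerivAt (f n)
      (A n w • ContinuousLinearMap.id ℝ ℂ + B n w • (conjCLE : ℂ →L[ℝ] ℂ)) w)
    (hA : ∀ n, ∀ w ∈ Metric.ball z 1, ‖A n w‖ ≤ u n)
    (hB : ∀ n, ∀ w ∈ Metric.ball z 1, ‖B n w‖ ≤ u n)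
    (h0 : Summable fun n => f n z) :
    HasDbarAt (fun w => ∑' n, f n w) (∑' n, B n z) z := by
  have hz : z ∈ Metric.ball z 1 := Metric.mem_ball_self one_pos
  have key := hasFDerivAt_tsum_of_isPreconnected (hu.add hu) Metric.isOpen_ball
    (convex_ball z 1).isPreconnected hf (fun n w hw => ?_) hz h0 hz
  · refine ⟨∑' n, A n z, key.congr_fderiv ?_⟩
    have sA : Summable fun n => A n z := Summable.of_norm_bounded hu fun n => hA n z hz
    have sB : Summable fun n => B n z := Summable.of_norm_bounded hu fun n => hB n z hz
    rw [(sA.smul_const _).tsum_add (sB.smul_const _), sA.tsum_smul_const, sB.tsum_smul_const]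
  · refine (norm_add_le _ _).trans (add_le_add ?_ ?_)
    · rw [norm_smul, ContinuousLinearMap.norm_id, mul_one]
      exact hA n w hw
    · rw [norm_smul]
      have : ‖(conjCLE : ℂ →L[ℝ] ℂ)‖ = 1 := conjCLE_norm
      rw [this, mul_one]
      exact hB n w hw

end HasDbarAt

/-! ### The `∂̄`-derivative of `R` and `PhiMod` -/

/-- The `∂̄`-derivative of `rTerm`. -/
def rBar (j m : ℝ) (τ : ℂ) (l : ℤ) (u : ℂ) : ℂ :=
  I * (2 * m / τ.im * Real.sqrt (τ.im / m) *
    Real.exp (-Real.pi * psi m (j + 2 * m * l) τ u ^ 2) : ℝ) * rExp j m τ l u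

/-- Only the error function depends on Im u, so the whole ∂̄-part comes from its Gaussian
derivative. -/
theorem hasFDerivAt_rTerm (j m : ℝ) (τ : ℂ) (l : ℤ) (u : ℂ) :
    HasFDerivAt (rTerm j m τ l)
      ((2 * Real.pi * I * ((j + 2 * m * l : ℝ) : ℂ) * rTerm j m τ l u - rBar j m τ l u) •
        ContinuousLinearMap.id ℝ ℂ + rBar j m τ l u • (conjCLE : ℂ →L[ℝ] ℂ)) u := by
  have h1 : HasFDerivAt (fun u : ℂ => psi m (j + 2 * m * l) τ u)
      ((-(2 * m / τ.im * Real.sqrt (τ.im / m))) • imCLM) u := by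
    have h := (((imCLM.hasFDerivAt (x := u)).const_mul (-(2 * m / τ.im * Real.sqrt (τ.im / m)))).const_add
      ((j + 2 * m * l) * Real.sqrt (τ.im / m)))
    refine h.congr_of_eventuallyEq (Filter.Eventually.of_forall fun w => ?_)
    simp only [psi, imCLM_apply]
    ring
  have h2 := ((hasDerivAt_E (psi m (j + 2 * m * l) τ u)).comp_hasFDerivAt u h1).const_sub
    (Real.sign ((j + 2 * m * l) - 1 / 2 - j + 2 * m))
  have h3 := (ofRealCLM.hasFDerivAt).comp u h2
  have h4 : HasFDerivAt (rExp j m τ l)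
      ((rExp j m τ l u * (2 * Real.pi * I * ((j + 2 * m * l : ℝ) : ℂ))) •
        ContinuousLinearMap.id ℝ ℂ) u := by
    have : HasDerivAt (rExp j m τ l)
        (rExp j m τ l u * (2 * Real.pi * I * ((j + 2 * m * l : ℝ) : ℂ))) u := by
      have h := ((hasDerivAt_id u).const_mul (2 * Real.pi * I * ((j + 2 * m * l : ℝ) : ℂ))).const_add
        (-(Real.pi * I * ((j + 2 * m * l : ℝ) : ℂ) ^ 2 / (2 * m)) * τ)
      rw [mul_one] at h
      exact h.cexp
    refine ((this.hasFDerivAt).restrictScalars ℝ).congr_fderiv ?_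
    ext
    simp [mul_comm]
  refine (h3.mul h4).congr_fderiv ?_
  refine ContinuousLinearMap.ext fun v => ?_
  -- This splits the differential of Im u into its linear and antilinear parts.
  have hv : ((v.im : ℝ) : ℂ) = (v - (starRingEnd ℂ) v) / (2 * I) := by
    rw [Complex.sub_conj]
    push_cast
    field_simp
  simp [rTerm, rBar]
  rw [hv]
  field_simp
  ring_nf
  simp only [Complex.I_sq]
  ring

theorem norm_rBar_le {m : ℝ} (hm : 0 < m) (j : ℝ) {τ : ℂ} (hτ : 0 < τ.im) {S : ℝ} {u : ℂ}
    (hu : |u.im| ≤ S) (l : ℤ) : ‖rBar j m τ l u‖ ≤ 2 * m / τ.im * Real.sqrt (τ.im / m) *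
      gaussBound (|j| * τ.im + 2 * m * S) (2 * m * τ.im) l := by
  rw [rBar, norm_mul, norm_mul, norm_I, one_mul, Complex.norm_real, Real.norm_eq_abs,
    abs_of_nonneg (by positivity), mul_assoc (_ * _)]
  exact mul_le_mul_of_nonneg_left (norm_gauss_mul_rExp_le hm j hτ hu l) (by positivity)

/-- Expanding the square in the Gaussian turns the holomorphic exponential into an antiholomorphic
one, up to a weight in Im u that does not involve l. -/
theorem rBar_eq {m : ℝ} (hm : 0 < m) (j : ℝ) {τ : ℂ} (hτ : 0 < τ.im) (l : ℤ) (u : ℂ) :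
    rBar j m τ l u = 2 * I * (Real.sqrt (m / τ.im) *
      Real.exp (-(4 * Real.pi * m * u.im ^ 2 / τ.im)) : ℝ) * (starRingEnd ℂ)
        (exp (2 * Real.pi * I * (m * (-2 * u) * (l + j / (2 * m))
          + τ * m * (l + j / (2 * m)) ^ 2))) := by
  have hy : (τ.im : ℂ) ≠ 0 := by exact_mod_cast hτ.ne'
  have hm' : (m : ℂ) ≠ 0 := by exact_mod_cast hm.ne'
  have h1 : 2 * m / τ.im * Real.sqrt (τ.im / m) = 2 * Real.sqrt (m / τ.im) := by
    rw [Real.sqrt_div' _ hm.le, Real.sqrt_div' _ hτ.le]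
    have h2 := Real.mul_self_sqrt hm.le
    have h3 := Real.mul_self_sqrt hτ.le
    have h4 := (Real.sqrt_pos.2 hm).ne'
    have h5 := (Real.sqrt_pos.2 hτ).ne'
    field_simp
    rw [sq, sq, h2, h3]
    ring
  have h2 : psi m (j + 2 * m * l) τ u ^ 2 = (j + 2 * m * l - 2 * m * (u.im / τ.im)) ^ 2 * (τ.im / m) := by
    rw [psi, mul_pow, Real.sq_sqrt (by positivity)]
  have h3 : ((Real.exp (-Real.pi * psi m (j + 2 * m * l) τ u ^ 2) : ℝ) : ℂ) * rExp j m τ l u =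
      ((Real.exp (-(4 * Real.pi * m * u.im ^ 2 / τ.im)) : ℝ) : ℂ) * (starRingEnd ℂ)
        (exp (2 * Real.pi * I * (m * (-2 * u) * (l + j / (2 * m))
          + τ * m * (l + j / (2 * m)) ^ 2))) := by
    rw [h2, rExp, ← Complex.exp_conj, Complex.ofReal_exp, Complex.ofReal_exp, ← Complex.exp_add,
      ← Complex.exp_add]
    congr 1
    have hu : u = u.re + u.im * I := (Complex.re_add_im u).symm
    have hτ' : τ = τ.re + τ.im * I := (Complex.re_add_im τ).symm
    have hu' : (starRingEnd ℂ) u = u.re - u.im * I := by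
      apply Complex.ext <;> simp
    have hτ'' : (starRingEnd ℂ) τ = τ.re - τ.im * I := by
      apply Complex.ext <;> simp
    simp only [map_mul, map_add, map_pow, map_neg, map_div₀, Complex.conj_I, Complex.conj_ofReal,
      map_ofNat, map_intCast, hu', hτ'']
    push_cast
    have e1 : (-(Real.pi * I * (j + 2 * m * l) ^ 2 / (2 * m)) * τ
        + 2 * Real.pi * I * (j + 2 * m * l) * u : ℂ)
        = (-(Real.pi * I * (j + 2 * m * l) ^ 2 / (2 * m)) * (τ.re + τ.im * I)
        + 2 * Real.pi * I * (j + 2 * m * l) * (u.re + u.im * I)) := by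
      rw [← hu, ← hτ']
    rw [e1]
    field_simp
    ring_nf
    simp only [Complex.I_sq]
    ring
  rw [rBar, h1, Complex.ofReal_mul, Complex.ofReal_mul, mul_assoc (_ * _) , mul_assoc I, mul_assoc (_ : ℂ) _ (rExp _ _ _ _ _),
    h3]
  push_cast
  ring

/-- Since the weight in `rBar_eq` is common to all terms, the termwise ∂̄-derivatives reassemble
into one conjugate theta function. -/
theorem hasDbarAt_R {N : ℕ} (hN : 0 < N) {m : ℝ} (hmN : 2 * m = N) (σ : ℤˣ) (j : ℝ) {τ : ℂ}
    (hτ : 0 < τ.im) (u : ℂ) :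
    HasDbarAt (R σ j m τ) (2 * I * (Real.sqrt (m / τ.im) *
      Real.exp (-(4 * Real.pi * m * u.im ^ 2 / τ.im)) : ℝ) *
        (starRingEnd ℂ) (theta1 σ j m τ (-2 * u))) u := by
  have hm : 0 < m := by
    have : (0 : ℝ) < N := by exact_mod_cast hN
    linarith
  obtain ⟨S, hS⟩ : ∃ S, S = |u.im| + 1 := ⟨_, rfl⟩
  obtain ⟨C, hC0, hC⟩ := exists_norm_rTerm_le hm j hτ hN hmN S
  have hball : ∀ w ∈ Metric.ball u 1, |w.im| ≤ S := by
    intro w hw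
    have h1 : |(w - u).im| ≤ 1 :=
      (Complex.abs_im_le_norm _).trans (by rw [← dist_eq_norm]; exact (Metric.mem_ball.1 hw).le)
    have h2 : w.im = u.im + (w - u).im := by simp
    rw [hS, h2]
    exact (abs_add_le _ _).trans (by gcongr)
  set G := gaussBound (|j| * τ.im + 2 * m * S) (2 * m * τ.im) with hG
  have hT : 0 < 2 * m * τ.im := by positivity
  set c := 2 * m / τ.im * Real.sqrt (τ.im / m) with hc
  have hc0 : 0 ≤ c := by positivity
  have hG0 : ∀ l, 0 ≤ G l := fun l => (Real.exp_pos _).le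
  -- The linear part of the differential carries the factor j + 2ml, hence the additional weight
  -- |l|.
  have hsum : Summable fun l : ℤ =>
      (2 * Real.pi * |j| * C + c) * G l + (4 * Real.pi * m * C) * ((|l| : ℝ) * G l) :=
    ((summable_gaussBound _ hT).mul_left _).add ((summable_abs_mul_gaussBound _ hT).mul_left _)
  have hr : (fun w => R σ j m τ w) = fun w => ∑' l : ℤ, ((σ : ℤ) : ℂ) ^ l * rTerm j m τ l w :=
    funext fun w => R_eq_tsum σ j m τ w
  have hB : ∀ l : ℤ, ∀ w ∈ Metric.ball u 1, ‖((σ : ℤ) : ℂ) ^ l * rBar j m τ l w‖ ≤ c * G l := by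
    intro l w hw
    rw [norm_mul, norm_sign_zpow, one_mul]
    exact norm_rBar_le hm j hτ (hball w hw) l
  have key := HasDbarAt.tsum (f := fun l w => ((σ : ℤ) : ℂ) ^ l * rTerm j m τ l w)
    (A := fun l w => ((σ : ℤ) : ℂ) ^ l *
      (2 * Real.pi * I * ((j + 2 * m * l : ℝ) : ℂ) * rTerm j m τ l w - rBar j m τ l w))
    (B := fun l w => ((σ : ℤ) : ℂ) ^ l * rBar j m τ l w) hsum u ?_ ?_ ?_
    (summable_rTerm hm j hτ hN hmN σ u)
  · have e : (∑' l : ℤ, ((σ : ℤ) : ℂ) ^ l * rBar j m τ l u) =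
        2 * I * (Real.sqrt (m / τ.im) *
      Real.exp (-(4 * Real.pi * m * u.im ^ 2 / τ.im)) : ℝ) *
        (starRingEnd ℂ) (theta1 σ j m τ (-2 * u)) := by
      rw [theta1, Complex.conj_tsum, ← tsum_mul_left]
      refine tsum_congr fun l => ?_
      rw [rBar_eq hm j hτ, map_mul, conj_sign_zpow]
      ring
    rw [← e]
    rw [show R σ j m τ = _ from hr]
    exact key
  · intro l w _
    refine ((hasFDerivAt_rTerm j m τ l w).const_mul (((σ : ℤ) : ℂ) ^ l)).congr_fderiv ?_
    refine ContinuousLinearMap.ext fun v => ?_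
    simp
    ring
  · intro l w hw
    have h1 : ‖rTerm j m τ l w‖ ≤ C * G l := hC w (hball w hw) l
    have h2 := norm_rBar_le hm j hτ (hball w hw) l
    have h3 : |j + 2 * m * l| ≤ |j| + 2 * m * |(l : ℝ)| := by
      refine (abs_add_le _ _).trans ?_
      rw [abs_mul, abs_of_pos (by positivity : 0 < 2 * m)]
    rw [norm_mul, norm_sign_zpow, one_mul]
    refine (norm_sub_le _ _).trans ?_
    rw [norm_mul, norm_mul, norm_mul, norm_mul, norm_I, Complex.norm_real, Complex.norm_real,
      Real.norm_eq_abs, Real.norm_eq_abs, abs_of_pos Real.pi_pos, mul_one, Complex.norm_two]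
    have h4 : 2 * Real.pi * |j + 2 * m * l| * ‖rTerm j m τ l w‖ ≤
        2 * Real.pi * (|j| + 2 * m * |(l : ℝ)|) * (C * G l) := by gcongr
    refine (add_le_add h4 h2).trans (le_of_eq ?_)
    ring
  · intro l w hw
    refine (hB l w hw).trans ?_
    have h1 : 0 ≤ 2 * Real.pi * |j| * C * G l := by have := hG0 l; positivity
    have h2 : 0 ≤ (4 * Real.pi * m * C) * ((|l| : ℝ) * G l) := by have := hG0 l; positivity
    linarith

/-- Writing the sign as a character makes a signed theta function a translate of the Jacobi theta
function. -/
theorem exists_sign_eq_exp (σ : ℤˣ) :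
    ∃ c : ℝ, ∀ n : ℤ, exp (2 * Real.pi * I * (n * c)) = ((σ : ℤ) : ℂ) ^ n := by
  rcases Int.units_eq_one_or σ with rfl | rfl
  · exact ⟨0, fun n => by simp⟩
  · refine ⟨1 / 2, fun n => ?_⟩
    have : (2 * Real.pi * I * (n * ((1 / 2 : ℝ) : ℂ)) : ℂ) = n * (Real.pi * I) := by
      push_cast
      ring
    rw [this, Complex.exp_int_mul, Complex.exp_pi_mul_I]
    simp

theorem theta1_eq_jacobiTheta₂ {σ : ℤˣ} {c : ℝ}
    (hc : ∀ n : ℤ, exp (2 * Real.pi * I * (n * c)) = ((σ : ℤ) : ℂ) ^ n) {m : ℝ} (hm : m ≠ 0) (j : ℝ)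
    (τ z : ℂ) : theta1 σ j m τ z = exp (Real.pi * I * (z * j + τ * j ^ 2 / (2 * m))) *
      jacobiTheta₂ (m * z + j * τ + c) (2 * m * τ) := by
  rw [theta1, jacobiTheta₂, ← tsum_mul_left]
  refine tsum_congr fun n => ?_
  rw [theta1_term_eq hm, ← hc, mul_left_comm, jacobiTheta₂_term, jacobiTheta₂_term,
    ← Complex.exp_add]
  congr 2
  ring

theorem differentiable_theta1 {m : ℝ} (hm : 0 < m) (σ : ℤˣ) (j : ℝ) {τ : ℂ} (hτ : 0 < τ.im) :
    Differentiable ℂ (theta1 σ j m τ) := by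
  obtain ⟨c, hc⟩ := exists_sign_eq_exp σ
  rw [show theta1 σ j m τ = _ from funext fun z => theta1_eq_jacobiTheta₂ hc hm.ne' j τ z]
  have hT : 0 < (2 * m * τ : ℂ).im := by
    have : (2 * m * τ : ℂ) = ((2 * m : ℝ) : ℂ) * τ := by push_cast; rfl
    rw [this, Complex.im_ofReal_mul]
    positivity
  intro z
  refine DifferentiableAt.mul (by fun_prop) ?_
  exact (differentiableAt_jacobiTheta₂_fst (m * z + j * τ + c) hT).comp z
    (f := fun z : ℂ => m * z + j * τ + c) (by fun_prop)

theorem differentiable_Phi {m : ℝ} (hm : 0 < m) {τ : ℂ} (hτ : 0 < τ.im) (σ : ℤˣ) (s : ℝ) (z₁ : ℂ) :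
    Differentiable ℂ (Phi σ m s τ z₁) := by
  intro z
  obtain ⟨C, S, h⟩ := exists_Phi_term_le hm hτ σ s z₁ (|z.im| + 1)
  have hsum := (summable_gaussBound S (by positivity : 0 < 2 * m * τ.im)).mul_left C
  refine (differentiableOn_tsum_of_summable_norm hsum (fun n => ?_) Metric.isOpen_ball
    fun n w hw => h w ?_ n).differentiableAt (Metric.ball_mem_nhds z one_pos)
  · fun_prop
  · have h1 : |(w - z).im| ≤ 1 :=
      (Complex.abs_im_le_norm _).trans (by rw [← dist_eq_norm]; exact (Metric.mem_ball.1 hw).le)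
    have h2 : w.im = z.im + (w - z).im := by simp
    rw [h2]
    exact (abs_add_le _ _).trans (by gcongr)

/-- `Phi` and the theta functions are holomorphic in z₂, so only `R` contributes. The outcome is a
hermitian pairing of the theta functions of index s + i, which is what makes it modular. -/
theorem hasDbarAt_PhiMod {N : ℕ} (hN : 0 < N) {m : ℝ} (hmN : 2 * m = N) (σ : ℤˣ) (s : ℝ) {τ : ℂ}
    (hτ : 0 < τ.im) (z₁ z₂ : ℂ) :
    HasDbarAt (PhiMod σ m s τ z₁) (I / 2 * (Real.sqrt (m / τ.im) *
      Real.exp (-(Real.pi * m * (z₂ - z₁).im ^ 2 / τ.im)) : ℝ) *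
        ∑ i ∈ Finset.range N, (starRingEnd ℂ) (theta1 σ (s + i) m τ (z₂ - z₁)) *
          theta1 σ (s + i) m τ (z₁ + z₂)) z₂ := by
  have hm : 0 < m := by
    have : (0 : ℝ) < N := by exact_mod_cast hN
    linarith
  have h1 : PhiMod σ m s τ z₁ = fun w => Phi σ m s τ z₁ w + (-(1 / 2 : ℂ)) *
      ∑ i ∈ Finset.range N, R σ (s + i) m τ (-(1 / 2 : ℂ) * w + z₁ / 2) *
        theta1 σ (s + i) m τ (z₁ + w) := by
    funext w
    rw [PhiMod, PhiAdd_eq hmN]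
    have : (z₁ - w) / 2 = -(1 / 2 : ℂ) * w + z₁ / 2 := by ring
    rw [this]
    ring
  rw [h1]
  have h2 := (HasDbarAt.of_holo (differentiable_Phi hm hτ σ s z₁ z₂)).add
    ((HasDbarAt.sum (Finset.range N) fun i _ =>
      ((hasDbarAt_R hN hmN σ (s + i) hτ (-(1 / 2 : ℂ) * z₂ + z₁ / 2)).comp_affine
        (-(1 / 2 : ℂ)) (z₁ / 2)).mul_holo (g := fun w => theta1 σ (s + i) m τ (z₁ + w))
        ((differentiable_theta1 hm σ (s + i) hτ).comp (differentiable_id.const_add z₁) z₂)).const_mul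
          (-(1 / 2 : ℂ)))
  convert h2 using 1
  rw [zero_add, Finset.mul_sum, Finset.mul_sum]
  refine Finset.sum_congr rfl fun i _ => ?_
  have e1 : -2 * (-(1 / 2 : ℂ) * z₂ + z₁ / 2) = z₂ - z₁ := by ring
  have e2 : (-(1 / 2 : ℂ) * z₂ + z₁ / 2).im = -(z₂ - z₁).im / 2 := by
    have : -(1 / 2 : ℂ) * z₂ + z₁ / 2 = ((-(1 / 2) : ℝ) : ℂ) * (z₂ - z₁) := by
      push_cast
      ring
    rw [this, Complex.im_ofReal_mul]
    ring
  have e3 : 4 * Real.pi * m * (-(z₂ - z₁).im / 2) ^ 2 / τ.im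
      = Real.pi * m * (z₂ - z₁).im ^ 2 / τ.im := by ring
  have e4 : (starRingEnd ℂ) (-(1 / 2 : ℂ)) = -(1 / 2 : ℂ) := by
    simp [map_ofNat]
  rw [e1, e2, e3, e4]
  ring

/-! ### The transformation `τ ↦ -1 / τ` of the rank one theta functions -/

theorem tsum_int_mod {N : ℕ} (hN : 0 < N) {f : ℤ → ℂ} (hf : Summable f) :
    ∑' k : ℤ, f k = ∑ i ∈ Finset.range N, ∑' l : ℤ, f (l * N + i) := by
  have : NeZero N := ⟨hN.ne'⟩
  have h1 := (Int.divModEquiv N).symm.tsum_eq f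
  have h2 : Summable fun p : ℤ × Fin N => f ((Int.divModEquiv N).symm p) :=
    (Int.divModEquiv N).symm.summable_iff.2 hf
  have h3 := ((Equiv.prodComm (Fin N) ℤ).summable_iff.2 h2).tsum_prod
  simp only [Function.comp_apply] at h3
  rw [← h1, ← (Equiv.prodComm (Fin N) ℤ).tsum_eq, h3, tsum_fintype,
    ← Fin.sum_univ_eq_sum_range fun i => ∑' l : ℤ, f (l * N + i)]
  rfl

theorem im_neg_one_div {τ : ℂ} : (-1 / τ).im = τ.im / normSq τ := by
  rw [neg_div, Complex.neg_im, one_div, Complex.inv_im]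
  ring

theorem im_neg_one_div_pos {τ : ℂ} (hτ : 0 < τ.im) : 0 < (-1 / τ).im := by
  rw [im_neg_one_div]
  refine div_pos hτ (Complex.normSq_pos.2 ?_)
  rintro rfl
  simp at hτ

theorem ne_zero_of_im_pos {τ : ℂ} (hτ : 0 < τ.im) : τ ≠ 0 := by
  rintro rfl
  simp at hτ

section S

variable {σ σ' : ℤˣ} {N : ℕ} {m s s' : ℝ} {τ : ℂ}

/-- The functional equation of the Jacobi theta function, with the dual sum sorted modulo N. The
sign σ is a character with exponent s', which becomes the new base index, while the old base index s
becomes the sign σ'. Only the modulus of κ is recorded, so no branch of the root has to be followed.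
-/
theorem exists_theta1_S (hN : 0 < N) (hmN : 2 * m = N)
    (hσ : ∀ n : ℤ, exp (2 * Real.pi * I * (n * s')) = ((σ : ℤ) : ℂ) ^ n)
    (hσ' : ∀ n : ℤ, exp (2 * Real.pi * I * (n * s)) = ((σ' : ℤ) : ℂ) ^ n) (hτ : 0 < τ.im) :
    ∃ κ : ℂ, ‖κ‖ ^ 2 * N = ‖τ‖ ∧ ∀ (i : ℕ) (z : ℂ), theta1 σ (s + i) m (-1 / τ) (z / τ) =
      κ * exp (Real.pi * I * m * z ^ 2 / (2 * τ)) * ∑ i' ∈ Finset.range N,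
        exp (-(Real.pi * I * (s + i) * (s' + i') / m)) * theta1 σ' (s' + i') m τ z := by
  have hm : 0 < m := by
    have : (0 : ℝ) < N := by exact_mod_cast hN
    linarith
  have hm' : (m : ℂ) ≠ 0 := by exact_mod_cast hm.ne'
  have hτ0 := ne_zero_of_im_pos hτ
  have hNC : (N : ℂ) = 2 * m := by exact_mod_cast hmN.symm
  refine ⟨1 / (-I * (2 * m * (-1 / τ))) ^ (1 / 2 : ℂ), ?_, fun i z => ?_⟩
  · have h1 : (-I * (2 * m * (-1 / τ)) : ℂ) = I * N / τ := by
      rw [hNC]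
      field_simp
    have h2 : ((I * N / τ : ℂ) ^ (1 / 2 : ℂ)) ^ 2 = I * N / τ := by
      have := Complex.cpow_nat_inv_pow (I * N / τ : ℂ) (two_ne_zero)
      rwa [Nat.cast_ofNat, inv_eq_one_div] at this
    have hN' : (N : ℝ) ≠ 0 := by exact_mod_cast hN.ne'
    rw [h1, ← norm_pow, div_pow, h2, one_pow, one_div_div, norm_div, norm_mul, norm_I, one_mul,
      Complex.norm_natCast, div_mul_cancel₀ _ hN']
  · rw [theta1_eq_jacobiTheta₂ hσ hm.ne', jacobiTheta₂_functional_equation]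
    have h1 : ((-1 : ℂ) / (2 * m * (-1 / τ))) = τ / N := by
      rw [hNC]
      field_simp
    have h2 : (m * (z / τ) + ((s + i : ℝ) : ℂ) * (-1 / τ) + s') / (2 * m * (-1 / τ)) =
      -((z - (s + i) / m + s' / m * τ) / 2) := by
      push_cast
      field_simp
      ring
    have hT : 0 < (τ / N).im := by
      have : (τ / N : ℂ) = (((N : ℝ)⁻¹ : ℝ) : ℂ) * τ := by
        push_cast
        ring
      rw [this, Complex.im_ofReal_mul]
      positivity
    rw [h1, h2, jacobiTheta₂_neg_left, jacobiTheta₂,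
      tsum_int_mod hN ((summable_jacobiTheta₂_term_iff _ _).2 hT), Finset.mul_sum, Finset.mul_sum,
      Finset.mul_sum]
    refine Finset.sum_congr rfl fun i' _ => ?_
    rw [theta1, ← tsum_mul_left, ← tsum_mul_left, ← tsum_mul_left, ← tsum_mul_left]
    refine tsum_congr fun l => ?_
    rw [← sign_zpow_neg σ', ← hσ', jacobiTheta₂_term, mul_assoc _ (exp _) (exp _), mul_left_comm,
      ← Complex.exp_add, ← Complex.exp_add, ← Complex.exp_add, ← Complex.exp_add,
      mul_assoc _ (exp _) (exp _), ← Complex.exp_add]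
    congr 1
    -- In (s + i)(lN + i')/m the part with s l yields the sign (σ')^l, and the part with i l is an
    -- integer period.
    refine exp_eq_of_sub_int (-(i * l)) ?_
    push_cast
    rw [hNC]
    field_simp
    ring

theorem sum_exp_div {N : ℕ} (hN : 0 < N) {d : ℤ} (hd : |d| < N) :
    ∑ i ∈ Finset.range N, exp (2 * Real.pi * I * (d / N) * i) = if d = 0 then (N : ℂ) else 0 := by
  split_ifs with h
  · simp [h]
  have hNC : (N : ℂ) ≠ 0 := by exact_mod_cast hN.ne'
  set x := exp (2 * Real.pi * I * (d / N)) with hx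
  have h1 : ∀ i : ℕ, exp (2 * Real.pi * I * (d / N) * i) = x ^ i := fun i => by
    rw [hx, ← Complex.exp_nat_mul, mul_comm]
  have h2 : x ^ N = 1 := by
    rw [← h1, mul_assoc, div_mul_cancel₀ _ hNC,
      exp_two_pi_mul_I_int]
  have h3 : x ≠ 1 := by
    intro h4
    obtain ⟨k, hk⟩ := Complex.exp_eq_one_iff.1 h4
    have h5 : (d : ℂ) / N = k := mul_left_cancel₀ Complex.two_pi_I_ne_zero (by rw [hk]; ring)
    rw [div_eq_iff hNC] at h5
    have h6 : d = k * N := by exact_mod_cast h5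
    refine h (Int.eq_zero_of_abs_lt_dvd ⟨k, by rw [h6, mul_comm]⟩ hd)
  rw [Finset.sum_congr rfl fun i _ => h1 i, geom_sum_eq h3, h2, sub_self, zero_div]

/-- The hermitian pairing of theta functions is invariant under `τ ↦ -1 / τ`. -/
theorem sum_conj_theta1_mul_theta1_S (hN : 0 < N) (hmN : 2 * m = N)
    (hσ : ∀ n : ℤ, exp (2 * Real.pi * I * (n * s')) = ((σ : ℤ) : ℂ) ^ n)
    (hσ' : ∀ n : ℤ, exp (2 * Real.pi * I * (n * s)) = ((σ' : ℤ) : ℂ) ^ n) (hτ : 0 < τ.im)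
    (v w : ℂ) :
    ∑ i ∈ Finset.range N, (starRingEnd ℂ) (theta1 σ (s + i) m (-1 / τ) (v / τ)) *
        theta1 σ (s + i) m (-1 / τ) (w / τ) =
      ‖τ‖ * ((starRingEnd ℂ) (exp (Real.pi * I * m * v ^ 2 / (2 * τ))) *
        exp (Real.pi * I * m * w ^ 2 / (2 * τ))) *
      ∑ i ∈ Finset.range N, (starRingEnd ℂ) (theta1 σ' (s' + i) m τ v) *
        theta1 σ' (s' + i) m τ w := by
  obtain ⟨κ, hκ, h⟩ := exists_theta1_S hN hmN hσ hσ' hτ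
  have hNC : (N : ℂ) = 2 * m := by exact_mod_cast hmN.symm
  have hm' : (m : ℂ) ≠ 0 := by
    rintro h0
    rw [h0, mul_zero] at hNC
    exact hN.ne' (by exact_mod_cast hNC)
  have hκ' : (starRingEnd ℂ) κ * κ * N = ‖τ‖ := by
    rw [← hκ, mul_comm ((starRingEnd ℂ) κ), Complex.mul_conj, Complex.normSq_eq_norm_sq]
    push_cast
    rfl
  simp only [h, map_mul, map_sum]
  have e1 : ∀ a b : ℂ, ∀ f g : ℕ → ℕ → ℂ,
      ∑ i ∈ Finset.range N, (a * ∑ k ∈ Finset.range N, f i k) * (b * ∑ k ∈ Finset.range N, g i k) =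
      a * b * ∑ k ∈ Finset.range N, ∑ k' ∈ Finset.range N, ∑ i ∈ Finset.range N, f i k * g i k' := by
    intro a b f g
    have : ∀ k ∈ Finset.range N, (∑ k' ∈ Finset.range N, ∑ i ∈ Finset.range N, f i k * g i k') =
        ∑ i ∈ Finset.range N, ∑ k' ∈ Finset.range N, f i k * g i k' :=
      fun k _ => Finset.sum_comm
    rw [Finset.sum_congr rfl this, Finset.sum_comm, Finset.mul_sum]
    refine Finset.sum_congr rfl fun i _ => ?_
    rw [mul_mul_mul_comm, Finset.sum_mul_sum]
  rw [e1]
  -- Orthogonality of characters modulo N: the off-diagonal terms vanish and each diagonal term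
  -- counts N times.
  have e2 : ∀ k ∈ Finset.range N, (∑ k' ∈ Finset.range N, ∑ i ∈ Finset.range N,
      (starRingEnd ℂ) (exp (-(Real.pi * I * (s + i) * (s' + k) / m))) *
        (starRingEnd ℂ) (theta1 σ' (s' + k) m τ v) *
      (exp (-(Real.pi * I * (s + i) * (s' + k') / m)) * theta1 σ' (s' + k') m τ w)) =
      N * ((starRingEnd ℂ) (theta1 σ' (s' + k) m τ v) * theta1 σ' (s' + k) m τ w) := by
    intro k hk
    rw [Finset.sum_eq_single_of_mem k hk]
    · rw [← nsmul_eq_mul, ← Finset.card_range N, ← Finset.sum_const, Finset.card_range]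
      refine Finset.sum_congr rfl fun i _ => ?_
      rw [mul_mul_mul_comm, ← Complex.exp_conj, ← Complex.exp_add]
      have : (starRingEnd ℂ) (-(Real.pi * I * (s + i) * (s' + k) / m))
          + -(Real.pi * I * (s + i) * (s' + k) / m) = 0 := by
        simp
        ring
      rw [this, Complex.exp_zero, one_mul]
    · intro k' hk' hne
      have h1 : ∀ i ∈ Finset.range N,
          (starRingEnd ℂ) (exp (-(Real.pi * I * (s + i) * (s' + k) / m))) *
            (starRingEnd ℂ) (theta1 σ' (s' + k) m τ v) *
          (exp (-(Real.pi * I * (s + i) * (s' + k') / m)) * theta1 σ' (s' + k') m τ w) =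
          (exp (Real.pi * I * s * (k - k') / m) * ((starRingEnd ℂ) (theta1 σ' (s' + k) m τ v) *
            theta1 σ' (s' + k') m τ w)) *
            exp (2 * Real.pi * I * (((k - k' : ℤ) : ℂ) / N) * i) := by
        intro i _
        rw [mul_mul_mul_comm, ← Complex.exp_conj, ← Complex.exp_add,
          mul_right_comm (exp (Real.pi * I * s * (k - k') / m)), ← Complex.exp_add]
        congr 2
        rw [hNC]
        simp
        field_simp
        ring
      rw [Finset.sum_congr rfl h1, ← Finset.mul_sum, sum_exp_div hN, if_neg, mul_zero]
      · have : (k : ℤ) ≠ k' := by exact_mod_cast hne.symm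
        lia
      · rw [Finset.mem_range] at hk hk'
        rw [abs_lt]
        lia
  rw [Finset.sum_congr rfl e2, ← Finset.mul_sum, ← hκ']
  ring

end S

/-! ### Entire functions with multipliers of degree zero -/

/-- An entire function on which the periods `1` and `τ` act by `1` and `e^{-2πiw}` vanishes, unless
`w` belongs to the lattice. -/
theorem eq_zero_of_quasiperiodic {f : ℂ → ℂ} (hf : Differentiable ℂ f) {τ w : ℂ} (hτ : 0 < τ.im)
    (h1 : ∀ z, f (z + 1) = f z) (h2 : ∀ z, f (z + τ) = exp (-(2 * Real.pi * I * w)) * f z)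
    (hw : ∀ a b : ℤ, w ≠ a + b * τ) : f = 0 := by
  -- With this real α, multiplying f by e^{2πiαz} makes both multipliers unimodular. The modulus is
  -- then doubly periodic, hence bounded, and Liouville's theorem applies.
  obtain ⟨α, hα⟩ : ∃ α : ℝ, α = w.im / τ.im := ⟨_, rfl⟩
  have hα' : α * τ.im = w.im := by rw [hα]; field_simp
  set g : ℂ → ℂ := fun z => f z * exp (2 * Real.pi * I * α * z) with hg
  have hgd : Differentiable ℂ g := hf.mul (by fun_prop)
  have n1 : ∀ z, ‖g (z + 1)‖ = ‖g z‖ := by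
    intro z
    simp only [hg]
    rw [h1, mul_add, Complex.exp_add, norm_mul, norm_mul, norm_mul]
    have : (2 * Real.pi * I * α * 1 : ℂ) = ((2 * Real.pi * α : ℝ) : ℂ) * I := by
      push_cast
      ring
    rw [this, Complex.norm_exp_ofReal_mul_I, mul_one]
  have n2 : ∀ z, ‖g (z + τ)‖ = ‖g z‖ := by
    intro z
    simp only [hg]
    rw [h2, mul_add, Complex.exp_add, norm_mul, norm_mul, norm_mul, norm_mul]
    have : ‖exp (-(2 * Real.pi * I * w))‖ * ‖exp (2 * Real.pi * I * α * τ)‖ = 1 := by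
      rw [← norm_mul, ← Complex.exp_add, Complex.norm_exp]
      have : -(2 * Real.pi * I * w) + 2 * Real.pi * I * α * τ
          = ((2 * Real.pi : ℝ) : ℂ) * (α * τ - w) * I := by
        push_cast
        ring
      rw [this, Complex.mul_I_re, Complex.im_ofReal_mul, Complex.sub_im, Complex.im_ofReal_mul, hα',
        sub_self, mul_zero, neg_zero, Real.exp_zero]
    linear_combination ‖f z‖ * ‖exp (2 * Real.pi * I * α * z)‖ * this
  have p1 : ∀ z, ∀ a : ℤ, ‖g (z + a)‖ = ‖g z‖ := by
    intro z a
    have hp : Function.Periodic (fun z => ‖g z‖) 1 := n1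
    simpa using hp.int_mul a z
  have p2 : ∀ z, ∀ a : ℤ, ‖g (z + a * τ)‖ = ‖g z‖ := by
    intro z a
    have hp : Function.Periodic (fun z => ‖g z‖) τ := n2
    exact hp.int_mul a z
  obtain ⟨C, hC⟩ := ((isCompact_Icc (a := (0 : ℝ)) (b := 1)).reProdIm
    (isCompact_Icc (a := (0 : ℝ)) (b := τ.im))).exists_bound_of_continuousOn
      hgd.continuous.continuousOn
  have hbd : ∀ z, ‖g z‖ ≤ C := by
    intro z
    set b : ℤ := ⌊z.im / τ.im⌋ with hb
    set z' := z + ((-b : ℤ) : ℂ) * τ with hz'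
    set a : ℤ := ⌊z'.re⌋ with ha
    have e1 : ‖g z‖ = ‖g (z' + ((-a : ℤ) : ℂ))‖ := by rw [p1, hz', p2]
    rw [e1]
    refine hC _ ?_
    have hb1 : (b : ℝ) * τ.im ≤ z.im := (le_div_iff₀ hτ).1 (Int.floor_le _)
    have hb2 : z.im ≤ (b + 1) * τ.im := ((div_lt_iff₀ hτ).1 (Int.lt_floor_add_one _)).le
    have him : (z' + ((-a : ℤ) : ℂ)).im = z.im - b * τ.im := by
      rw [Complex.add_im, Complex.intCast_im, add_zero, hz', Complex.add_im]
      have : (((-b : ℤ) : ℂ) * τ).im = -b * τ.im := by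
        rw [← Complex.ofReal_intCast, Complex.im_ofReal_mul]
        push_cast
        ring
      rw [this]
      ring
    have hre : (z' + ((-a : ℤ) : ℂ)).re = z'.re - a := by
      rw [Complex.add_re, Complex.intCast_re]
      push_cast
      ring
    rw [Complex.mem_reProdIm, Set.mem_Icc, Set.mem_Icc, him, hre]
    refine ⟨⟨?_, ?_⟩, ?_, ?_⟩
    · linarith [Int.floor_le z'.re]
    · linarith [Int.lt_floor_add_one z'.re]
    · linarith
    · linarith
  have hconst : ∀ z, g z = g 0 := fun z => hgd.apply_eq_apply_of_bounded
    (isBounded_iff_forall_norm_le.2 ⟨C, by rintro _ ⟨z, rfl⟩; exact hbd z⟩) z 0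
  by_cases hc : g 0 = 0
  · funext z
    have := hconst z
    rw [hc] at this
    exact (mul_eq_zero.1 this).resolve_right (Complex.exp_ne_zero _)
  -- A nonzero constant forces both multipliers to equal 1: the first makes α an integer, the second
  -- then puts w in the lattice.
  · exfalso
    have hf0 : f 0 ≠ 0 := by simpa [hg] using hc
    have q1 := hconst 1
    have q2 := hconst τ
    have r1 := h1 0
    have r2 := h2 0
    rw [zero_add] at r1 r2
    simp only [hg, mul_zero, Complex.exp_zero, mul_one, r1, r2] at q1 q2
    have t1 : exp (2 * Real.pi * I * α) = 1 := by
      refine mul_left_cancel₀ hf0 ?_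
      rw [q1, mul_one]
    have t2 : exp (-(2 * Real.pi * I * w) + 2 * Real.pi * I * α * τ) = 1 := by
      refine mul_left_cancel₀ hf0 ?_
      rw [Complex.exp_add, mul_one]
      linear_combination q2
    obtain ⟨a, ha⟩ := Complex.exp_eq_one_iff.1 t1
    obtain ⟨b, hb⟩ := Complex.exp_eq_one_iff.1 t2
    have u1 : (α : ℂ) = a := mul_left_cancel₀ Complex.two_pi_I_ne_zero (by rw [ha]; ring)
    have u2 : -w + α * τ = b :=
      mul_left_cancel₀ Complex.two_pi_I_ne_zero (by rw [← mul_comm (b : ℂ), ← hb]; ring)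
    refine hw (-b) a ?_
    push_cast
    rw [← u1, ← u2]
    ring

/-! ### The transformation `τ ↦ -1 / τ` of `PhiMod` -/

/-- Invariance of the Gaussian weight of the `∂̄`-derivative of `PhiMod`. -/
theorem gaussian_weight_S {m : ℝ} {τ : ℂ} (hτ : 0 < τ.im) (z₁ z₂ : ℂ) :
    ((Real.exp (-(Real.pi * m * (z₂ / τ - z₁ / τ).im ^ 2 / (-1 / τ).im)) : ℝ) : ℂ) *
      ((starRingEnd ℂ) (exp (Real.pi * I * m * (z₂ - z₁) ^ 2 / (2 * τ))) *
        exp (Real.pi * I * m * (z₁ + z₂) ^ 2 / (2 * τ))) *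
      exp (-(2 * Real.pi * I * m * z₁ * z₂ / τ)) =
    ((Real.exp (-(Real.pi * m * (z₂ - z₁).im ^ 2 / τ.im)) : ℝ) : ℂ) := by
  have hτ0 := ne_zero_of_im_pos hτ
  obtain ⟨p, hp⟩ : ∃ p, p = (z₂ - z₁) / τ := ⟨_, rfl⟩
  have h1 : z₂ / τ - z₁ / τ = p := by rw [hp]; ring
  have h2 : z₂ - z₁ = τ * p := by rw [hp]; field_simp
  obtain ⟨X, hX⟩ : ∃ X, X = Real.pi * I * m * (z₂ - z₁) ^ 2 / (2 * τ) := ⟨_, rfl⟩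
  -- From (z₁ + z₂)² - 4z₁z₂ = (z₂ - z₁)² the remaining exponential is e^X, and together with its
  -- conjugate it gives |e^X|².
  have h3 : exp (Real.pi * I * m * (z₁ + z₂) ^ 2 / (2 * τ)) *
      exp (-(2 * Real.pi * I * m * z₁ * z₂ / τ)) = exp X := by
    rw [← Complex.exp_add, hX]
    congr 1
    field_simp
    ring
  have h4 : X = ((Real.pi * m / 2 : ℝ) : ℂ) * (τ * p ^ 2) * I := by
    rw [hX, h2]
    push_cast
    field_simp
  have h5 : X.re = -(Real.pi * m / 2 * (τ * p ^ 2).im) := by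
    rw [h4, Complex.mul_I_re, Complex.im_ofReal_mul]
  have h6 : (starRingEnd ℂ) (exp X) * exp X = ((Real.exp (2 * X.re) : ℝ) : ℂ) := by
    rw [mul_comm, Complex.mul_conj, Complex.normSq_eq_norm_sq, Complex.norm_exp, ← Real.exp_nat_mul]
    norm_num
  rw [mul_assoc (_ : ℂ) (_ * _) (exp _), mul_assoc ((starRingEnd ℂ) _), h3, ← hX, h6, ← Complex.ofReal_mul, ← Real.exp_add, h1, h2, h5,
    im_neg_one_div]
  congr 2
  have h7 : normSq τ = τ.re ^ 2 + τ.im ^ 2 := by rw [Complex.normSq_apply]; ring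
  have h8 : (τ * p).im = τ.re * p.im + τ.im * p.re := Complex.mul_im _ _
  have h9 : (τ * p ^ 2).im = τ.re * (2 * p.re * p.im) + τ.im * (p.re ^ 2 - p.im ^ 2) := by
    rw [Complex.mul_im, sq p, Complex.mul_im, Complex.mul_re]
    ring
  have hn : τ.re ^ 2 + τ.im ^ 2 ≠ 0 := by positivity
  rw [h7, h8, h9]
  have := hτ.ne'
  field_simp
  ring

section PhiModS

variable {σ σ' : ℤˣ} {N : ℕ} {m s s' : ℝ} {τ : ℂ}

/-- For fixed z₁ the two sides have the same ∂̄-derivative in z₂ after normalization, so their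
difference is entire; its multipliers of degree zero are nontrivial off the lattice and make it
vanish. -/
theorem PhiMod_S (hN : 0 < N) (hmN : 2 * m = N)
    (hσ : ∀ n : ℤ, exp (2 * Real.pi * I * (n * s')) = ((σ : ℤ) : ℂ) ^ n)
    (hσ' : ∀ n : ℤ, exp (2 * Real.pi * I * (n * s)) = ((σ' : ℤ) : ℂ) ^ n) (hτ : 0 < τ.im)
    {z₁ : ℂ} (hz : ∀ a b : ℤ, z₁ ≠ a + b * τ) (z₂ : ℂ) :
    PhiMod σ m s (-1 / τ) (z₁ / τ) (z₂ / τ) =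
      τ * exp (2 * Real.pi * I * m * z₁ * z₂ / τ) * PhiMod σ' m s' τ z₁ z₂ := by
  have hτ0 := ne_zero_of_im_pos hτ
  have hτ' := im_neg_one_div_pos hτ
  have hm : 0 < m := by
    have : (0 : ℝ) < N := by exact_mod_cast hN
    linarith
  have hm' : (m : ℂ) ≠ 0 := by exact_mod_cast hm.ne'
  have hz' : ∀ a b : ℤ, z₁ / τ ≠ a + b * (-1 / τ) := by
    intro a b h
    refine hz (-b) a ?_
    field_simp at h
    rw [h]
    push_cast
    ring
  set D : ℂ → ℂ := fun w => PhiMod σ m s (-1 / τ) (z₁ / τ) (τ⁻¹ * w + 0) *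
      exp (-(2 * Real.pi * I * m * z₁ * w / τ)) + (-τ) * PhiMod σ' m s' τ z₁ w with hD
  have hDdiff : Differentiable ℂ D := by
    intro w
    have h := (((hasDbarAt_PhiMod hN hmN σ s hτ' (z₁ / τ) (τ⁻¹ * w + 0)).comp_affine τ⁻¹ 0).mul_holo
      (g := fun w => exp (-(2 * Real.pi * I * m * z₁ * w / τ))) (by fun_prop)).add
      ((hasDbarAt_PhiMod hN hmN σ' s' hτ z₁ w).const_mul (-τ))
    refine HasDbarAt.differentiableAt ?_
    convert h using 1
    have e1 : τ⁻¹ * w + 0 - z₁ / τ = (w - z₁) / τ := by ring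
    have e2 : z₁ / τ + (τ⁻¹ * w + 0) = (z₁ + w) / τ := by ring
    have e3 : (τ⁻¹ * w + 0 - z₁ / τ) = w / τ - z₁ / τ := by ring
    have e4 : Real.sqrt (m / (-1 / τ).im) = ‖τ‖ * Real.sqrt (m / τ.im) := by
      have : m / (-1 / τ).im = ‖τ‖ ^ 2 * (m / τ.im) := by
        rw [im_neg_one_div, Complex.normSq_eq_norm_sq]
        field_simp
      rw [this, Real.sqrt_mul (by positivity), Real.sqrt_sq (norm_nonneg _)]
    -- One |τ| comes from the root in the Gaussian weight, one from the pairing of theta functions,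
    -- and the conjugate of τ⁻¹ from the chain rule; their product is the automorphy factor τ.
    have e5 : (starRingEnd ℂ) τ⁻¹ * (‖τ‖ * ‖τ‖) = τ := by
      have : ((‖τ‖ : ℂ) * ‖τ‖) = τ * (starRingEnd ℂ) τ := by
        rw [Complex.mul_conj, Complex.normSq_eq_norm_sq]
        push_cast
        ring
      have h0 : (starRingEnd ℂ) τ ≠ 0 := by simpa using hτ0
      rw [this, map_inv₀]
      field_simp
    rw [e1, e2, sum_conj_theta1_mul_theta1_S hN hmN hσ hσ' hτ, ← e1, e3, e4]
    simp only [Complex.ofReal_mul]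
    rw [← gaussian_weight_S hτ z₁ w (m := m)]
    linear_combination (-(I / 2 * (Real.sqrt (m / τ.im) : ℂ) *
      ((Real.exp (-(Real.pi * m * (w / τ - z₁ / τ).im ^ 2 / (-1 / τ).im)) : ℝ) : ℂ) *
      ((starRingEnd ℂ) (exp (Real.pi * I * m * (w - z₁) ^ 2 / (2 * τ))) *
        exp (Real.pi * I * m * (z₁ + w) ^ 2 / (2 * τ))) *
      exp (-(2 * Real.pi * I * m * z₁ * w / τ)) * ∑ i ∈ Finset.range N,
        (starRingEnd ℂ) (theta1 σ' (s' + i) m τ (w - z₁)) * theta1 σ' (s' + i) m τ (z₁ + w))) * e5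
  have hshift1 : ∀ w, D (w + 1 / m) = D w := by
    intro w
    -- The inversion exchanges the two periods: a shift by 1/m on one side is a shift along -1/τ on
    -- the other.
    have e1 : τ⁻¹ * (w + 1 / m) + 0 = (τ⁻¹ * w + 0) + ((-(1 / m) : ℝ) : ℂ) * (-1 / τ) := by
      push_cast
      field_simp
      ring
    have e2 : exp (-(2 * Real.pi * I * m * z₁ * (w + 1 / m) / τ)) =
        exp (-(2 * Real.pi * I * z₁ / τ)) * exp (-(2 * Real.pi * I * m * z₁ * w / τ)) := by
      rw [← Complex.exp_add]
      congr 1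
      field_simp
      ring
    have e3 : exp (-(2 * Real.pi * I * ((-1 : ℤ) : ℂ) * (z₁ / τ))) *
        exp (-(2 * Real.pi * I * z₁ / τ)) = 1 := by
      rw [← Complex.exp_add, Complex.exp_eq_one_iff]
      refine ⟨0, ?_⟩
      push_cast
      ring
    simp only [hD]
    rw [PhiMod_add_inv σ' hm.ne', e1, PhiMod_add_mul_of_int hN hmN hτ' σ s hz' _ (a := -1)
      (by push_cast; field_simp), e2]
    linear_combination (PhiMod σ m s (-1 / τ) (z₁ / τ) (τ⁻¹ * w + 0) *
      exp (-(2 * Real.pi * I * m * z₁ * w / τ))) * e3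
  have hshift2 : ∀ w, D (w + τ / m) = exp (-(2 * Real.pi * I * z₁)) * D w := by
    intro w
    have e1 : τ⁻¹ * (w + τ / m) + 0 = (τ⁻¹ * w + 0) + 1 / m := by
      field_simp
      ring
    have e2 : exp (-(2 * Real.pi * I * m * z₁ * (w + τ / m) / τ)) =
        exp (-(2 * Real.pi * I * z₁)) * exp (-(2 * Real.pi * I * m * z₁ * w / τ)) := by
      rw [← Complex.exp_add]
      congr 1
      field_simp
      ring
    have e3 : w + τ / m = w + ((1 / m : ℝ) : ℂ) * τ := by
      push_cast
      ring
    simp only [hD]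
    rw [e1, e2, e3, PhiMod_add_inv σ hm.ne', PhiMod_add_mul_of_int hN hmN hτ σ' s' hz _ (a := 1)
      (by push_cast; field_simp)]
    push_cast
    rw [mul_one]
    ring
  -- Rescaling by m turns the periods 1/m and τ/m into 1 and τ.
  have hzero : (fun w => D (w / m)) = 0 := by
    refine eq_zero_of_quasiperiodic (w := z₁) (hDdiff.comp (by fun_prop)) hτ (fun w => ?_)
      (fun w => ?_) hz
    · rw [add_div, hshift1]
    · rw [add_div, hshift2]
  have h0 : D z₂ = 0 := by
    have := congrFun hzero (m * z₂)
    simpa [hm'] using this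
  have e4 : exp (-(2 * Real.pi * I * m * z₁ * z₂ / τ)) * exp (2 * Real.pi * I * m * z₁ * z₂ / τ)
      = 1 := by
    rw [← Complex.exp_add, neg_add_cancel, Complex.exp_zero]
  have e5 : τ⁻¹ * z₂ + 0 = z₂ / τ := by ring
  simp only [hD, e5] at h0
  linear_combination exp (2 * Real.pi * I * m * z₁ * z₂ / τ) * h0 -
    PhiMod σ m s (-1 / τ) (z₁ / τ) (z₂ / τ) * e4

end PhiModS

/-! ### Theta series of positive definite quadratic forms -/

section Quadratic

variable {ι : Type*} [Fintype ι]

/-- The quadratic form of a real matrix on complex vectors. -/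
def quad (A : Matrix ι ι ℝ) (x : ι → ℂ) : ℂ := ∑ i, ∑ j, (A i j : ℂ) * x i * x j

theorem posDef_iff_quad {A : Matrix ι ι ℝ} : A.PosDef ↔ (∀ i j, A i j = A j i) ∧
    ∀ x : ι → ℝ, x ≠ 0 → 0 < ∑ i, ∑ j, A i j * x i * x j := by
  have h : ∀ x : ι → ℝ, star x ⬝ᵥ A.mulVec x = ∑ i, ∑ j, A i j * x i * x j := by
    intro x
    simp only [dotProduct, Matrix.mulVec, Finset.mul_sum, star_trivial]
    exact Finset.sum_congr rfl fun i _ => Finset.sum_congr rfl fun j _ => by ring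
  rw [Matrix.posDef_iff_dotProduct_mulVec]
  refine and_congr ?_ ?_
  · rw [Matrix.IsHermitian.ext_iff]
    simp only [star_trivial]
    exact ⟨fun h i j => h j i, fun h i j => h j i⟩
  · refine forall_congr' fun x => ?_
    rw [h]

/-- A positive definite form is bounded below by a multiple of the sum of squares. -/
theorem exists_quad_ge {A : Matrix ι ι ℝ} (hA : A.PosDef) :
    ∃ ε : ℝ, 0 < ε ∧ ∀ x : ι → ℝ, ε * ∑ i, x i ^ 2 ≤ ∑ i, ∑ j, A i j * x i * x j := by
  rw [posDef_iff_quad] at hA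
  have hcont : Continuous fun x : ι → ℝ => ∑ i, ∑ j, A i j * x i * x j := by fun_prop
  rcases isEmpty_or_nonempty ι with hι | hι
  · exact ⟨1, one_pos, fun x => by simp⟩
  -- The minimum on the unit sphere of the sup norm extends by homogeneity; the sum of squares is at
  -- most the dimension times the squared sup norm.
  obtain ⟨x₀, hx₀, hmin⟩ := (isCompact_sphere (0 : ι → ℝ) 1).exists_isMinOn
    (NormedSpace.sphere_nonempty.2 zero_le_one) hcont.continuousOn
  have hx₀' : x₀ ≠ 0 := by
    rintro rfl
    simp at hx₀
  set μ := ∑ i, ∑ j, A i j * x₀ i * x₀ j with hμ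
  have hμ0 : 0 < μ := hA.2 x₀ hx₀'
  have hcard : (0 : ℝ) < Fintype.card ι := by exact_mod_cast Fintype.card_pos
  refine ⟨μ / Fintype.card ι, by positivity, fun x => ?_⟩
  have h1 : ∑ i, x i ^ 2 ≤ Fintype.card ι * ‖x‖ ^ 2 := by
    rw [← nsmul_eq_mul]
    refine Finset.sum_le_card_nsmul _ _ _ fun i _ => ?_
    rw [← sq_abs]
    exact pow_le_pow_left₀ (abs_nonneg _) (norm_le_pi_norm x i) 2
  have h2 : μ * ‖x‖ ^ 2 ≤ ∑ i, ∑ j, A i j * x i * x j := by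
    rcases eq_or_ne x 0 with rfl | hx
    · simp
    have hn : ‖x‖ ≠ 0 := norm_ne_zero_iff.2 hx
    have h3 : ‖x‖⁻¹ • x ∈ Metric.sphere (0 : ι → ℝ) 1 := by
      rw [mem_sphere_zero_iff_norm, norm_smul, norm_inv, norm_norm, inv_mul_cancel₀ hn]
    have h4 : μ ≤ ∑ i, ∑ j, A i j * (‖x‖⁻¹ • x) i * (‖x‖⁻¹ • x) j := hmin h3
    have h5 : ∑ i, ∑ j, A i j * (‖x‖⁻¹ • x) i * (‖x‖⁻¹ • x) j
        = (‖x‖ ^ 2)⁻¹ * ∑ i, ∑ j, A i j * x i * x j := by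
      simp only [Finset.mul_sum, Pi.smul_apply, smul_eq_mul]
      refine Finset.sum_congr rfl fun i _ => Finset.sum_congr rfl fun j _ => ?_
      field_simp
    rw [h5] at h4
    have h6 : (0 : ℝ) < ‖x‖ ^ 2 := by positivity
    rwa [← div_eq_inv_mul, le_div_iff₀ h6] at h4
  calc μ / Fintype.card ι * ∑ i, x i ^ 2 ≤ μ / Fintype.card ι * (Fintype.card ι * ‖x‖ ^ 2) := by
        gcongr
    _ = μ * ‖x‖ ^ 2 := by field_simp
    _ ≤ _ := h2

theorem summable_prod_fin {d : ℕ} {f : Fin d → ℤ → ℝ} (hf : ∀ i, Summable (f i))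
    (h0 : ∀ i n, 0 ≤ f i n) : Summable fun n : Fin d → ℤ => ∏ i, f i (n i) := by
  induction d with
  | zero => exact Summable.of_finite
  | succ d ih =>
    rw [← (Fin.consEquiv fun _ => ℤ).summable_iff]
    have h := (hf 0).mul_of_nonneg (ih (fun i => hf i.succ) fun i n => h0 i.succ n) (h0 0)
      fun n => Finset.prod_nonneg fun i _ => h0 _ _
    refine h.congr fun p => ?_
    simp [Fin.consEquiv, Fin.prod_univ_succ]

theorem summable_quad {d : ℕ} {A : Matrix (Fin d) (Fin d) ℝ} (hA : A.PosDef) {τ : ℂ}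
    (hτ : 0 < τ.im) (z : Fin d → ℂ) : Summable fun n : Fin d → ℤ =>
      exp (Real.pi * I * τ * quad A (fun i => n i) + 2 * Real.pi * I * ∑ i, n i * z i) := by
  obtain ⟨ε, hε, h⟩ := exists_quad_ge hA
  refine Summable.of_norm_bounded (summable_prod_fin (f := fun i => gaussBound |(z i).im| (ε * τ.im))
    (fun i => summable_gaussBound _ (by positivity)) fun i n => (Real.exp_pos _).le) fun n => ?_
  have h1 : quad A (fun i => n i) = ((∑ i, ∑ j, A i j * n i * n j : ℝ) : ℂ) := by
    simp [quad]
  have h2 : (Real.pi * I * τ * quad A (fun i => n i) + 2 * Real.pi * I * ∑ i, n i * z i)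
      = (((Real.pi * ∑ i, ∑ j, A i j * n i * n j : ℝ) : ℂ) * τ
        + ((2 * Real.pi : ℝ) : ℂ) * ∑ i, ((n i : ℝ) : ℂ) * z i) * I := by
    rw [h1]
    push_cast
    ring
  rw [Complex.norm_exp, h2, Complex.mul_I_re, Complex.add_im, Complex.im_ofReal_mul,
    Complex.im_ofReal_mul, Complex.im_sum]
  simp only [Complex.im_ofReal_mul, gaussBound]
  rw [← Real.exp_sum, Real.exp_le_exp, ← Finset.mul_sum, Finset.sum_sub_distrib, ← Finset.mul_sum]
  have h3 := h fun i => (n i : ℝ)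
  have h4 : -∑ i, (n i : ℝ) * (z i).im ≤ ∑ i, |(z i).im| * (|n i| : ℤ) := by
    rw [← Finset.sum_neg_distrib]
    refine Finset.sum_le_sum fun i _ => (neg_le_abs _).trans ?_
    rw [abs_mul, mul_comm, Int.cast_abs]
  have h5 : ∑ i, 2 * |(z i).im| * ((|n i| : ℤ) : ℝ) = 2 * ∑ i, |(z i).im| * ((|n i| : ℤ) : ℝ) := by
    rw [Finset.mul_sum]
    exact Finset.sum_congr rfl fun i _ => by ring
  rw [h5]
  have h6 := mul_le_mul_of_nonneg_left h3 (mul_nonneg Real.pi_pos.le hτ.le)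
  have h7 := mul_le_mul_of_nonneg_left h4 (mul_nonneg two_pos.le Real.pi_pos.le)
  linarith

variable [DecidableEq ι]

/-- The inverse form, computed by solving a linear system. -/
theorem quad_inv_eq {A : Matrix ι ι ℝ} (hdet : IsUnit A.det) (x w : ι → ℂ)
    (h : ∀ i, ∑ j, (A i j : ℂ) * w j = x i) : quad A⁻¹ x = ∑ i, x i * w i := by
  have hw : ∀ i, ∑ j, (A⁻¹ i j : ℂ) * x j = w i := by
    intro i
    simp only [← h, Finset.mul_sum]
    rw [Finset.sum_comm]
    have h1 : ∀ l, ∑ j, (A⁻¹ i j : ℂ) * ((A j l : ℂ) * w l) = if i = l then w l else 0 := by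
      intro l
      have : (∑ j, A⁻¹ i j * A j l) = (1 : Matrix ι ι ℝ) i l := by
        rw [← Matrix.nonsing_inv_mul A hdet, Matrix.mul_apply]
      have h2 : (∑ j, (A⁻¹ i j : ℂ) * (A j l : ℂ)) = if i = l then 1 else 0 := by
        rw [Matrix.one_apply] at this
        have := congrArg (fun r : ℝ => (r : ℂ)) this
        push_cast at this
        rw [this]
        split_ifs <;> simp
      calc _ = (∑ j, (A⁻¹ i j : ℂ) * (A j l : ℂ)) * w l := by
            rw [Finset.sum_mul]
            exact Finset.sum_congr rfl fun j _ => by ring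
        _ = _ := by rw [h2]; split_ifs <;> simp
    rw [Finset.sum_congr rfl fun l _ => h1 l]
    simp
  rw [quad]
  refine Finset.sum_congr rfl fun i _ => ?_
  rw [← hw i, Finset.mul_sum]
  exact Finset.sum_congr rfl fun j _ => by ring

end Quadratic

/-- One-dimensional Poisson summation for a shifted Gaussian. -/
theorem tsum_gaussian_shift {a : ℝ} (ha : 0 < a) {τ : ℂ} (hτ : 0 < τ.im) (x : ℝ) (z : ℂ) :
    ∑' n : ℤ, exp (Real.pi * I * τ * (a * (n + x) ^ 2) + 2 * Real.pi * I * (n * z)) =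
      1 / (-I * τ) ^ (1 / 2 : ℂ) * ((Real.sqrt a)⁻¹ : ℝ) *
        ∑' k : ℤ, exp (-(Real.pi * I / τ) * ((z + k) ^ 2 / a) - 2 * Real.pi * I * (x * (z + k))) := by
  have ha' : (a : ℂ) ≠ 0 := by exact_mod_cast ha.ne'
  have hτ0 := ne_zero_of_im_pos hτ
  have h1 : ∑' n : ℤ, exp (Real.pi * I * τ * (a * (n + x) ^ 2) + 2 * Real.pi * I * (n * z)) =
      exp (Real.pi * I * τ * a * x ^ 2) * jacobiTheta₂ (τ * a * x + z) (τ * a) := by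
    rw [jacobiTheta₂, ← tsum_mul_left]
    refine tsum_congr fun n => ?_
    rw [jacobiTheta₂_term, ← Complex.exp_add]
    congr 1
    ring
  -- The principal root splits here because a is a positive real.
  have h2 : (-I * (τ * a)) ^ (1 / 2 : ℂ) = (-I * τ) ^ (1 / 2 : ℂ) * ((Real.sqrt a : ℝ) : ℂ) := by
    have e : ((Real.sqrt a : ℝ) : ℂ) = (a : ℂ) ^ (1 / 2 : ℂ) := by
      rw [Real.sqrt_eq_rpow, Complex.ofReal_cpow ha.le]
      push_cast
      rfl
    have h0 : -I * τ ≠ 0 := mul_ne_zero (neg_ne_zero.2 I_ne_zero) hτ0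
    rw [e, ← mul_assoc, Complex.cpow_def_of_ne_zero (mul_ne_zero h0 ha'),
      Complex.cpow_def_of_ne_zero h0, Complex.cpow_def_of_ne_zero ha', ← Complex.exp_add,
      mul_comm (-I * τ) (a : ℂ), Complex.log_ofReal_mul ha h0, Complex.ofReal_log ha.le]
    congr 1
    ring
  have h3 : (τ * a * x + z) / (τ * a) = -(-(x + z / (τ * a))) := by
    field_simp
  rw [h1, jacobiTheta₂_functional_equation, h2, h3, jacobiTheta₂_neg_left, jacobiTheta₂,
    ← tsum_mul_left, ← tsum_mul_left, ← tsum_mul_left]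
  refine tsum_congr fun k => ?_
  have h4 : exp (-(Real.pi * I / τ) * ((z + k) ^ 2 / a) - 2 * Real.pi * I * (x * (z + k))) =
      exp (Real.pi * I * τ * a * x ^ 2) * (exp (-Real.pi * I * (τ * a * x + z) ^ 2 / (τ * a)) *
        jacobiTheta₂_term k (-(x + z / (τ * a))) (-1 / (τ * a))) := by
    rw [jacobiTheta₂_term, ← Complex.exp_add, ← Complex.exp_add]
    congr 1
    field_simp
    ring
  rw [h4]
  push_cast
  ring

/-! ### Poisson summation in several variables, by induction on the rank -/

section Poisson

variable {d : ℕ}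

/-- The Schur complement of the first diagonal entry. -/
def schur (A : Matrix (Fin (d + 1)) (Fin (d + 1)) ℝ) : Matrix (Fin d) (Fin d) ℝ :=
  Matrix.of fun i j => A i.succ j.succ - A 0 i.succ * A 0 j.succ / A 0 0

variable {A : Matrix (Fin (d + 1)) (Fin (d + 1)) ℝ}

theorem posDef_zero_zero (hA : A.PosDef) : 0 < A 0 0 := by
  rw [posDef_iff_quad] at hA
  have := hA.2 (Pi.single 0 1) (by simp)
  simpa [Pi.single_apply] using this

/-- Completing the square in the first variable; this isolates a one-dimensional Gaussian in the
Poisson summation. -/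
theorem quad_cons (hs : ∀ i j, A i j = A j i) (ha : A 0 0 ≠ 0) (x : Fin (d + 1) → ℂ) :
    quad A x = A 0 0 * (x 0 + ∑ i : Fin d, ((A 0 i.succ / A 0 0 : ℝ) : ℂ) * x i.succ) ^ 2 +
      quad (schur A) fun i => x i.succ := by
  have ha' : (A 0 0 : ℂ) ≠ 0 := by exact_mod_cast ha
  set X := ∑ i : Fin d, ((A 0 i.succ / A 0 0 : ℝ) : ℂ) * x i.succ with hX
  have h1 : ∑ i : Fin d, (A 0 i.succ : ℂ) * x i.succ = A 0 0 * X := by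
    rw [hX, Finset.mul_sum]
    refine Finset.sum_congr rfl fun i _ => ?_
    push_cast
    field_simp
  have h2 : ∑ i : Fin d, ∑ j : Fin d, (A 0 i.succ * A 0 j.succ / A 0 0 : ℂ) * x i.succ * x j.succ
      = A 0 0 * X ^ 2 := by
    have : (A 0 0 : ℂ) * X ^ 2 = (A 0 0 * X) * (A 0 0 * X) / A 0 0 := by field_simp
    rw [this, ← h1, Finset.sum_mul_sum, Finset.sum_div]
    refine Finset.sum_congr rfl fun i _ => ?_
    rw [Finset.sum_div]
    exact Finset.sum_congr rfl fun j _ => by ring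
  have h3 : quad (schur A) (fun i => x i.succ) =
      (∑ i : Fin d, ∑ j : Fin d, (A i.succ j.succ : ℂ) * x i.succ * x j.succ) - A 0 0 * X ^ 2 := by
    rw [← h2, quad, ← Finset.sum_sub_distrib]
    refine Finset.sum_congr rfl fun i _ => ?_
    rw [← Finset.sum_sub_distrib]
    refine Finset.sum_congr rfl fun j _ => ?_
    simp only [schur, Matrix.of_apply]
    push_cast
    ring
  have h4 : ∑ j : Fin d, (A 0 j.succ : ℂ) * x 0 * x j.succ = x 0 * (A 0 0 * X) := by
    rw [← h1, Finset.mul_sum]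
    exact Finset.sum_congr rfl fun i _ => by ring
  have h5 : ∑ i : Fin d, (A i.succ 0 : ℂ) * x i.succ * x 0 = x 0 * (A 0 0 * X) := by
    rw [← h1, Finset.mul_sum]
    refine Finset.sum_congr rfl fun i _ => ?_
    rw [hs i.succ 0]
    ring
  rw [h3, quad, Fin.sum_univ_succ]
  simp only [Fin.sum_univ_succ, Finset.sum_add_distrib]
  rw [h4, h5]
  ring

theorem schur_posDef (hA : A.PosDef) : (schur A).PosDef := by
  have ha := posDef_zero_zero hA
  rw [posDef_iff_quad] at hA ⊢
  refine ⟨fun i j => ?_, fun x hx => ?_⟩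
  · simp only [schur, Matrix.of_apply]
    rw [hA.1 i.succ j.succ]
    ring
  -- The first coordinate is chosen to make the completed square vanish.
  · have h1 := hA.2 (Fin.cons (-∑ i : Fin d, A 0 i.succ / A 0 0 * x i) x) ?_
    · have h2 := quad_cons hA.1 ha.ne'
        (fun i => ((Fin.cons (-∑ i : Fin d, A 0 i.succ / A 0 0 * x i) x : Fin (d + 1) → ℝ) i : ℂ))
      simp only [Fin.cons_zero, Fin.cons_succ] at h2
      push_cast at h2
      rw [neg_add_cancel, zero_pow two_ne_zero, mul_zero, zero_add] at h2
      simp only [quad] at h2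
      have h3 : (∑ i, ∑ j, A i j *
          (Fin.cons (-∑ i : Fin d, A 0 i.succ / A 0 0 * x i) x : Fin (d + 1) → ℝ) i *
          (Fin.cons (-∑ i : Fin d, A 0 i.succ / A 0 0 * x i) x : Fin (d + 1) → ℝ) j) =
          ∑ i, ∑ j, schur A i j * x i * x j := by
        exact_mod_cast h2
      rwa [h3] at h1
    · intro h
      refine hx (funext fun i => ?_)
      have := congrFun h i.succ
      simpa using this

theorem det_eq_mul_det_schur (hs : ∀ i j, A i j = A j i) (ha : A 0 0 ≠ 0) :
    A.det = A 0 0 * (schur A).det := by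
  -- The result of clearing the first column by row operations.
  set B : Matrix (Fin (d + 1)) (Fin (d + 1)) ℝ := Matrix.of
    (Fin.cons (A 0) fun i => Fin.cons 0 (schur A i)) with hB
  have h1 : A.det = B.det := by
    refine Matrix.det_eq_of_forall_row_eq_smul_add_const
      (Fin.cons 0 fun i => A 0 i.succ / A 0 0) 0 rfl fun i j => ?_
    refine Fin.cases ?_ (fun i => ?_) i
    · simp [hB]
    · refine Fin.cases ?_ (fun j => ?_) j
      · simp only [hB, Matrix.of_apply, Fin.cons_succ, Fin.cons_zero, zero_add]
        rw [div_mul_cancel₀ _ ha, hs]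
      · simp only [hB, Matrix.of_apply, Fin.cons_succ, Fin.cons_zero, schur]
        ring
  have h2 : B.submatrix Fin.succ Fin.succ = schur A := by
    ext i j
    simp [hB]
  rw [h1, Matrix.det_succ_column_zero, Fin.sum_univ_succ, Finset.sum_eq_zero]
  · simp only [Fin.val_zero, pow_zero, one_mul, add_zero, Fin.succAbove_zero, h2]
    simp [hB]
  · intro i _
    simp [hB]

/-- The dual of completing the square. The system A w = x is solved by elimination: the Schur system
gives the later coordinates, and the first row then gives the first one. -/
theorem quad_inv_cons (hA : A.PosDef) (x : Fin (d + 1) → ℂ) :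
    quad A⁻¹ x = x 0 ^ 2 / A 0 0 +
      quad (schur A)⁻¹ fun i => x i.succ - ((A 0 i.succ / A 0 0 : ℝ) : ℂ) * x 0 := by
  have ha := posDef_zero_zero hA
  have ha' : (A 0 0 : ℂ) ≠ 0 := by exact_mod_cast ha.ne'
  have hs := (posDef_iff_quad.1 hA).1
  have hS := (schur_posDef hA).det_pos.ne'.isUnit
  set y : Fin d → ℂ := fun i => x i.succ - ((A 0 i.succ / A 0 0 : ℝ) : ℂ) * x 0 with hy
  set w' : Fin d → ℂ := fun i => ∑ j, ((schur A)⁻¹ i j : ℂ) * y j with hw'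
  have hSw : ∀ i, ∑ j, (schur A i j : ℂ) * w' j = y i := by
    intro i
    simp only [hw', Finset.mul_sum]
    rw [Finset.sum_comm]
    have h1 : ∀ l, ∑ j, (schur A i j : ℂ) * (((schur A)⁻¹ j l : ℂ) * y l)
        = if i = l then y l else 0 := by
      intro l
      have : (∑ j, schur A i j * (schur A)⁻¹ j l) = (1 : Matrix (Fin d) (Fin d) ℝ) i l := by
        rw [← Matrix.mul_nonsing_inv _ hS, Matrix.mul_apply]
      rw [Matrix.one_apply] at this
      have := congrArg (fun r : ℝ => (r : ℂ) * y l) this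
      push_cast at this
      rw [Finset.sum_mul] at this
      calc _ = _ := Finset.sum_congr rfl fun j _ => by rw [← mul_assoc]
        _ = _ := this
        _ = _ := by split_ifs <;> simp
    rw [Finset.sum_congr rfl fun l _ => h1 l]
    simp
  set X := ∑ i : Fin d, ((A 0 i.succ / A 0 0 : ℝ) : ℂ) * w' i with hX
  have hX' : ∑ i : Fin d, (A 0 i.succ : ℂ) * w' i = A 0 0 * X := by
    rw [hX, Finset.mul_sum]
    refine Finset.sum_congr rfl fun i _ => ?_
    push_cast
    field_simp
  have key := quad_inv_eq hA.det_pos.ne'.isUnit x (Fin.cons (x 0 / A 0 0 - X) w') ?_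
  · rw [key, quad_inv_eq hS y w' hSw, Fin.sum_univ_succ]
    simp only [Fin.cons_zero, Fin.cons_succ, hy, sub_mul, Finset.sum_sub_distrib]
    have : ∑ i : Fin d, ((A 0 i.succ / A 0 0 : ℝ) : ℂ) * x 0 * w' i = x 0 * X := by
      rw [hX, Finset.mul_sum]
      exact Finset.sum_congr rfl fun i _ => by ring
    rw [this]
    ring
  · intro i
    rw [Fin.sum_univ_succ]
    simp only [Fin.cons_zero, Fin.cons_succ]
    refine Fin.cases ?_ (fun i => ?_) i
    · rw [hX']
      field_simp
      ring
    · have h1 := hSw i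
      simp only [schur, Matrix.of_apply, hy] at h1
      push_cast at h1
      simp only [sub_mul, Finset.sum_sub_distrib] at h1
      have h2 : ∑ j : Fin d, (A 0 i.succ * A 0 j.succ / A 0 0 : ℂ) * w' j = A 0 i.succ * X := by
        rw [hX, Finset.mul_sum]
        refine Finset.sum_congr rfl fun i _ => ?_
        push_cast
        ring
      rw [h2] at h1
      rw [hs i.succ 0]
      linear_combination h1

theorem summable_quad_inv {d : ℕ} {A : Matrix (Fin d) (Fin d) ℝ} (hA : A.PosDef) {τ : ℂ}
    (hτ : 0 < τ.im) (z : Fin d → ℂ) :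
    Summable (fun k : Fin d → ℤ => exp (-(Real.pi * I / τ) * quad A⁻¹ fun i => z i + k i)) := by
  have hs := (posDef_iff_quad.1 hA.inv).1
  have h := (summable_quad hA.inv (im_neg_one_div_pos hτ)
    (fun i => -1 / τ * ∑ j, (A⁻¹ i j : ℂ) * z j)).mul_left (exp (-(Real.pi * I / τ) * quad A⁻¹ z))
  refine h.congr fun k => ?_
  rw [← Complex.exp_add]
  congr 1
  have h1 : quad A⁻¹ (fun i => z i + k i) = quad A⁻¹ z + 2 * (∑ i, k i * ∑ j, (A⁻¹ i j : ℂ) * z j)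
      + quad A⁻¹ (fun i => k i) := by
    have h2 : ∑ i, ∑ j, (A⁻¹ i j : ℂ) * z i * k j = ∑ i, k i * ∑ j, (A⁻¹ i j : ℂ) * z j := by
      rw [Finset.sum_comm]
      refine Finset.sum_congr rfl fun i _ => ?_
      rw [Finset.mul_sum]
      refine Finset.sum_congr rfl fun j _ => ?_
      rw [hs j i]
      ring
    have h3 : ∑ i, ∑ j, (A⁻¹ i j : ℂ) * k i * z j = ∑ i, k i * ∑ j, (A⁻¹ i j : ℂ) * z j := by
      refine Finset.sum_congr rfl fun i _ => ?_
      rw [Finset.mul_sum]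
      exact Finset.sum_congr rfl fun j _ => by ring
    simp only [quad, mul_add, add_mul, Finset.sum_add_distrib]
    rw [h2, h3]
    ring
  have h4 : ∑ i, (k i : ℂ) * (-1 / τ * ∑ j, (A⁻¹ i j : ℂ) * z j)
      = -1 / τ * ∑ i, k i * ∑ j, (A⁻¹ i j : ℂ) * z j := by
    rw [Finset.mul_sum]
    exact Finset.sum_congr rfl fun i _ => by ring
  rw [h1, h4]
  ring

theorem summable_gaussian_inv {a : ℝ} (ha : 0 < a) {τ : ℂ} (hτ : 0 < τ.im) (z : ℂ) :
    Summable fun k : ℤ => exp (-(Real.pi * I / τ) * ((z + k) ^ 2 / a)) := by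
  have ha' : (a : ℂ) ≠ 0 := by exact_mod_cast ha.ne'
  have hτ0 := ne_zero_of_im_pos hτ
  have hT : 0 < (-1 / (τ * a)).im := by
    refine im_neg_one_div_pos ?_
    rw [mul_comm, Complex.im_ofReal_mul]
    positivity
  refine (((summable_jacobiTheta₂_term_iff (-(z / (τ * a))) _).2 hT).mul_left
    (exp (-(Real.pi * I / τ) * (z ^ 2 / a)))).congr fun k => ?_
  rw [jacobiTheta₂_term, ← Complex.exp_add]
  congr 1
  field_simp
  ring

/-- Poisson summation for a positive definite quadratic form. -/
theorem tsum_quad_S {d : ℕ} {A : Matrix (Fin d) (Fin d) ℝ} (hA : A.PosDef) {τ : ℂ}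
    (hτ : 0 < τ.im) (z : Fin d → ℂ) :
    ∑' n : Fin d → ℤ, exp (Real.pi * I * τ * quad A (fun i => n i)
        + 2 * Real.pi * I * ∑ i, n i * z i) =
      (1 / (-I * τ) ^ (1 / 2 : ℂ)) ^ d * ((Real.sqrt A.det)⁻¹ : ℝ) *
        ∑' k : Fin d → ℤ, exp (-(Real.pi * I / τ) * quad A⁻¹ fun i => z i + k i) := by
  induction d with
  | zero => simp [quad, tsum_fintype]
  | succ d ih =>
    have ha := posDef_zero_zero hA
    have hs := (posDef_iff_quad.1 hA).1
    have hS := schur_posDef hA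
    set K : ℂ := 1 / (-I * τ) ^ (1 / 2 : ℂ) with hK
    set a := A 0 0 with haa
    set c : Fin d → ℝ := fun i => A 0 i.succ / a with hc
    set z' : Fin d → ℂ := fun i => z i.succ with hz'
    set x : (Fin d → ℤ) → ℝ := fun n => ∑ i, c i * n i with hx
    -- g carries the last d variables with the Schur form, G is a one-dimensional Gaussian in n₀
    -- recentred at -x(n), and H is its Poisson dual.
    set g : (Fin d → ℤ) → ℂ := fun n => exp (Real.pi * I * τ * quad (schur A) (fun i => n i)
        + 2 * Real.pi * I * ∑ i, n i * z' i) with hg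
    set G : ℤ → (Fin d → ℤ) → ℂ := fun n₀ n =>
      exp (Real.pi * I * τ * (a * (n₀ + x n) ^ 2) + 2 * Real.pi * I * (n₀ * z 0)) with hG
    set H : ℤ → (Fin d → ℤ) → ℂ := fun k₀ n => exp (-(Real.pi * I / τ) * ((z 0 + k₀) ^ 2 / a)
      - 2 * Real.pi * I * (x n * (z 0 + k₀))) with hH
    have e1 : ∀ p : ℤ × (Fin d → ℤ), exp (Real.pi * I * τ *
          quad A (fun i => ((Fin.consEquiv (fun _ => ℤ) p i : ℤ) : ℂ))
        + 2 * Real.pi * I * ∑ i, ((Fin.consEquiv (fun _ => ℤ) p i : ℤ) : ℂ) * z i) =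
        g p.2 * G p.1 p.2 := by
      rintro ⟨n₀, n⟩
      rw [← Complex.exp_add, quad_cons hs ha.ne', Fin.sum_univ_succ]
      simp only [Fin.consEquiv, Equiv.coe_fn_mk, Fin.cons_zero, Fin.cons_succ, hx, hc, hz', haa]
      congr 1
      push_cast
      ring
    have s1 : Summable fun p : ℤ × (Fin d → ℤ) => g p.2 * G p.1 p.2 :=
      ((Fin.consEquiv (fun _ => ℤ)).summable_iff.2 (summable_quad hA hτ z)).congr e1
    have e2 : ∀ k₀ n, g n * H k₀ n = exp (-(Real.pi * I / τ) * ((z 0 + k₀) ^ 2 / a)) *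
        exp (Real.pi * I * τ * quad (schur A) (fun i => n i)
          + 2 * Real.pi * I * ∑ i, n i * (z' i - c i * (z 0 + k₀))) := by
      intro k₀ n
      rw [← Complex.exp_add, ← Complex.exp_add]
      congr 1
      simp only [mul_sub, Finset.sum_sub_distrib, hx]
      push_cast
      rw [Finset.sum_mul, Finset.sum_congr rfl fun i _ =>
        (by ring : (n i : ℂ) * (c i * (z 0 + k₀)) = c i * n i * (z 0 + k₀))]
      ring
    -- The coupling between k₀ and n is the phase e^{-2πi x(n) k₀} with x(n) real, so in absolute
    -- value the double series is a product of two summable ones.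
    have s2 : Summable fun p : ℤ × (Fin d → ℤ) => g p.2 * H p.1 p.2 := by
      have h1 := (summable_gaussian_inv ha hτ (z 0)).norm.mul_norm
        (summable_quad hS hτ fun i => z' i - c i * z 0).norm
      refine Summable.of_norm (h1.congr fun p => ?_)
      have h2 : g p.2 * H p.1 p.2 = (exp (-(Real.pi * I / τ) * ((z 0 + p.1) ^ 2 / a)) *
          exp (Real.pi * I * τ * quad (schur A) (fun i => p.2 i)
          + 2 * Real.pi * I * ∑ i, p.2 i * (z' i - c i * z 0))) *
          exp (((-(2 * Real.pi * (x p.2 * p.1)) : ℝ) : ℂ) * I) := by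
        rw [e2, mul_assoc (exp _) (exp _) (exp _)]
        congr 1
        rw [← Complex.exp_add]
        congr 1
        simp only [mul_sub, mul_add, Finset.sum_sub_distrib, Finset.sum_add_distrib, hx]
        push_cast
        rw [Finset.sum_mul, Finset.sum_congr rfl fun i _ =>
          (by ring : (p.2 i : ℂ) * (c i * p.1) = c i * p.2 i * p.1)]
        ring
      rw [h2, norm_mul _ (exp (_ * I)), Complex.norm_exp_ofReal_mul_I, mul_one]
    have e3 : ∀ n, ∑' n₀ : ℤ, g n * G n₀ n = K * ((Real.sqrt a)⁻¹ : ℝ) * ∑' k₀ : ℤ, g n * H k₀ n := by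
      intro n
      rw [tsum_mul_left, tsum_gaussian_shift ha hτ, tsum_mul_left]
      ring
    -- H shifts the linear argument z' by -c(z₀ + k₀), which is the displacement in `quad_inv_cons`;
    -- the induction hypothesis applies to the Schur form.
    have e4 : ∀ k₀ : ℤ, ∑' n, g n * H k₀ n = K ^ d * ((Real.sqrt (schur A).det)⁻¹ : ℝ) *
        ∑' k : Fin d → ℤ, exp (-(Real.pi * I / τ) * quad A⁻¹
          fun i => z i + ((Fin.consEquiv (fun _ => ℤ) (k₀, k) i : ℤ) : ℂ)) := by
      intro k₀
      rw [tsum_congr fun n => e2 k₀ n, tsum_mul_left, ih hS fun i => z' i - c i * (z 0 + k₀),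
        mul_left_comm, ← tsum_mul_left]
      congr 1
      refine tsum_congr fun k => ?_
      rw [quad_inv_cons hA, ← Complex.exp_add, ← mul_add]
      simp only [Fin.consEquiv, Equiv.coe_fn_mk, Fin.cons_zero, Fin.cons_succ, hz', hc]
      congr 4
      funext i
      ring
    have s3 := (Fin.consEquiv (fun _ => ℤ)).summable_iff.2 (summable_quad_inv hA hτ z)
    have s3' := s3.tsum_prod
    simp only [Function.comp_apply] at s3'
    have s1' : ∑' p : ℤ × (Fin d → ℤ), g p.2 * G p.1 p.2 = ∑' n₀, ∑' n, g n * G n₀ n := s1.tsum_prod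
    have s1'' : Summable (Function.uncurry fun n₀ n => g n * G n₀ n) := s1
    have s2' : Summable (Function.uncurry fun k₀ n => g n * H k₀ n) := s2
    rw [← (Fin.consEquiv (fun _ => ℤ)).tsum_eq, tsum_congr e1, s1',
      ← s1''.tsum_comm, tsum_congr e3, tsum_mul_left, s2'.tsum_comm, tsum_congr e4, tsum_mul_left,
      ← (Fin.consEquiv (fun _ => ℤ)).tsum_eq, s3', det_eq_mul_det_schur hs ha.ne',
      Real.sqrt_mul ha.le, mul_inv, pow_succ]
    push_cast
    ring

end Poisson

/-! ### Integral forms -/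

section Integral

variable {ι : Type*} [Fintype ι] [DecidableEq ι]

theorem tendsto_floor_mul_div (x : ℝ) :
    Filter.Tendsto (fun t : ℕ => (⌊(t : ℝ) * x⌋ : ℝ) / t) Filter.atTop (nhds x) := by
  have h1 : Filter.Tendsto (fun t : ℕ => x - 1 / (t : ℝ)) Filter.atTop (nhds x) := by
    simpa using tendsto_const_nhds.sub (tendsto_one_div_atTop_nhds_zero_nat (𝕜 := ℝ))
  refine tendsto_of_tendsto_of_tendsto_of_le_of_le' h1 tendsto_const_nhds ?_ ?_
  · filter_upwards [Filter.eventually_gt_atTop 0] with t ht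
    have ht' : (0 : ℝ) < t := by exact_mod_cast ht
    rw [le_div_iff₀ ht', sub_mul, one_div_mul_cancel ht'.ne']
    nlinarith [Int.lt_floor_add_one ((t : ℝ) * x)]
  · filter_upwards [Filter.eventually_gt_atTop 0] with t ht
    have ht' : (0 : ℝ) < t := by exact_mod_cast ht
    rw [div_le_iff₀ ht']
    nlinarith [Int.floor_le ((t : ℝ) * x)]

/-- An integral symmetric matrix that is positive on nonzero integral vectors is positive
definite. -/
theorem posDef_of_int (N : Matrix ι ι ℤ) (hs : ∀ i j, N i j = N j i)
    (hN : ∀ v : ι → ℤ, v ≠ 0 → 0 < ∑ i, ∑ j, N i j * v i * v j) :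
    (N.map ((↑) : ℤ → ℝ)).PosDef := by
  -- Approximating real vectors by rational ones only gives semidefiniteness; a degenerate integral
  -- form would have an integral kernel vector, which the hypothesis excludes.
  have h0 : ∀ x : ι → ℝ, 0 ≤ ∑ i, ∑ j, (N i j : ℝ) * x i * x j := by
    intro x
    have hlim : Filter.Tendsto (fun t : ℕ => ∑ i, ∑ j, (N i j : ℝ) * ((⌊(t : ℝ) * x i⌋ : ℝ) / t) *
        ((⌊(t : ℝ) * x j⌋ : ℝ) / t)) Filter.atTop
        (nhds (∑ i, ∑ j, (N i j : ℝ) * x i * x j)) :=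
      tendsto_finsetSum _ fun i _ => tendsto_finsetSum _ fun j _ =>
        (tendsto_const_nhds.mul (tendsto_floor_mul_div _)).mul (tendsto_floor_mul_div _)
    refine ge_of_tendsto' hlim fun t => ?_
    have h1 : ∑ i, ∑ j, (N i j : ℝ) * ((⌊(t : ℝ) * x i⌋ : ℝ) / t) * ((⌊(t : ℝ) * x j⌋ : ℝ) / t) =
        ((∑ i, ∑ j, N i j * ⌊(t : ℝ) * x i⌋ * ⌊(t : ℝ) * x j⌋ : ℤ) : ℝ) / (t : ℝ) ^ 2 := by
      push_cast
      rw [Finset.sum_div]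
      refine Finset.sum_congr rfl fun i _ => ?_
      rw [Finset.sum_div]
      refine Finset.sum_congr rfl fun j _ => ?_
      ring
    rw [h1]
    refine div_nonneg ?_ (sq_nonneg _)
    rcases eq_or_ne (fun i => ⌊(t : ℝ) * x i⌋) 0 with h2 | h2
    · have h3 : ∀ i, ⌊(t : ℝ) * x i⌋ = 0 := fun i => congrFun h2 i
      simp [h3]
    · exact_mod_cast (hN _ h2).le
  have hsemi : (N.map ((↑) : ℤ → ℝ)).PosSemidef := by
    rw [Matrix.posSemidef_iff_dotProduct_mulVec]
    refine ⟨Matrix.IsHermitian.ext fun i j => by simp [hs i j], fun x => ?_⟩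
    refine (h0 x).trans_eq ?_
    simp only [dotProduct, Matrix.mulVec, Finset.mul_sum, star_trivial, Matrix.map_apply]
    exact Finset.sum_congr rfl fun i _ => Finset.sum_congr rfl fun j _ => by ring
  rw [hsemi.posDef_iff_det_ne_zero]
  intro hdet
  have hdet' : N.det = 0 := by
    have h1 : ((N.det : ℤ) : ℝ) = (N.map ((↑) : ℤ → ℝ)).det := (Int.castRingHom ℝ).map_det N
    rw [hdet] at h1
    exact_mod_cast h1
  obtain ⟨v, hv, hv'⟩ := Matrix.exists_mulVec_eq_zero_iff.2 hdet'
  have h1 := hN v hv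
  have h2 : ∑ i, ∑ j, N i j * v i * v j = ∑ i, v i * N.mulVec v i := by
    simp only [Matrix.mulVec, dotProduct, Finset.mul_sum]
    exact Finset.sum_congr rfl fun i _ => Finset.sum_congr rfl fun j _ => by ring
  rw [h2, hv'] at h1
  simp at h1

/-- The image of an integral matrix of nonzero determinant has index `|det|`. -/
theorem index_range_toLin' (N : Matrix ι ι ℤ) (hN : N.det ≠ 0) :
    (LinearMap.range (Matrix.toLin' N)).toAddSubgroup.index = N.det.natAbs := by
  have hinj : Function.Injective (Matrix.toLin' N) := by
    rw [← LinearMap.ker_eq_bot, LinearMap.ker_eq_bot']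
    intro v hv
    exact Matrix.eq_zero_of_mulVec_eq_zero hN (by simpa using hv)
  have h := Submodule.natAbs_det_equiv (LinearMap.range (Matrix.toLin' N))
    (LinearEquiv.ofInjective _ hinj)
  have h' : (LinearMap.range (Matrix.toLin' N)).subtype ∘ₗ
      ((LinearEquiv.ofInjective (Matrix.toLin' N) hinj :
        (ι → ℤ) →+ LinearMap.range (Matrix.toLin' N))).toIntLinearMap = Matrix.toLin' N := by
    ext
    rfl
  rw [h', LinearMap.det_toLin'] at h
  rw [h]
  rfl

end Integral

namespace Setting

variable {V : Type*} [AddCommGroup V] [Module ℂ V] {m n : ℕ} (S : Setting V m n)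

/-! ### The lattice `M` -/

theorem form_comm (x y : V) : S.form x y = S.form y x := S.form_symm.eq x y

theorem gamma_mem (i : Fin m) : S.gamma i ∈ S.L := Submodule.subset_span ⟨i, rfl⟩

theorem gam_mem (p : Fin n) : S.gam p ∈ S.L := S.gamma_mem _

theorem form_gam_beta (p q : Fin n) : S.form (S.gam p) (S.beta q) = if p = q then -1 else 0 := by
  rw [gam, S.gamma_beta]
  simp [Fin.ext_iff]

theorem ofReal_form {x y : V} (hx : x ∈ S.L) (hy : y ∈ S.L) :
    ((S.form x y).re : ℂ) = S.form x y :=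
  Complex.ext (by simp) (by simp [S.form_real x hx y hy])

theorem k_ne_zero : (S.k : ℂ) ≠ 0 := by exact_mod_cast S.k_pos.ne'

/-- `x + ∑_{p ≤ s} (x|γ_p) β_p`. -/
def shift (s : ℕ) : V →ₗ[ℂ] V :=
  LinearMap.id + ∑ p ∈ Finset.univ.filter (fun p : Fin n => (p : ℕ) < s),
    (S.form.flip (S.gam p)).smulRight (S.beta p)

theorem shift_apply (s : ℕ) (x : V) : S.shift s x =
    x + ∑ p ∈ Finset.univ.filter (fun p : Fin n => (p : ℕ) < s), S.form x (S.gam p) • S.beta p := by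
  simp [shift]

theorem shift_top (x : V) : S.shift n x = x + ∑ p, S.form x (S.gam p) • S.beta p := by
  rw [shift_apply]
  congr 2
  simp

theorem stageWeight_eq (s : ℕ) (lam : AffineDual V) :
    S.stageWeight s lam = (S.shift s lam.bar, lam.2) := by
  rw [stageWeight, shift_apply]

theorem form_shift_beta (s : ℕ) (x : V) (q : Fin n) :
    S.form (S.shift s x) (S.beta q) = S.form x (S.beta q) := by
  simp [shift_apply, S.beta_isotropic]

theorem form_shift_left (s : ℕ) (x : V) {y : V} (hy : ∀ q, S.form y (S.beta q) = 0) :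
    S.form (S.shift s x) y = S.form x y := by
  simp [shift_apply, S.form_comm (S.beta _) y, hy]

/-- The added vectors lie in the span of T, which is isotropic and orthogonal to both arguments: on
the orthogonal complement of T the shift is an isometry. -/
theorem form_shift_shift (s : ℕ) {x y : V} (hx : ∀ q, S.form x (S.beta q) = 0)
    (hy : ∀ q, S.form y (S.beta q) = 0) : S.form (S.shift s x) (S.shift s y) = S.form x y := by
  rw [S.form_shift_left s x fun q => by rw [S.form_shift_beta, hy], S.form_comm,
    S.form_shift_left s y hx, S.form_comm]

/-- As (β_p|γ_q) = -δ_{pq}, the added multiples of the β_p cancel the products with the γ_q; this is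
the purpose of the shift. -/
theorem form_shift_gam {x : V} (q : Fin n) :
    S.form (S.shift n x) (S.gam q) = 0 := by
  simp [shift_top, S.form_comm (S.beta _) (S.gam _), form_gam_beta]

theorem shift_succ (s : ℕ) (hs : s < n) (x : V) :
    S.shift (s + 1) x = S.shift s x + S.form x (S.gam ⟨s, hs⟩) • S.beta ⟨s, hs⟩ := by
  have h : Finset.univ.filter (fun p : Fin n => (p : ℕ) < s + 1) =
      insert ⟨s, hs⟩ (Finset.univ.filter (fun p : Fin n => (p : ℕ) < s)) := by
    ext p
    simp [Fin.ext_iff, le_iff_lt_or_eq, or_comm]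
  rw [shift_apply, shift_apply, h, Finset.sum_insert (by simp)]
  abel

/-- The span of the `γ_i`, `i > n`. -/
def coreLattice : Submodule ℤ V := Submodule.span ℤ (S.gamma '' {i | n ≤ (i : ℕ)})

theorem coreLattice_le : S.coreLattice ≤ S.L :=
  Submodule.span_mono (Set.image_subset_range _ _)

theorem form_coreLattice_beta {x : V} (hx : x ∈ S.coreLattice) (q : Fin n) :
    S.form x (S.beta q) = 0 := by
  induction hx using Submodule.span_induction with
  | mem x hx =>
    obtain ⟨i, hi, rfl⟩ := hx
    rw [S.gamma_beta, if_neg]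
    have hi : n ≤ (i : ℕ) := hi
    omega
  | zero => simp
  | add x y _ _ hx hy => simp [hx, hy]
  | smul a x _ hx => simp [hx]

theorem span_stageVec (s : ℕ) : Submodule.span ℤ (S.stageVec s '' {i | n ≤ (i : ℕ)}) =
    S.coreLattice.map ((S.shift s).restrictScalars ℤ) := by
  rw [coreLattice, Submodule.map_span, ← Set.image_comp]
  congr 1
  refine Set.image_congr fun i _ => ?_
  simp [stageVec, shift_apply]

theorem M_eq : S.M = S.coreLattice.map ((S.shift n).restrictScalars ℤ) := S.span_stageVec n

theorem eq_zero_of_form_self {x : V} (hx : x ∈ S.L) (h : S.form x x = 0) : x = 0 := by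
  by_contra h0
  have := S.form_pos x hx h0
  rw [h] at this
  simp at this

/-- An isometry on vectors of positive norm has no kernel; it allows sums over L_s to be pulled
back. -/
theorem shift_injOn (s : ℕ) : Set.InjOn (S.shift s) S.coreLattice := by
  intro x hx y hy h
  have hd : x - y ∈ S.coreLattice := sub_mem hx hy
  rw [← sub_eq_zero]
  refine S.eq_zero_of_form_self (S.coreLattice_le hd) ?_
  rw [← S.form_shift_shift s (S.form_coreLattice_beta hd) (S.form_coreLattice_beta hd), map_sub,
    sub_eq_zero.2 h]
  simp

/-- Sums over the image of `coreLattice` are sums over `coreLattice`. -/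
theorem tsum_map_shift (s : ℕ) (f : V → ℂ) :
    ∑' x : S.coreLattice.map ((S.shift s).restrictScalars ℤ), f x =
      ∑' x : S.coreLattice, f (S.shift s x) :=
  tsum_image f (S.shift_injOn s)

theorem tsum_M (f : V → ℂ) : ∑' x : S.M, f x = ∑' x : S.coreLattice, f (S.shift n x) := by
  rw [M_eq]
  exact S.tsum_map_shift n f

theorem exists_of_mem_M {x : V} (hx : x ∈ S.M) : ∃ y ∈ S.coreLattice, S.shift n y = x := by
  rw [M_eq] at hx
  exact hx

theorem form_M_beta {x : V} (hx : x ∈ S.M) (q : Fin n) : S.form x (S.beta q) = 0 := by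
  obtain ⟨y, hy, rfl⟩ := S.exists_of_mem_M hx
  rw [form_shift_beta, S.form_coreLattice_beta hy]

theorem form_M_gam {x : V} (hx : x ∈ S.M) (q : Fin n) : S.form x (S.gam q) = 0 := by
  obtain ⟨y, hy, rfl⟩ := S.exists_of_mem_M hx
  exact S.form_shift_gam q

theorem exists_k_form_M {x y : V} (hx : x ∈ S.M) (hy : y ∈ S.M) :
    ∃ a : ℤ, (S.k : ℂ) * S.form x y = a := by
  obtain ⟨u, hu, rfl⟩ := S.exists_of_mem_M hx
  obtain ⟨v, hv, rfl⟩ := S.exists_of_mem_M hy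
  rw [S.form_shift_shift n (S.form_coreLattice_beta hu) (S.form_coreLattice_beta hv)]
  exact S.k_integral u (S.coreLattice_le hu) v (S.coreLattice_le hv)

/-- The basis of `M`. -/
def basisM (i : Fin (m - n)) : V := S.stageVec n ⟨n + i, by omega⟩

/-- The basis vectors `γ_i`, `i > n`. -/
def coreGamma (i : Fin (m - n)) : V := S.gamma ⟨n + i, by omega⟩

theorem basisM_eq (i : Fin (m - n)) : S.basisM i = S.shift n (S.coreGamma i) := by
  simp [basisM, coreGamma, stageVec, shift_apply]

theorem coreGamma_mem (i : Fin (m - n)) : S.coreGamma i ∈ S.coreLattice :=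
  Submodule.subset_span ⟨_, by simp, rfl⟩

theorem basisM_mem (i : Fin (m - n)) : S.basisM i ∈ S.M :=
  Submodule.subset_span ⟨⟨n + i, by omega⟩, by simp, rfl⟩

theorem M_eq_span : S.M = Submodule.span ℤ (Set.range S.basisM) := by
  rw [M, stageLattice]
  congr 1
  ext x
  constructor
  · rintro ⟨i, hi, rfl⟩
    have hi : n ≤ (i : ℕ) := hi
    exact ⟨⟨i - n, by omega⟩, by simp [basisM, Nat.add_sub_cancel' hi]⟩
  · rintro ⟨i, rfl⟩
    exact ⟨⟨n + i, by omega⟩, by simp, rfl⟩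

theorem coreGamma_indep : LinearIndependent ℤ S.coreGamma :=
  S.gamma_indep.comp (fun i : Fin (m - n) => (⟨n + i, by omega⟩ : Fin m)) fun i j h => by
    simpa [Fin.ext_iff] using h

theorem mem_M_iff {x : V} : x ∈ S.M ↔ ∃ a : Fin (m - n) → ℤ, ∑ i, a i • S.basisM i = x := by
  rw [M_eq_span, Submodule.mem_span_range_iff_exists_fun]

/-- The integral Gram matrix of `M` with respect to `k ( . | . )`. -/
def gram (i j : Fin (m - n)) : ℤ := Classical.choose
  (S.exists_k_form_M (S.basisM_mem i) (S.basisM_mem j))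

theorem gram_eq (i j : Fin (m - n)) :
    (S.gram i j : ℂ) = S.k * S.form (S.basisM i) (S.basisM j) :=
  (Classical.choose_spec (S.exists_k_form_M (S.basisM_mem i) (S.basisM_mem j))).symm

theorem gram_symm (i j : Fin (m - n)) : S.gram i j = S.gram j i := by
  have : (S.gram i j : ℂ) = S.gram j i := by rw [gram_eq, gram_eq, form_comm]
  exact_mod_cast this

theorem k_form_sum_sum (a b : Fin (m - n) → ℂ) :
    S.k * S.form (∑ i, a i • S.basisM i) (∑ i, b i • S.basisM i) =
      ∑ i, ∑ j, S.gram i j * a i * b j := by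
  simp only [map_sum, LinearMap.sum_apply, map_smul, LinearMap.smul_apply, smul_eq_mul,
    Finset.mul_sum]
  rw [Finset.sum_comm]
  refine Finset.sum_congr rfl fun i _ => Finset.sum_congr rfl fun j _ => ?_
  rw [gram_eq]
  ring

/-- The real Gram matrix of `M` with respect to `k ( . | . )`. -/
def gramR : Matrix (Fin (m - n)) (Fin (m - n)) ℝ := (Matrix.of S.gram).map ((↑) : ℤ → ℝ)

theorem gramR_apply (i j : Fin (m - n)) :
    (S.gramR i j : ℂ) = S.k * S.form (S.basisM i) (S.basisM j) := by
  rw [← gram_eq]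
  simp [gramR]

/-- M is the isometric image of a sublattice of L, so positivity on L passes to integral
combinations of the basis of M; integrality of the Gram matrix then gives real definiteness. -/
theorem gramR_posDef : S.gramR.PosDef := by
  refine posDef_of_int _ S.gram_symm fun v hv => ?_
  set x := ∑ i, v i • S.coreGamma i with hx
  have hxc : x ∈ S.coreLattice := sum_mem fun i _ => Submodule.smul_mem _ _ (S.coreGamma_mem i)
  have hx0 : x ≠ 0 := fun h => hv (funext (Fintype.linearIndependent_iff.1 S.coreGamma_indep v h))
  have h1 := S.form_pos x (S.coreLattice_le hxc) hx0
  have h2 : ((∑ i, ∑ j, S.gram i j * v i * v j : ℤ) : ℂ) = S.k * S.form x x := by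
    rw [← S.form_shift_shift n (S.form_coreLattice_beta hxc) (S.form_coreLattice_beta hxc)]
    have : S.shift n x = ∑ i, (v i : ℂ) • S.basisM i := by
      simp only [hx, map_sum, basisM_eq]
      refine Finset.sum_congr rfl fun i _ => ?_
      rw [map_zsmul, Int.cast_smul_eq_zsmul]
    rw [this, k_form_sum_sum]
    push_cast
    rfl
  have h3 : ((∑ i, ∑ j, S.gram i j * v i * v j : ℤ) : ℝ) = S.k * (S.form x x).re := by
    have := congrArg Complex.re h2
    rw [Complex.re_ofReal_mul] at this
    simpa using this
  have h4 : (0 : ℝ) < ((∑ i, ∑ j, S.gram i j * v i * v j : ℤ) : ℝ) := by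
    rw [h3]
    exact mul_pos S.k_pos h1
  exact_mod_cast h4

theorem gramR_det_pos : 0 < S.gramR.det := S.gramR_posDef.det_pos

end Setting

namespace Setting

variable {V : Type*} [AddCommGroup V] [Module ℂ V] {m n : ℕ} (S : Setting V m n)

/-! ### The complex span of `M` and the orthogonal projection -/

/-- The complex span of `M`. -/
def cM : Submodule ℂ V := Submodule.span ℂ (S.M : Set V)

theorem mem_cM_iff {x : V} : x ∈ S.cM ↔ ∃ a : Fin (m - n) → ℂ, ∑ i, a i • S.basisM i = x := by
  rw [cM, M_eq_span, Submodule.span_span_of_tower, Submodule.mem_span_range_iff_exists_fun]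

theorem mem_cM_of_mem_M {x : V} (hx : x ∈ S.M) : x ∈ S.cM := Submodule.subset_span hx

theorem form_eq_of_forall_M {x y : V} (h : ∀ v ∈ S.M, S.form x v = S.form y v) {v : V}
    (hv : v ∈ S.cM) : S.form x v = S.form y v := by
  obtain ⟨a, rfl⟩ := S.mem_cM_iff.1 hv
  simp only [map_sum, map_smul, h _ (S.basisM_mem _)]

theorem form_eq_of_forall_basisM {x y : V} (h : ∀ i, S.form (S.basisM i) x = S.form (S.basisM i) y)
    {v : V} (hv : v ∈ S.cM) : S.form x v = S.form y v := by
  obtain ⟨a, rfl⟩ := S.mem_cM_iff.1 hv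
  simp only [map_sum, map_smul, S.form_comm _ (S.basisM _), h]

theorem form_cM_beta {x : V} (hx : x ∈ S.cM) (q : Fin n) : S.form x (S.beta q) = 0 := by
  rw [form_comm, S.form_eq_of_forall_M (y := 0) (fun v hv => ?_) hx]
  · simp
  · rw [form_comm, S.form_M_beta hv]
    simp

theorem form_cM_gam {x : V} (hx : x ∈ S.cM) (q : Fin n) : S.form x (S.gam q) = 0 := by
  rw [form_comm, S.form_eq_of_forall_M (y := 0) (fun v hv => ?_) hx]
  · simp
  · rw [form_comm, S.form_M_gam hv]
    simp

theorem gramR_map_det_ne_zero : (S.gramR.map ((↑) : ℝ → ℂ)).det ≠ 0 := by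
  have h : (S.gramR.map ((↑) : ℝ → ℂ)).det = ((S.gramR.det : ℝ) : ℂ) :=
    (Complex.ofRealHom.map_det S.gramR).symm
  rw [h]
  exact_mod_cast S.gramR_det_pos.ne'

theorem k_form_basisM (i : Fin (m - n)) (a : Fin (m - n) → ℂ) :
    S.k * S.form (S.basisM i) (∑ j, a j • S.basisM j) =
      (S.gramR.map ((↑) : ℝ → ℂ)).mulVec a i := by
  simp only [Matrix.mulVec, dotProduct, Matrix.map_apply, gramR_apply, map_sum, map_smul,
    smul_eq_mul, Finset.mul_sum]
  exact Finset.sum_congr rfl fun j _ => by ring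

theorem coeff_eq_zero {a : Fin (m - n) → ℂ}
    (h : ∀ i, S.form (S.basisM i) (∑ j, a j • S.basisM j) = 0) : a = 0 :=
  Matrix.eq_zero_of_mulVec_eq_zero S.gramR_map_det_ne_zero <| funext fun i => by
    rw [← k_form_basisM, h, mul_zero, Pi.zero_apply]

theorem ext_cM {x y : V} (hx : x ∈ S.cM) (hy : y ∈ S.cM)
    (h : ∀ i, S.form (S.basisM i) x = S.form (S.basisM i) y) : x = y := by
  obtain ⟨a, ha⟩ := S.mem_cM_iff.1 (sub_mem hx hy)
  have : a = 0 := S.coeff_eq_zero fun i => by rw [ha, map_sub, h, sub_self]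
  rw [← sub_eq_zero, ← ha, this]
  simp

/-- The element of `ℂM` with given products with the basis of `M`. -/
def dualVec (x : Fin (m - n) → ℂ) : V :=
  ∑ i, ((S.k : ℂ) * ((S.gramR.map ((↑) : ℝ → ℂ))⁻¹.mulVec x) i) • S.basisM i

theorem dualVec_mem (x : Fin (m - n) → ℂ) : S.dualVec x ∈ S.cM :=
  S.mem_cM_iff.2 ⟨_, rfl⟩

theorem form_basisM_dualVec (x : Fin (m - n) → ℂ) (i : Fin (m - n)) :
    S.form (S.basisM i) (S.dualVec x) = x i := by
  have h1 : S.dualVec x = (S.k : ℂ) •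
      ∑ i, ((S.gramR.map ((↑) : ℝ → ℂ))⁻¹.mulVec x) i • S.basisM i := by
    simp only [dualVec, Finset.smul_sum, smul_smul]
  rw [h1, map_smul, smul_eq_mul, k_form_basisM, Matrix.mulVec_mulVec, Matrix.mul_nonsing_inv _
    (isUnit_iff_ne_zero.2 S.gramR_map_det_ne_zero), Matrix.one_mulVec]

/-- The values of the inverse Gram matrix on `ℂM`. -/
theorem quad_gramR_inv {x : V} (hx : x ∈ S.cM) :
    quad S.gramR⁻¹ (fun i => S.form (S.basisM i) x) = S.form x x / S.k := by
  obtain ⟨a, rfl⟩ := S.mem_cM_iff.1 hx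
  rw [quad_inv_eq (isUnit_iff_ne_zero.2 S.gramR_det_pos.ne') _ (fun i => a i / S.k) fun i => ?_]
  · have h1 : S.form (∑ i, a i • S.basisM i) (∑ i, a i • S.basisM i) =
        ∑ i, a i * S.form (S.basisM i) (∑ i, a i • S.basisM i) := by
      rw [map_sum S.form, LinearMap.sum_apply]
      exact Finset.sum_congr rfl fun i _ => by rw [map_smul, LinearMap.smul_apply, smul_eq_mul]
    rw [h1, Finset.sum_div]
    exact Finset.sum_congr rfl fun i _ => by ring
  · have := S.k_form_basisM i a
    simp only [Matrix.mulVec, dotProduct, Matrix.map_apply] at this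
    have hk := S.k_ne_zero
    simp only [← mul_div_assoc]
    rw [← Finset.sum_div, ← this]
    field_simp

theorem exists_unique_projM (z : V) : ∃! w : V, S.IsProjM z w := by
  refine ⟨S.dualVec fun i => S.form (S.basisM i) z, ⟨S.dualVec_mem _, fun x hx => ?_⟩,
    fun w hw => ?_⟩
  · rw [map_sub, LinearMap.sub_apply, sub_eq_zero]
    exact S.form_eq_of_forall_basisM (fun i => (S.form_basisM_dualVec
      (fun i => S.form (S.basisM i) z) i).symm) (S.mem_cM_of_mem_M hx)
  · refine S.ext_cM hw.1 (S.dualVec_mem _) fun i => ?_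
    have := hw.2 _ (S.basisM_mem i)
    rw [map_sub, LinearMap.sub_apply, sub_eq_zero] at this
    rw [form_basisM_dualVec, form_comm, ← this, form_comm]

variable {S} in
theorem IsProjM.form_eq {z w v : V} (h : S.IsProjM z w) (hv : v ∈ S.cM) :
    S.form v z = S.form v w := by
  rw [form_comm, S.form_comm v]
  refine S.form_eq_of_forall_M (fun x hx => ?_) hv
  have := h.2 x hx
  rwa [map_sub, LinearMap.sub_apply, sub_eq_zero] at this

variable {S} in
theorem IsProjM.smul {z w : V} (h : S.IsProjM z w) (c : ℂ) : S.IsProjM (c • z) (c • w) :=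
  ⟨Submodule.smul_mem _ _ h.1, fun x hx => by rw [← smul_sub, map_smul, LinearMap.smul_apply,
    h.2 x hx, smul_zero]⟩

/-- The basis of `V` made of the basis of `M`, the `β_p` and the `γ_p`. -/
def fullFamily : Fin (m - n) ⊕ (Fin n ⊕ Fin n) → V :=
  Sum.elim S.basisM (Sum.elim S.beta S.gam)

theorem sum_fullFamily (a : Fin (m - n) ⊕ (Fin n ⊕ Fin n) → ℂ) :
    ∑ i, a i • S.fullFamily i = ∑ i, a (.inl i) • S.basisM i +
      (∑ p, a (.inr (.inl p)) • S.beta p + ∑ p, a (.inr (.inr p)) • S.gam p) := by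
  simp [Fintype.sum_sum_type, fullFamily]

/-- Pairing with β_q isolates the coefficient of γ_q, pairing with γ_q then isolates that of β_q,
and the Gram matrix of M settles the rest. -/
theorem fullFamily_indep : LinearIndependent ℂ S.fullFamily := by
  rw [Fintype.linearIndependent_iff]
  intro a ha
  rw [sum_fullFamily] at ha
  set w := ∑ i, a (.inl i) • S.basisM i with hw
  have hwM : w ∈ S.cM := S.mem_cM_iff.2 ⟨_, rfl⟩
  have hc : ∀ q, a (.inr (.inr q)) = 0 := by
    intro q
    have h := congrArg (fun v => S.form v (S.beta q)) ha
    simpa [S.form_cM_beta hwM, S.beta_isotropic, form_gam_beta] using h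
  have hb : ∀ q, a (.inr (.inl q)) = 0 := by
    intro q
    have h := congrArg (fun v => S.form v (S.gam q)) ha
    simpa [S.form_cM_gam hwM, S.form_comm (S.beta _), form_gam_beta, hc] using h
  have h0 : w = 0 := by simpa [hb, hc] using ha
  have h1 : (fun i => a (.inl i)) = 0 := S.coeff_eq_zero fun i => by
    rw [← hw, h0, map_zero]
  rintro (i | p | p)
  · exact congrFun h1 i
  · exact hb p
  · exact hc p

/-- `V` is spanned by `ℂM`, the `β_p` and the `γ_p`. -/
theorem exists_decomposition (z : V) : ∃ w ∈ S.cM, ∃ b c : Fin n → ℂ,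
    z = w + (∑ p, b p • S.beta p + ∑ p, c p • S.gam p) := by
  -- (m - n) + 2n = m + n: here the dimension hypothesis makes the family a basis.
  have hcard : Fintype.card (Fin (m - n) ⊕ (Fin n ⊕ Fin n)) = Module.finrank ℂ V := by
    have := S.n_le
    simp only [Fintype.card_sum, Fintype.card_fin, S.dim_eq]
    omega
  have : FiniteDimensional ℂ V := Module.finite_of_finrank_pos (by
    have := S.rank_pos
    rw [S.dim_eq]
    omega)
  have : z ∈ Submodule.span ℂ (Set.range S.fullFamily) := by
    rw [S.fullFamily_indep.span_eq_top_of_card_eq_finrank' hcard]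
    trivial
  obtain ⟨a, ha⟩ := (Submodule.mem_span_range_iff_exists_fun ℂ).1 this
  rw [sum_fullFamily] at ha
  exact ⟨_, S.mem_cM_iff.2 ⟨_, rfl⟩, _, _, ha.symm⟩

/-- A vector orthogonal to all `β_p` is moved into `ℂM` by `shift n`. -/
theorem shift_mem_cM {x : V} (hx : ∀ q, S.form x (S.beta q) = 0) : S.shift n x ∈ S.cM := by
  obtain ⟨w, hw, b, c, h⟩ := S.exists_decomposition (S.shift n x)
  have hc : ∀ q, c q = 0 := by
    intro q
    have h1 := congrArg (fun v => S.form v (S.beta q)) h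
    simpa [S.form_shift_beta, hx, S.form_cM_beta hw, S.beta_isotropic, form_gam_beta] using h1
  have hb : ∀ q, b q = 0 := by
    intro q
    have h1 := congrArg (fun v => S.form v (S.gam q)) h
    simpa [S.form_shift_gam, S.form_cM_gam hw, S.form_comm (S.beta _), form_gam_beta, hc] using h1
  rw [h]
  simpa [hb, hc] using hw

variable {S} in
/-- The square of the orthogonal complement of the projection. -/
theorem IsProjM.form_self {z w : V} (h : S.IsProjM z w) : S.form z z = S.form w w -
    ∑ p, (2 * S.form (S.beta p) z * S.form (S.gam p) z +
      S.form (S.beta p) z * ∑ q, S.form (S.gam p) (S.gam q) * S.form (S.beta q) z) := by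
  obtain ⟨w', hw', b, c, hz⟩ := S.exists_decomposition z
  have hww : w = w' := by
    refine (S.exists_unique_projM z).unique h ⟨hw', fun x hx => ?_⟩
    rw [hz, add_sub_cancel_left]
    simp [S.form_comm _ x, S.form_M_beta hx, S.form_M_gam hx]
  subst hww
  have hc : ∀ q, S.form (S.beta q) z = - c q := by
    intro q
    rw [hz, form_comm]
    simp [S.form_cM_beta hw', S.beta_isotropic, form_gam_beta]
  have hg : ∀ q, S.form (S.gam q) z = - b q + ∑ p, S.form (S.gam q) (S.gam p) * c p := by
    intro q
    rw [hz]
    simp [S.form_comm _ w, S.form_cM_gam hw', form_gam_beta, mul_comm]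
  have h1 : S.form z z = S.form w w + (∑ p, b p * S.form (S.beta p) z +
      ∑ p, c p * S.form (S.gam p) z) := by
    rw [congrArg (S.form z) hz, map_add, S.form_comm z w, h.form_eq hw']
    simp [S.form_comm z]
  have h2 : ∀ p, ∑ q, S.form (S.gam p) (S.gam q) * S.form (S.beta q) z =
      - ∑ q, S.form (S.gam p) (S.gam q) * c q := by
    intro p
    simp [hc]
  rw [h1, ← Finset.sum_add_distrib, sub_eq_add_neg, ← Finset.sum_neg_distrib]
  congr 1
  refine Finset.sum_congr rfl fun p _ => ?_
  rw [h2, hg, hc]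
  ring

end Setting

namespace Setting

variable {V : Type*} [AddCommGroup V] [Module ℂ V] {m n : ℕ} (S : Setting V m n)

/-! ### The dual lattice -/

theorem mem_Mdual {x : V} : x ∈ S.Mdual ↔ x ∈ S.cM ∧ ∀ y ∈ S.M, ∃ a : ℤ, S.form x y = a := Iff.rfl

theorem mem_kM {x : V} : x ∈ S.kM ↔ ∃ y ∈ S.M, (S.k : ℂ) • y = x := Iff.rfl

/-- The element of the dual lattice with given products with the basis of `M`. -/
def dualHom : (Fin (m - n) → ℤ) →+ V where
  toFun c := S.dualVec fun i => c i
  map_zero' := S.ext_cM (S.dualVec_mem _) (zero_mem _) fun i => by simp [form_basisM_dualVec]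
  map_add' c d := S.ext_cM (S.dualVec_mem _) (add_mem (S.dualVec_mem _) (S.dualVec_mem _))
    fun i => by simp [form_basisM_dualVec]

theorem form_basisM_dualHom (c : Fin (m - n) → ℤ) (i : Fin (m - n)) :
    S.form (S.basisM i) (S.dualHom c) = c i := S.form_basisM_dualVec _ i

theorem dualHom_mem_cM (c : Fin (m - n) → ℤ) : S.dualHom c ∈ S.cM := S.dualVec_mem _

theorem dualHom_injective : Function.Injective S.dualHom := fun c d h => funext fun i => by
  have : (c i : ℂ) = d i := by rw [← S.form_basisM_dualHom c, h, form_basisM_dualHom]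
  exact_mod_cast this

theorem Mdual_eq : S.Mdual = (⊤ : AddSubgroup (Fin (m - n) → ℤ)).map S.dualHom := by
  ext x
  simp only [AddSubgroup.mem_map, AddSubgroup.mem_top, true_and, mem_Mdual]
  constructor
  · rintro ⟨hx, h⟩
    choose c hc using fun i => h _ (S.basisM_mem i)
    exact ⟨c, S.ext_cM (S.dualHom_mem_cM c) hx fun i => by
      rw [form_basisM_dualHom, ← hc, form_comm]⟩
  · rintro ⟨c, rfl⟩
    refine ⟨S.dualHom_mem_cM c, fun y hy => ?_⟩
    obtain ⟨a, rfl⟩ := S.mem_M_iff.1 hy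
    refine ⟨∑ i, a i * c i, ?_⟩
    simp [S.form_comm _ (S.basisM _), form_basisM_dualHom]

theorem dualHom_gram (v : Fin (m - n) → ℤ) :
    S.dualHom (Matrix.toLin' (Matrix.of S.gram) v) = (S.k : ℂ) • ∑ i, v i • S.basisM i := by
  refine S.ext_cM (S.dualHom_mem_cM _) (Submodule.smul_mem _ _ (S.mem_cM_of_mem_M
    (S.mem_M_iff.2 ⟨v, rfl⟩))) fun i => ?_
  rw [form_basisM_dualHom]
  simp [Matrix.mulVec, dotProduct, gram_eq, Finset.mul_sum]
  exact Finset.sum_congr rfl fun j _ => by ring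

theorem kM_eq : S.kM =
    (LinearMap.range (Matrix.toLin' (Matrix.of S.gram))).toAddSubgroup.map S.dualHom := by
  ext x
  simp only [mem_kM, AddSubgroup.mem_map, Submodule.mem_toAddSubgroup, LinearMap.mem_range]
  constructor
  · rintro ⟨y, hy, rfl⟩
    obtain ⟨v, rfl⟩ := S.mem_M_iff.1 hy
    exact ⟨_, ⟨v, rfl⟩, S.dualHom_gram v⟩
  · rintro ⟨_, ⟨v, rfl⟩, rfl⟩
    exact ⟨_, S.mem_M_iff.2 ⟨v, rfl⟩, (S.dualHom_gram v).symm⟩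

theorem gram_det : (((Matrix.of S.gram).det : ℤ) : ℝ) = S.gramR.det :=
  (Int.castRingHom ℝ).map_det (Matrix.of S.gram)

/-- In the coordinates of `dualHom` the dual lattice is ℤ^{m-n} and kM is the image of the Gram
matrix. -/
theorem index_eq : (S.index : ℝ) = S.gramR.det := by
  have h0 : 0 < (Matrix.of S.gram).det := by
    have := S.gramR_det_pos
    rw [← gram_det] at this
    exact_mod_cast this
  rw [index, kM_eq, Mdual_eq, AddSubgroup.relIndex_map_map_of_injective _ _ S.dualHom_injective,
    AddSubgroup.relIndex_top_right, index_range_toLin' _ h0.ne', ← gram_det, Nat.cast_natAbs,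
    abs_of_pos h0]

theorem index_ne_zero : S.index ≠ 0 := by
  have := S.gramR_det_pos
  rw [← index_eq] at this
  exact_mod_cast this.ne'

theorem tsum_Mdual (f : V → ℂ) : ∑' x : S.Mdual, f x = ∑' c, f (S.dualHom c) := by
  have hmem : ∀ c, S.dualHom c ∈ S.Mdual := fun c => by
    rw [Mdual_eq]
    exact ⟨c, trivial, rfl⟩
  have hbij : Function.Bijective fun c => (⟨S.dualHom c, hmem c⟩ : S.Mdual) := by
    refine ⟨fun c d h => S.dualHom_injective (congrArg Subtype.val h), ?_⟩
    rintro ⟨x, hx⟩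
    rw [Mdual_eq] at hx
    obtain ⟨c, -, rfl⟩ := hx
    exact ⟨c, rfl⟩
  exact ((Equiv.ofBijective _ hbij).tsum_eq fun x : S.Mdual => f x).symm

theorem summable_Mdual {f : V → ℂ} (h : Summable fun c => f (S.dualHom c)) :
    Summable fun x : S.Mdual => f x := by
  have hmem : ∀ x : S.Mdual, ∃ c, S.dualHom c = x := fun x => by
    obtain ⟨c, -, hc⟩ := S.Mdual_eq.le x.2
    exact ⟨c, hc⟩
  choose g hg using hmem
  have hg' : Function.Injective g := fun x y hxy => Subtype.ext (by rw [← hg x, hxy, hg])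
  refine (h.comp_injective hg').congr fun x => ?_
  rw [Function.comp_apply, hg]

/-! ### Representatives of `P_{k,T}` -/

theorem shift_mem_Mdual {mu : AffineDual V} (hmu : mu ∈ S.PT) : S.shift n mu.bar ∈ S.Mdual := by
  refine S.mem_Mdual.2 ⟨S.shift_mem_cM hmu.2, fun y hy => ?_⟩
  obtain ⟨x, hx, rfl⟩ := S.exists_of_mem_M hy
  rw [S.form_shift_shift n hmu.2 (S.form_coreLattice_beta hx)]
  exact hmu.1.2 x (S.coreLattice_le hx)

theorem shift_of_mem_cM {x : V} (hx : x ∈ S.cM) : S.shift n x = x := by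
  simp [shift_top, S.form_cM_gam hx]

theorem mem_PT_of_mem_Mdual {x : V} (hx : x ∈ S.Mdual) : ((x, S.k, 0) : AffineDual V) ∈ S.PT := by
  obtain ⟨hx, h⟩ := S.mem_Mdual.1 hx
  refine ⟨⟨rfl, fun y hy => ?_⟩, S.form_cM_beta hx⟩
  change ∃ a : ℤ, S.form x y = a
  induction hy using Submodule.span_induction with
  | mem y hy =>
    obtain ⟨i, rfl⟩ := hy
    by_cases hi : (i : ℕ) < n
    · exact ⟨0, by simpa [gam] using S.form_cM_gam hx ⟨i, hi⟩⟩
    · obtain ⟨a, ha⟩ := h _ (Submodule.subset_span ⟨i, not_lt.1 hi, rfl⟩)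
      refine ⟨a, ?_⟩
      rw [← ha, stageVec]
      simp [S.form_cM_beta hx]
  | zero => exact ⟨0, by simp⟩
  | add y y' _ _ hy hy' =>
    obtain ⟨a, ha⟩ := hy
    obtain ⟨b, hb⟩ := hy'
    exact ⟨a + b, by simp [ha, hb]⟩
  | smul c y _ hy =>
    obtain ⟨a, ha⟩ := hy
    exact ⟨c * a, by simp [ha]⟩

/-- For weights orthogonal to T the shift lands in ℂM and alters the weight only by elements of M^⊥.
The class of a weight can therefore be read off in M*/kM. -/
theorem congruent_iff {mu nu : AffineDual V} (hmu : mu ∈ S.PT) (hnu : nu ∈ S.PT) :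
    S.Congruent mu nu ↔ S.shift n mu.bar - S.shift n nu.bar ∈ S.kM := by
  have key : ∀ v ∈ S.M, S.form (S.shift n mu.bar - S.shift n nu.bar) v =
      S.form (mu.bar - nu.bar) v := by
    intro v hv
    rw [← map_sub, S.form_shift_left n _ (S.form_M_beta hv)]
  constructor
  · rintro ⟨x, hx, y, hy, a, h⟩
    have hbar : mu.bar - nu.bar = x + y := congrArg Prod.fst h
    suffices S.shift n mu.bar - S.shift n nu.bar = x by rwa [this]
    refine S.ext_cM (sub_mem (S.shift_mem_cM hmu.2) (S.shift_mem_cM hnu.2)) ?_ fun i => ?_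
    · obtain ⟨u, hu, rfl⟩ := S.mem_kM.1 hx
      exact Submodule.smul_mem _ _ (S.mem_cM_of_mem_M hu)
    · rw [form_comm, key _ (S.basisM_mem i), hbar, map_add, LinearMap.add_apply,
        hy _ (S.basisM_mem i), add_zero, form_comm]
  · intro h
    refine ⟨_, h, mu.bar - nu.bar - (S.shift n mu.bar - S.shift n nu.bar), fun v hv => ?_,
      (mu - nu).2.2, ?_⟩
    · rw [map_sub S.form, LinearMap.sub_apply, key v hv, sub_self]
    · refine Prod.ext (add_sub_cancel _ (mu.bar - nu.bar)).symm (Prod.ext ?_ rfl)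
      · have h1 := hmu.1.1
        have h2 := hnu.1.1
        change mu.level - nu.level = 0
        rw [h1, h2, sub_self]

/-- The classes correspond to M*/kM, which is finite because its index is a nonzero determinant;
elements of M* themselves serve as representatives. -/
theorem exists_isRepresentatives : ∃ A : Finset (AffineDual V), S.IsRepresentatives A := by
  classical
  have : (S.kM.addSubgroupOf S.Mdual).FiniteIndex := ⟨S.index_ne_zero⟩
  have : Finite (S.Mdual ⧸ S.kM.addSubgroupOf S.Mdual) :=
    AddSubgroup.finite_quotient_of_finiteIndex
  have := Fintype.ofFinite (S.Mdual ⧸ S.kM.addSubgroupOf S.Mdual)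
  let f : S.Mdual ⧸ S.kM.addSubgroupOf S.Mdual → AffineDual V :=
    fun q => (((Quotient.out q : S.Mdual) : V), S.k, 0)
  have hf : ∀ q, f q ∈ S.PT := fun q => S.mem_PT_of_mem_Mdual (Quotient.out q).2
  have hiff : ∀ nu (hnu : nu ∈ S.PT) q, S.Congruent nu (f q) ↔
      q = QuotientAddGroup.mk ⟨_, S.shift_mem_Mdual hnu⟩ := by
    intro nu hnu q
    rw [S.congruent_iff hnu (hf q), S.shift_of_mem_cM (S.mem_Mdual.1 (Quotient.out q).2).1]
    conv_rhs => rw [← QuotientAddGroup.out_eq' q]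
    rw [QuotientAddGroup.eq, AddSubgroup.mem_addSubgroupOf]
    simp only [neg_add_eq_sub]
    rfl
  refine ⟨Finset.univ.image f, ?_, fun nu hnu => ?_⟩
  · intro mu hmu
    obtain ⟨q, -, rfl⟩ := Finset.mem_image.1 hmu
    exact hf q
  · refine ⟨f (QuotientAddGroup.mk ⟨_, S.shift_mem_Mdual hnu⟩),
      ⟨Finset.mem_image_of_mem _ (Finset.mem_univ _), (hiff nu hnu _).2 rfl⟩, ?_⟩
    rintro mu ⟨hmu, hc⟩
    obtain ⟨q, -, rfl⟩ := Finset.mem_image.1 hmu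
    rw [(hiff nu hnu q).1 hc]

/-- The elements `μ_n + k x` of the dual lattice. -/
theorem shift_add_mem_Mdual {mu : AffineDual V} (hmu : mu ∈ S.PT) {x : V} (hx : x ∈ S.M) :
    S.shift n mu.bar + (S.k : ℂ) • x ∈ S.Mdual := by
  refine add_mem (S.shift_mem_Mdual hmu) (S.mem_Mdual.2 ⟨Submodule.smul_mem _ _
    (S.mem_cM_of_mem_M hx), fun y hy => ?_⟩)
  obtain ⟨a, ha⟩ := S.exists_k_form_M hx hy
  exact ⟨a, by rw [map_smul, LinearMap.smul_apply, smul_eq_mul, ha]⟩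

theorem IsRepresentatives.eq_of_shift_add_eq {S : Setting V m n} {A : Finset (AffineDual V)}
    (hA : S.IsRepresentatives A)
    {mu nu : AffineDual V} (hmu : mu ∈ A) (hnu : nu ∈ A) {x y : V} (hx : x ∈ S.M) (hy : y ∈ S.M)
    (h : S.shift n mu.bar + (S.k : ℂ) • x = S.shift n nu.bar + (S.k : ℂ) • y) :
    mu = nu ∧ x = y := by
  have h2 : S.Congruent mu nu := by
    rw [S.congruent_iff (hA.1 _ hmu) (hA.1 _ hnu)]
    refine S.mem_kM.2 ⟨y - x, sub_mem hy hx, ?_⟩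
    rw [smul_sub, sub_eq_sub_iff_add_eq_add, add_comm _ (S.shift n nu.bar), ← h]
  have h3 : S.Congruent mu mu := by
    rw [S.congruent_iff (hA.1 _ hmu) (hA.1 _ hmu), sub_self]
    exact zero_mem _
  have h4 : mu = nu := (hA.2 mu (hA.1 _ hmu)).unique ⟨hmu, h3⟩ ⟨hnu, h2⟩
  subst h4
  exact ⟨rfl, smul_right_injective V S.k_ne_zero (add_left_cancel h)⟩

theorem IsRepresentatives.exists_shift_add_eq {S : Setting V m n} {A : Finset (AffineDual V)}
    (hA : S.IsRepresentatives A) {x : V} (hx : x ∈ S.Mdual) :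
    ∃ mu ∈ A, ∃ y ∈ S.M, S.shift n mu.bar + (S.k : ℂ) • y = x := by
  have hx' := S.mem_PT_of_mem_Mdual hx
  obtain ⟨mu, ⟨hmu, hc⟩, -⟩ := hA.2 _ hx'
  rw [S.congruent_iff hx' (hA.1 _ hmu)] at hc
  obtain ⟨y, hy, h⟩ := S.mem_kM.1 hc
  have h' : (S.k : ℂ) • y = S.shift n x - S.shift n mu.bar := h
  refine ⟨mu, hmu, y, hy, ?_⟩
  rw [h', S.shift_of_mem_cM (S.mem_Mdual.1 hx).1, add_sub_cancel]

/-- A system of representatives parametrizes the dual lattice. -/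
def IsRepresentatives.toMdual {S : Setting V m n} {A : Finset (AffineDual V)}
    (hA : S.IsRepresentatives A) (p : A × S.M) : S.Mdual :=
  ⟨_, S.shift_add_mem_Mdual (hA.1 _ p.1.2) p.2.2⟩

theorem IsRepresentatives.bijective_toMdual {S : Setting V m n} {A : Finset (AffineDual V)}
    (hA : S.IsRepresentatives A) : Function.Bijective hA.toMdual := by
  constructor
  · intro p q h
    obtain ⟨h1, h2⟩ := hA.eq_of_shift_add_eq p.1.2 q.1.2 p.2.2 q.2.2 (congrArg Subtype.val h)
    exact Prod.ext (Subtype.ext h1) (Subtype.ext h2)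
  · intro x
    obtain ⟨mu, hmu, y, hy, h⟩ := hA.exists_shift_add_eq x.2
    exact ⟨(⟨mu, hmu⟩, ⟨y, hy⟩), Subtype.ext h⟩

/-- A sum over the dual lattice is a sum over the classes modulo `kM`. -/
theorem IsRepresentatives.tsum_Mdual {S : Setting V m n} {A : Finset (AffineDual V)}
    (hA : S.IsRepresentatives A) {f : V → ℂ} (hf : Summable fun x : S.Mdual => f x) :
    ∑' x : S.Mdual, f x = ∑ mu ∈ A, ∑' x : S.M, f (S.shift n mu.bar + (S.k : ℂ) • (x : V)) := by
  have hs : Summable fun p : A × S.M => f (hA.toMdual p) :=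
    hf.comp_injective hA.bijective_toMdual.injective
  have h1 : ∑' p : A × S.M, f (hA.toMdual p) = ∑' x : S.Mdual, f x :=
    (Equiv.ofBijective hA.toMdual hA.bijective_toMdual).tsum_eq fun x : S.Mdual => f x
  rw [← h1, hs.tsum_prod, tsum_fintype]
  exact Finset.sum_coe_sort A fun mu => ∑' x : S.M, f (S.shift n mu.bar + (S.k : ℂ) • (x : V))

end Setting

theorem one_div_cpow_neg_one_div {τ : ℂ} (hτ : 0 < τ.im) (a : ℂ) :
    1 / (-I * (-1 / τ)) ^ a = (-I * τ) ^ a := by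
  have h1 : -I * (-1 / τ) = (-I * τ)⁻¹ := by
    rw [mul_inv, inv_neg, inv_I]
    ring
  -- Inversion commutes with principal powers since -iτ has positive real part.
  rw [h1, inv_cpow, one_div, inv_inv]
  intro h
  have h2 := (arg_eq_pi_iff.1 h).1
  simp at h2
  linarith

theorem sign_cpow_of_eq_int (σ : ℤˣ) {x : ℂ} (h : ∃ a : ℤ, x = a) :
    ((σ : ℤ) : ℂ) ^ x * ((σ : ℤ) : ℂ) ^ x = 1 := by
  obtain ⟨a, rfl⟩ := h
  rw [cpow_intCast, ← mul_zpow, sign_mul_self, one_zpow]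

namespace Setting

variable {V : Type*} [AddCommGroup V] [Module ℂ V] {m n : ℕ} (S : Setting V m n)

/-! ### Theta functions of the lattice `M` -/

/-- The theta series of the lattice `M`. -/
def thetaM (σ : ℤˣ) (ν : V) (τ : ℂ) (w : V) : ℂ :=
  ∑' x : S.M, ((σ : ℤ) : ℂ) ^ ((S.k : ℂ) * S.form x x) *
    exp (Real.pi * I * τ / S.k * S.form (ν + (S.k : ℂ) • (x : V)) (ν + (S.k : ℂ) • (x : V)) +
      2 * Real.pi * I * S.form (ν + (S.k : ℂ) • (x : V)) w)

theorem signedTheta_eq (σ : ℤˣ) {lam : AffineDual V} (h : lam.level = S.k) (τ : ℂ) (w : V)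
    (t : ℂ) : S.signedTheta σ lam τ w t =
      exp (2 * Real.pi * I * S.k * t) * S.thetaM σ lam.bar τ w := by
  rw [signedTheta, mockTheta, h, thetaM]
  congr 1
  refine tsum_congr fun x => ?_
  rw [Finset.prod_empty, div_one, mul_assoc, ← Complex.exp_add]
  congr 3
  ring

theorem form_add_smul_self (ν x : V) : S.form (ν + (S.k : ℂ) • x) (ν + (S.k : ℂ) • x) =
    S.form ν ν + 2 * S.k * S.form ν x + S.k ^ 2 * S.form x x := by
  simp only [map_add, LinearMap.add_apply, map_smul, LinearMap.smul_apply, smul_eq_mul,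
    S.form_comm x ν]
  ring

/-- The series sees ν only through |ν|² and its products with ℂM. This is needed in (a), where λ_n +
ξ₀ need not lie in ℂM. -/
theorem thetaM_congr (σ : ℤˣ) {ν ν' : V} (h : S.form ν ν = S.form ν' ν')
    (h' : ∀ v ∈ S.cM, S.form ν v = S.form ν' v) (τ : ℂ) {w : V} (hw : w ∈ S.cM) :
    S.thetaM σ ν τ w = S.thetaM σ ν' τ w := by
  refine tsum_congr fun x => ?_
  rw [form_add_smul_self, form_add_smul_self, h, h' _ (S.mem_cM_of_mem_M x.2), map_add,
    LinearMap.add_apply, h' w hw, map_add, LinearMap.add_apply]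

theorem basis_sum_mem (a : Fin (m - n) → ℤ) : ∑ i, a i • S.basisM i ∈ S.M :=
  S.mem_M_iff.2 ⟨a, rfl⟩

theorem tsum_M_basis (f : V → ℂ) :
    ∑' x : S.M, f x = ∑' a : Fin (m - n) → ℤ, f (∑ i, a i • S.basisM i) := by
  have hbij : Function.Bijective fun a => (⟨_, S.basis_sum_mem a⟩ : S.M) := by
    constructor
    · intro a b h
      have h1 : ∑ i, a i • S.basisM i = ∑ i, b i • S.basisM i := congrArg Subtype.val h
      have h2 : ∑ j, ((a j - b j : ℤ) : ℂ) • S.basisM j = 0 := by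
        simp only [Int.cast_smul_eq_zsmul, sub_smul, Finset.sum_sub_distrib, h1, sub_self]
      have h3 := S.coeff_eq_zero (a := fun j => ((a j - b j : ℤ) : ℂ)) fun i => by
        rw [h2, map_zero]
      funext i
      have h4 : ((a i - b i : ℤ) : ℂ) = 0 := congrFun h3 i
      exact sub_eq_zero.1 (by exact_mod_cast h4)
    · rintro ⟨x, hx⟩
      obtain ⟨a, ha⟩ := S.mem_M_iff.1 hx
      exact ⟨a, Subtype.ext ha⟩
  exact ((Equiv.ofBijective (fun a => (⟨_, S.basis_sum_mem a⟩ : S.M)) hbij).tsum_eq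
    fun x : S.M => f x).symm

theorem quad_gramR (a : Fin (m - n) → ℤ) : quad S.gramR (fun i => (a i : ℂ)) =
    S.k * S.form (∑ i, a i • S.basisM i) (∑ i, a i • S.basisM i) := by
  have h := S.k_form_sum_sum (fun i => (a i : ℂ)) fun i => (a i : ℂ)
  simp only [Int.cast_smul_eq_zsmul] at h
  rw [h]
  simp [quad, gramR]

/-- Poisson summation for the lattice `M`. -/
theorem tsum_M_poisson {τ : ℂ} (hτ : 0 < τ.im) {y : V} (hy : y ∈ S.cM) :
    ∑' x : S.M, exp (Real.pi * I * (-1 / τ) * (S.k * S.form x x) +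
        2 * Real.pi * I * S.form x y) =
      ((-I * τ) ^ (1 / 2 : ℂ)) ^ (m - n) * ((Real.sqrt (S.index : ℝ))⁻¹ : ℝ) *
        ∑' x : S.Mdual, exp (Real.pi * I * τ * (S.form (y + x) (y + x) / S.k)) := by
  rw [S.tsum_M_basis fun x => exp (Real.pi * I * (-1 / τ) * (S.k * S.form x x) +
        2 * Real.pi * I * S.form x y),
    S.tsum_Mdual fun x => exp (Real.pi * I * τ * (S.form (y + x) (y + x) / S.k)),
    index_eq, ← one_div_cpow_neg_one_div hτ]
  have h := tsum_quad_S S.gramR_posDef (im_neg_one_div_pos hτ) fun i => S.form (S.basisM i) y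
  refine Eq.trans (tsum_congr fun a => ?_) (h.trans ?_)
  · rw [quad_gramR]
    simp
  · congr 1
    refine tsum_congr fun c => ?_
    rw [← S.quad_gramR_inv (add_mem hy (S.dualHom_mem_cM c))]
    simp only [map_add, form_basisM_dualHom]
    congr 2
    have := ne_zero_of_im_pos hτ
    field_simp

theorem summable_Mdual_exp {τ : ℂ} (hτ : 0 < τ.im) {y : V} (hy : y ∈ S.cM) :
    Summable fun x : S.Mdual => exp (Real.pi * I * τ * (S.form (y + x) (y + x) / S.k)) := by
  refine S.summable_Mdual (f := fun x => exp (Real.pi * I * τ * (S.form (y + x) (y + x) / S.k))) ?_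
  refine (summable_quad_inv S.gramR_posDef (im_neg_one_div_pos hτ)
    fun i => S.form (S.basisM i) y).congr fun c => ?_
  rw [← S.quad_gramR_inv (add_mem hy (S.dualHom_mem_cM c))]
  simp only [map_add, form_basisM_dualHom]
  congr 2
  have := ne_zero_of_im_pos hτ
  field_simp

/-- The `S`-transformation of the theta functions of the lattice `M`. -/
theorem thetaM_S {A : Finset (AffineDual V)} (hA : S.IsRepresentatives A) {σ σ' : ℤˣ} {ν ρ : V}
    (hν : ν ∈ S.cM)
    (hν' : ∀ x ∈ S.M, exp (2 * Real.pi * I * S.form ν x) = ((σ' : ℤ) : ℂ) ^ (S.k * S.form x x))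
    (hρ : ρ ∈ S.cM)
    (hρ' : ∀ x ∈ S.M, exp (2 * Real.pi * I * S.form ρ x) = ((σ : ℤ) : ℂ) ^ (S.k * S.form x x))
    {τ : ℂ} (hτ : 0 < τ.im) {w : V} (hw : w ∈ S.cM) :
    exp (-(Real.pi * I * S.k * S.form w w / τ)) * S.thetaM σ ν (-1 / τ) (τ⁻¹ • w) =
      ((-I * τ) ^ (1 / 2 : ℂ)) ^ (m - n) * ((Real.sqrt (S.index : ℝ))⁻¹ : ℝ) *
        ∑ mu ∈ A, exp (-(2 * Real.pi * I / S.k) * S.form ν (S.shift n mu.bar + ρ)) *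
          S.thetaM σ' (S.shift n mu.bar + ρ) τ w := by
  have hk := S.k_ne_zero
  have hτ0 := ne_zero_of_im_pos hτ
  -- Completing the square moves ν and w into the linear term u/τ of the Poisson formula; adding ρ
  -- there expresses the sign σ as a character.
  set u : V := (S.k : ℂ) • w - ν with hu
  set y : V := τ⁻¹ • u + ρ with hy
  have hyM : y ∈ S.cM :=
    add_mem (Submodule.smul_mem _ _ (sub_mem (Submodule.smul_mem _ _ hw) hν)) hρ
  have huu : S.form u u = S.k ^ 2 * S.form w w - 2 * S.k * S.form ν w + S.form ν ν := by
    simp only [hu, map_sub, LinearMap.sub_apply, map_smul, LinearMap.smul_apply, smul_eq_mul,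
      S.form_comm w ν]
    ring
  have hux : ∀ x, S.form u x = S.k * S.form x w - S.form ν x := fun x => by
    simp only [hu, map_sub, LinearMap.sub_apply, map_smul, LinearMap.smul_apply, smul_eq_mul,
      S.form_comm w x]
  have h1 : exp (-(Real.pi * I * S.k * S.form w w / τ)) * S.thetaM σ ν (-1 / τ) (τ⁻¹ • w) =
      exp (-(Real.pi * I / (S.k * τ)) * S.form u u) *
        ∑' x : S.M, exp (Real.pi * I * (-1 / τ) * (S.k * S.form x x) +
          2 * Real.pi * I * S.form x y) := by
    rw [thetaM, ← tsum_mul_left, ← tsum_mul_left]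
    refine tsum_congr fun x => ?_
    rw [← hρ' x x.2, ← Complex.exp_add, ← Complex.exp_add, ← Complex.exp_add, huu,
      form_add_smul_self, S.form_comm x y]
    congr 1
    simp only [hy, map_add, LinearMap.add_apply, map_smul, LinearMap.smul_apply, smul_eq_mul, hux]
    field_simp
    ring
  rw [h1, S.tsum_M_poisson hτ hyM, hA.tsum_Mdual
    (f := fun x => exp (Real.pi * I * τ * (S.form (y + x) (y + x) / S.k)))
    (S.summable_Mdual_exp hτ hyM), mul_left_comm, Finset.mul_sum]
  congr 1
  refine Finset.sum_congr rfl fun mu _ => ?_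
  rw [thetaM, ← tsum_mul_left, ← tsum_mul_left]
  refine tsum_congr fun x => ?_
  set N : V := S.shift n mu.bar + ρ with hN
  -- A sign is its own inverse, so the character of ν may be used with the opposite exponent that
  -- the dual sum produces.
  have h2 : ((σ' : ℤ) : ℂ) ^ (S.k * S.form (x : V) x) = exp (-(2 * Real.pi * I * S.form ν x)) := by
    rw [Complex.exp_neg, hν' x x.2, eq_comm]
    exact inv_eq_of_mul_eq_one_left (sign_cpow_of_eq_int σ' (S.exists_k_form_M x.2 x.2))
  have h3 : y + (S.shift n mu.bar + (S.k : ℂ) • (x : V)) =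
      τ⁻¹ • u + (N + (S.k : ℂ) • (x : V)) := by
    rw [hy, hN]
    abel
  have h4 : S.form (τ⁻¹ • u + (N + (S.k : ℂ) • (x : V))) (τ⁻¹ • u + (N + (S.k : ℂ) • (x : V))) =
      τ⁻¹ ^ 2 * S.form u u + 2 * τ⁻¹ * S.form u (N + (S.k : ℂ) • (x : V)) +
        S.form (N + (S.k : ℂ) • (x : V)) (N + (S.k : ℂ) • (x : V)) := by
    generalize N + (S.k : ℂ) • (x : V) = v
    simp only [map_add, LinearMap.add_apply, map_smul, LinearMap.smul_apply, smul_eq_mul,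
      S.form_comm v u]
    ring
  have h5 : S.form ν (N + (S.k : ℂ) • (x : V)) = S.form ν N + S.k * S.form ν x := by
    rw [map_add, map_smul, smul_eq_mul]
  rw [h2, ← Complex.exp_add, ← Complex.exp_add, ← Complex.exp_add, h3, h4, hux (N + _), h5]
  congr 1
  field_simp
  ring

/-- The `T`-transformation of the theta functions of the lattice `M`. -/
theorem thetaM_add_one {σ σ' : ℤˣ} {ν : V}
    (hν' : ∀ x ∈ S.M, exp (2 * Real.pi * I * S.form ν x) = ((σ' : ℤ) : ℂ) ^ (S.k * S.form x x))
    (τ : ℂ) (w : V) :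
    S.thetaM σ ν (τ + 1) w =
      exp (Real.pi * I / S.k * S.form ν ν) * S.thetaM (σ * -σ') ν τ w := by
  have hk := S.k_ne_zero
  rw [thetaM, thetaM, ← tsum_mul_left]
  refine tsum_congr fun x => ?_
  obtain ⟨a, ha⟩ := S.exists_k_form_M x.2 x.2
  have h1 : ((((σ * -σ' : ℤˣ)) : ℤ) : ℂ) ^ (S.k * S.form (x : V) x) =
      ((σ : ℤ) : ℂ) ^ (S.k * S.form (x : V) x) * (exp (Real.pi * I * (S.k * S.form (x : V) x)) *
        exp (2 * Real.pi * I * S.form ν x)) := by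
    rw [hν' x x.2, ha, cpow_intCast, cpow_intCast, cpow_intCast,
      show Real.pi * I * (a : ℂ) = a * (Real.pi * I) by ring, exp_int_mul, exp_pi_mul_I,
      ← mul_zpow, ← mul_zpow]
    push_cast
    rw [neg_one_mul]
  have h2 : exp (Real.pi * I * (τ + 1) / S.k *
        S.form (ν + (S.k : ℂ) • (x : V)) (ν + (S.k : ℂ) • (x : V)) +
        2 * Real.pi * I * S.form (ν + (S.k : ℂ) • (x : V)) w) =
      exp (Real.pi * I / S.k * S.form ν ν) * (exp (Real.pi * I * (S.k * S.form (x : V) x)) *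
        exp (2 * Real.pi * I * S.form ν x) * exp (Real.pi * I * τ / S.k *
        S.form (ν + (S.k : ℂ) • (x : V)) (ν + (S.k : ℂ) • (x : V)) +
        2 * Real.pi * I * S.form (ν + (S.k : ℂ) • (x : V)) w)) := by
    rw [← Complex.exp_add, ← Complex.exp_add, ← Complex.exp_add]
    congr 1
    rw [form_add_smul_self]
    field_simp
    ring
  rw [h1, h2]
  ring

end Setting

theorem sum_sum_symm {n : ℕ} (a : Fin n → Fin n → ℂ) (h : ∀ p q, a p q = a q p) :
    ∑ p, ∑ q, a p q =
      ∑ p, (a p p + 2 * ∑ q ∈ Finset.univ.filter (fun q : Fin n => q < p), a p q) := by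
  have h1 : ∑ p, ∑ q, a p q =
      ∑ p, ∑ q, ((if p = q then a p q else 0) + ((if q < p then a p q else 0) +
        if p < q then a p q else 0)) := by
    refine Finset.sum_congr rfl fun p _ => Finset.sum_congr rfl fun q _ => ?_
    rcases lt_trichotomy p q with hpq | hpq | hpq
    · simp [hpq, hpq.ne, hpq.not_gt]
    · simp [hpq]
    · simp [hpq, hpq.ne', hpq.not_gt]
  have h2 : ∑ p, ∑ q, (if p < q then a p q else 0) = ∑ p, ∑ q, if q < p then a p q else 0 := by
    rw [Finset.sum_comm]
    exact Finset.sum_congr rfl fun p _ => Finset.sum_congr rfl fun q _ => by rw [h]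
  rw [h1]
  simp only [Finset.sum_add_distrib, h2, ← Finset.mul_sum, Finset.sum_filter]
  simp
  ring

theorem neg_one_zpow_mul_self (c : ℤ) : (-1 : ℂ) ^ (c * c) = (-1) ^ c := by
  rcases Int.even_or_odd c with h | h
  · rw [(h.mul_right c).neg_one_zpow, h.neg_one_zpow]
  · rw [(h.mul h).neg_one_zpow, h.neg_one_zpow]

theorem im_eq_zero_of_exp_eq_sign {x : ℂ} {σ : ℤˣ} {a : ℤ}
    (h : exp (2 * Real.pi * I * x) = ((σ : ℤ) : ℂ) ^ a) : x.im = 0 := by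
  have h1 := congrArg norm h
  rw [norm_sign_zpow, Complex.norm_exp, Real.exp_eq_one_iff] at h1
  simpa [Real.pi_ne_zero] using h1

namespace Setting

variable {V : Type*} [AddCommGroup V] [Module ℂ V] {m n : ℕ} (S : Setting V m n)

/-! ### Weights with a character on the lattice -/

/-- The weights `λ` of level `k`, orthogonal to `T`, with
`e^{2πi (λ|γ)} = (±1)^{k|γ|²}` for `γ ∈ L`. -/
def HasType (σ : ℤˣ) (lam : AffineDual V) : Prop :=
  lam.level = S.k ∧ (∀ q, S.form lam.bar (S.beta q) = 0) ∧
    ∀ x ∈ S.L, exp (2 * Real.pi * I * S.form lam.bar x) = ((σ : ℤ) : ℂ) ^ (S.k * S.form x x)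

theorem hasType_of_mem_PT {lam : AffineDual V} (h : lam ∈ S.PT) : S.HasType 1 lam := by
  refine ⟨h.1.1, h.2, fun x hx => ?_⟩
  obtain ⟨a, ha⟩ := h.1.2 x hx
  rw [ha, exp_two_pi_mul_I_int]
  simp

/-- Both sides are characters of L: modulo 2 the function k|x|² is additive, because its cross term
is 2k(x|y) with k(x|y) an integer. It suffices to compare them on the basis. -/
theorem hasType_add {ξ₀ : V}
    (hξ_even : ∀ i : Fin m, S.gamma i ∈ S.Leven → ∃ a : ℤ, S.form ξ₀ (S.gamma i) = a)
    (hξ_odd : ∀ i : Fin m, S.gamma i ∈ S.Lodd → ∃ a : ℤ, S.form ξ₀ (S.gamma i) = 1 / 2 + a)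
    (hξ_T : ∀ j : Fin n, S.form ξ₀ (S.beta j) = 0) {lam : AffineDual V} (h : lam ∈ S.PT) :
    S.HasType (-1) (lam + (ξ₀, 0, 0)) := by
  have key : ∀ x ∈ S.L, exp (2 * Real.pi * I * S.form ξ₀ x) = (-1) ^ (S.k * S.form x x) := by
    intro x hx
    have hx' := hx
    induction hx using Submodule.span_induction with
    | mem x hx =>
      obtain ⟨i, rfl⟩ := hx
      obtain ⟨a, ha⟩ := S.k_integral _ (S.gamma_mem i) _ (S.gamma_mem i)
      rw [ha, cpow_intCast]
      rcases Int.even_or_odd' a with ⟨b, rfl | rfl⟩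
      · obtain ⟨c, hc⟩ := hξ_even i ⟨S.gamma_mem i, b, by rw [ha]; push_cast; ring⟩
        rw [hc, exp_two_pi_mul_I_int, (even_two_mul b).neg_one_zpow]
      · obtain ⟨c, hc⟩ := hξ_odd i ⟨S.gamma_mem i, b, by rw [ha]; push_cast; ring⟩
        rw [hc, (odd_two_mul_add_one b).neg_one_zpow,
          exp_eq_of_sub_int c (show _ = Real.pi * I + 2 * Real.pi * I * c by ring), exp_pi_mul_I]
    | zero => simp
    | add x y hx hy ihx ihy =>
      obtain ⟨a, ha⟩ := S.k_integral x hx x hx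
      obtain ⟨b, hb⟩ := S.k_integral y hy y hy
      obtain ⟨c, hc⟩ := S.k_integral x hx y hy
      have h1 : S.k * S.form (x + y) (x + y) = ((a + b + 2 * c : ℤ) : ℂ) := by
        push_cast
        rw [← ha, ← hb, ← hc]
        simp only [map_add, LinearMap.add_apply, S.form_comm y x]
        ring
      rw [h1, map_add, mul_add, Complex.exp_add, ihx hx, ihy hy, ha, hb, cpow_intCast,
        cpow_intCast, cpow_intCast, zpow_add₀ (by norm_num), zpow_add₀ (by norm_num),
        (even_two_mul c).neg_one_zpow, mul_one]
    | smul c x hx ih =>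
      obtain ⟨a, ha⟩ := S.k_integral x hx x hx
      have h1 : S.k * S.form (c • x) (c • x) = ((c * c * a : ℤ) : ℂ) := by
        push_cast
        rw [← ha]
        simp only [map_zsmul, LinearMap.smul_apply, zsmul_eq_mul]
        ring
      rw [h1, map_zsmul, zsmul_eq_mul,
        show 2 * Real.pi * I * (c * S.form ξ₀ x) = c * (2 * Real.pi * I * S.form ξ₀ x) by ring,
        exp_int_mul, ih hx, ha, cpow_intCast, cpow_intCast, zpow_mul, neg_one_zpow_mul_self,
        ← zpow_mul, ← zpow_mul, mul_comm]
  refine ⟨?_, fun q => ?_, fun x hx => ?_⟩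
  · have h1 := h.1.1
    change lam.level + 0 = _
    rw [h1, add_zero]
  · change S.form (lam.bar + ξ₀) _ = 0
    rw [map_add, LinearMap.add_apply, h.2, hξ_T, add_zero]
  · change exp (2 * Real.pi * I * S.form (lam.bar + ξ₀) x) = _
    obtain ⟨a, ha⟩ := h.1.2 x hx
    rw [map_add, LinearMap.add_apply, ha, mul_add, Complex.exp_add, exp_two_pi_mul_I_int, one_mul,
      key x hx]
    simp

variable {S}

theorem HasType.exp_shift {σ : ℤˣ} {lam : AffineDual V} (h : S.HasType σ lam) {x : V}
    (hx : x ∈ S.M) : exp (2 * Real.pi * I * S.form (S.shift n lam.bar) x) =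
      ((σ : ℤ) : ℂ) ^ (S.k * S.form x x) := by
  obtain ⟨y, hy, rfl⟩ := S.exists_of_mem_M hx
  rw [S.form_shift_shift n h.2.1 (S.form_coreLattice_beta hy),
    S.form_shift_shift n (S.form_coreLattice_beta hy) (S.form_coreLattice_beta hy),
    h.2.2 y (S.coreLattice_le hy)]

theorem HasType.ofReal_form_gam {σ : ℤˣ} {lam : AffineDual V} (h : S.HasType σ lam) (p : Fin n) :
    ((S.form lam.bar (S.gam p)).re : ℂ) = S.form lam.bar (S.gam p) := by
  obtain ⟨a, ha⟩ := S.k_integral _ (S.gam_mem p) _ (S.gam_mem p)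
  have h1 := h.2.2 _ (S.gam_mem p)
  rw [ha, cpow_intCast] at h1
  exact Complex.ext (by simp) (by simp [im_eq_zero_of_exp_eq_sign h1])

theorem exists_odd_nat (hodd : ∀ p : Fin n, S.gam p ∈ S.Lodd) (p : Fin n) :
    ∃ N : ℕ, 0 < N ∧ Odd N ∧ 2 * (S.k / 2 * (S.form (S.gam p) (S.gam p)).re) = N := by
  obtain ⟨hL, a, ha⟩ := hodd p
  rw [← S.ofReal_form hL hL] at ha
  have h1 : S.k * (S.form (S.gam p) (S.gam p)).re = ((1 + 2 * a : ℤ) : ℝ) := by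
    have : ((S.k * (S.form (S.gam p) (S.gam p)).re : ℝ) : ℂ) = (((1 + 2 * a : ℤ) : ℝ) : ℂ) := by
      push_cast
      exact ha
    exact_mod_cast this
  have hne : S.gam p ≠ 0 := by
    intro h0
    have := S.form_gam_beta p p
    rw [h0] at this
    simp at this
  have h2 := mul_pos S.k_pos (S.form_pos _ hL hne)
  rw [h1] at h2
  have h3 : 0 < 1 + 2 * a := by exact_mod_cast h2
  obtain ⟨b, rfl⟩ : ∃ b : ℕ, a = b := ⟨a.toNat, by omega⟩
  refine ⟨1 + 2 * b, by omega, ⟨b, by ring⟩, ?_⟩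
  rw [← mul_assoc, mul_div_cancel₀ _ two_ne_zero, h1]
  push_cast
  ring

/-- As k|γ_p|² is odd, the character takes the value σ at γ_p; this matches the type of a weight
with the sign data of the rank one transformations. -/
theorem HasType.exp_gam (hodd : ∀ p : Fin n, S.gam p ∈ S.Lodd) {σ : ℤˣ} {lam : AffineDual V}
    (h : S.HasType σ lam) (p : Fin n) (c : ℤ) :
    exp (2 * Real.pi * I * (c * (S.form lam.bar (S.gam p)).re)) = ((σ : ℤ) : ℂ) ^ c := by
  obtain ⟨hL, a, ha⟩ := hodd p
  have h1 := h.2.2 _ hL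
  have ha' : S.k * S.form (S.gam p) (S.gam p) = ((1 + 2 * a : ℤ) : ℂ) := by
    push_cast
    exact ha
  rw [ha', cpow_intCast, zpow_add₀ (sign_ne_zero σ), zpow_mul, zpow_one,
    show ((σ : ℤ) : ℂ) ^ (2 : ℤ) = 1 by rw [zpow_two, sign_mul_self], one_zpow, mul_one] at h1
  rw [h.ofReal_form_gam, mul_left_comm, exp_int_mul, h1]

/-! ### The rank one factors -/

variable (S) in
/-- The third argument of the rank one factor with index `p`. -/
def factorArg (p : Fin n) (z : V) : ℂ :=
  S.form (S.beta p) z + S.form (coroot S.form (S.gam p)) z +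
    ∑ i ∈ Finset.univ.filter (fun i : Fin n => i < p),
      S.form (coroot S.form (S.gam p)) (S.gam i) * S.form (S.beta i) z

theorem factor_eq (σ : ℤˣ) (lam : AffineDual V) (p : Fin n) (τ : ℂ) (z : V) :
    S.factor σ lam p τ z = PhiMod σ (S.k / 2 * (S.form (S.gam p) (S.gam p)).re)
      (S.form lam.bar (S.gam p)).re τ (-S.form (S.beta p) z) (S.factorArg p z) := rfl

theorem factorArg_smul (p : Fin n) (c : ℂ) (z : V) :
    S.factorArg p (c • z) = c * S.factorArg p z := by
  simp only [factorArg, map_smul, smul_eq_mul, mul_add, Finset.mul_sum]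
  congr 1
  exact Finset.sum_congr rfl fun i _ => by ring

theorem Regular.neg_ne {τ : ℂ} {z : V} (h : S.Regular τ z) (p : Fin n) (a b : ℤ) :
    -S.form (S.beta p) z ≠ a + b * τ := by
  intro h1
  refine h.2 p (-a) (-b) ?_
  push_cast
  linear_combination -h1

theorem factor_S (hodd : ∀ p : Fin n, S.gam p ∈ S.Lodd) {σ σ' : ℤˣ} {lam mu : AffineDual V}
    (hlam : S.HasType σ' lam) (hmu : S.HasType σ mu) {τ : ℂ} {z : V} (h : S.Regular τ z)
    (p : Fin n) : S.factor σ lam p (-1 / τ) (τ⁻¹ • z) =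
      τ * exp (2 * Real.pi * I * ((S.k / 2 * (S.form (S.gam p) (S.gam p)).re : ℝ) : ℂ) *
        (-S.form (S.beta p) z) * S.factorArg p z / τ) * S.factor σ' mu p τ z := by
  obtain ⟨N, hN, -, hmN⟩ := exists_odd_nat hodd p
  rw [factor_eq, factor_eq, factorArg_smul, map_smul, smul_eq_mul, inv_mul_eq_div,
    inv_mul_eq_div, ← neg_div]
  exact PhiMod_S hN hmN (hmu.exp_gam hodd p) (hlam.exp_gam hodd p) h.1 (h.neg_ne p) _

theorem factor_add_one (hodd : ∀ p : Fin n, S.gam p ∈ S.Lodd) (σ : ℤˣ) {σ' : ℤˣ}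
    {lam : AffineDual V} (hlam : S.HasType σ' lam) (τ : ℂ) (z : V) (p : Fin n) :
    S.factor σ lam p (τ + 1) z = S.factor (σ * -σ') lam p τ z := by
  obtain ⟨N, hN, hNodd, hmN⟩ := exists_odd_nat hodd p
  exact PhiMod_add_one hNodd hmN (hlam.exp_gam hodd p) σ τ _ _

theorem form_self_gam_ne_zero (p : Fin n) : S.form (S.gam p) (S.gam p) ≠ 0 := by
  intro h0
  have h1 := S.eq_zero_of_form_self (S.gam_mem p) h0
  have := S.form_gam_beta p p
  rw [h1] at this
  simp at this

/-- The exponents in the transformation of the rank one factors add up to the square of the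
component of `z` orthogonal to `M`. -/
theorem IsProjM.sum_factorArg {z w : V} (h : S.IsProjM z w) :
    ∑ p, ((S.k / 2 * (S.form (S.gam p) (S.gam p)).re : ℝ) : ℂ) * (-S.form (S.beta p) z) *
      S.factorArg p z = S.k / 2 * (S.form z z - S.form w w) := by
  -- The rank one arguments contain only the indices i < p; the symmetric double sum is folded onto
  -- that triangle.
  have h1 : ∑ p, S.form (S.beta p) z * ∑ q, S.form (S.gam p) (S.gam q) * S.form (S.beta q) z =
      ∑ p, (S.form (S.gam p) (S.gam p) * S.form (S.beta p) z ^ 2 +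
        2 * ∑ q ∈ Finset.univ.filter (fun q : Fin n => q < p),
          S.form (S.beta p) z * S.form (S.gam p) (S.gam q) * S.form (S.beta q) z) := by
    simp only [Finset.mul_sum (Finset.univ : Finset (Fin n)), ← mul_assoc]
    rw [sum_sum_symm _ fun p q => by rw [S.form_comm (S.gam p)]; ring]
    exact Finset.sum_congr rfl fun p _ => by ring
  rw [h.form_self, Finset.sum_add_distrib, h1, ← Finset.sum_add_distrib, sub_sub_cancel_left,
    ← Finset.sum_neg_distrib, Finset.mul_sum]
  refine Finset.sum_congr rfl fun p _ => ?_
  have h0 := form_self_gam_ne_zero (S := S) p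
  have h2 : S.form (S.gam p) (S.gam p) * S.factorArg p z =
      S.form (S.gam p) (S.gam p) * S.form (S.beta p) z + 2 * S.form (S.gam p) z +
      2 * ∑ i ∈ Finset.univ.filter (fun i : Fin n => i < p),
        S.form (S.gam p) (S.gam i) * S.form (S.beta i) z := by
    simp only [factorArg, coroot, map_smul, LinearMap.smul_apply, smul_eq_mul, mul_assoc,
      ← Finset.mul_sum]
    field_simp
  push_cast
  rw [S.ofReal_form (S.gam_mem p) (S.gam_mem p)]
  simp only [mul_assoc, ← Finset.mul_sum] at h2 ⊢
  linear_combination (-(S.k / 2 : ℂ) * S.form (S.beta p) z) * h2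

end Setting

namespace Setting

variable {V : Type*} [AddCommGroup V] [Module ℂ V]

/-! ### The modified mock theta function as a product -/

/-- The theta series of `M` as a sum over `coreLattice`. -/
theorem thetaM_eq_tsum_coreLattice {m n : ℕ} (S : Setting V m n) (σ : ℤˣ) {x₀ : V}
    (hx₀ : ∀ q, S.form x₀ (S.beta q) = 0) (τ : ℂ) {z w : V} (hw : S.IsProjM z w) :
    S.thetaM σ (S.shift n x₀) τ w = ∑' x : S.coreLattice,
      ((σ : ℤ) : ℂ) ^ ((S.k : ℂ) * S.form x x) *
        exp (Real.pi * I * τ / S.k * S.form (x₀ + (S.k : ℂ) • (x : V)) (x₀ + (S.k : ℂ) • (x : V)) +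
          2 * Real.pi * I * S.form (S.shift n (x₀ + (S.k : ℂ) • (x : V))) z) := by
  rw [thetaM, S.tsum_M fun x => ((σ : ℤ) : ℂ) ^ ((S.k : ℂ) * S.form x x) *
    exp (Real.pi * I * τ / S.k * S.form (S.shift n x₀ + (S.k : ℂ) • x)
      (S.shift n x₀ + (S.k : ℂ) • x) + 2 * Real.pi * I * S.form (S.shift n x₀ + (S.k : ℂ) • x) w)]
  refine tsum_congr fun x => ?_
  have hx := S.form_coreLattice_beta x.2
  have hv : ∀ q, S.form (x₀ + (S.k : ℂ) • (x : V)) (S.beta q) = 0 := fun q => by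
    rw [map_add, LinearMap.add_apply, map_smul, LinearMap.smul_apply, hx₀, hx, smul_zero, add_zero]
  rw [S.form_shift_shift n hx hx, ← map_smul, ← map_add, S.form_shift_shift n hv hv,
    ← hw.form_eq (S.shift_mem_cM hv)]

theorem modTheta_eq_of_eq_zero {m : ℕ} (S : Setting V m 0) (σ : ℤˣ) {lam : AffineDual V}
    (hl : lam.level = S.k) (τ : ℂ) {z w : V} (hw : S.IsProjM z w) (t : ℂ) :
    S.modTheta σ lam τ z t = exp (2 * Real.pi * I * S.k * t) *
      S.thetaM σ (S.shift 0 lam.bar) τ w * ∏ p, S.factor σ lam p τ z := by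
  have hL : S.L = S.coreLattice := by
    rw [L, coreLattice]
    simp
  have hshift : ∀ x, S.shift 0 x = x := fun x => by simp [shift_apply]
  change mockTheta S.form S.L (S.eps σ) Finset.univ S.beta lam τ z t = _
  rw [S.thetaM_eq_tsum_coreLattice σ (fun q => q.elim0) τ hw, mockTheta, hl, hL]
  simp only [Finset.univ_eq_empty, Finset.prod_empty, mul_one, div_one]
  congr 1
  refine tsum_congr fun x => ?_
  rw [mul_assoc, ← Complex.exp_add, hshift]
  simp only [eps, Finset.univ_eq_empty, Finset.sum_empty, zero_add, add_zero]
  congr 2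
  ring

theorem form_shift_left_of_lt {m n : ℕ} (S : Setting V m n) (s : ℕ) (x : V) {y : V}
    (hy : ∀ q : Fin n, (q : ℕ) < s → S.form y (S.beta q) = 0) :
    S.form (S.shift s x) y = S.form x y := by
  rw [shift_apply, map_add, LinearMap.add_apply, map_sum, LinearMap.sum_apply,
    Finset.sum_eq_zero, add_zero]
  intro q hq
  rw [map_smul, LinearMap.smul_apply, S.form_comm (S.beta q), hy q (Finset.mem_filter.1 hq).2,
    smul_zero]

theorem stageT_top {m n : ℕ} (S : Setting V m n) : S.stageT n = ∅ := by
  ext p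
  simp [stageT]

/-- The modified function only involves its last step, where T_{s+1} is empty and no denominators
are left. Quasi-periodicity of `PhiMod` makes its dependence on the summation vector exponential,
and the last factor can be taken out of the sum. -/
theorem modTheta_eq_of_eq_succ {m s : ℕ} (S : Setting V m (s + 1))
    (hodd : ∀ p : Fin (s + 1), S.gam p ∈ S.Lodd) (σ : ℤˣ) {lam : AffineDual V}
    (hl : lam.level = S.k) (hb : ∀ q, S.form lam.bar (S.beta q) = 0) {τ : ℂ} {z w : V}
    (h : S.Regular τ z) (hw : S.IsProjM z w) (t : ℂ) :
    S.modTheta σ lam τ z t = exp (2 * Real.pi * I * S.k * t) *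
      S.thetaM σ (S.shift (s + 1) lam.bar) τ w * ∏ p, S.factor σ lam p τ z := by
  have hs : s < s + 1 := Nat.lt_succ_self s
  set p : Fin (s + 1) := ⟨s, hs⟩ with hp
  have hk := S.k_ne_zero
  have hγ0 := form_self_gam_ne_zero (S := S) p
  have hgb : ∀ q : Fin (s + 1), (q : ℕ) < s → S.form (S.gam p) (S.beta q) = 0 := fun q hq => by
    rw [form_gam_beta, if_neg]
    rintro rfl
    exact hq.ne rfl
  have hvec : S.stageVec s (Fin.castLE S.n_le p) = S.shift s (S.gam p) := by
    rw [shift_apply]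
    rfl
  have hfilter : Finset.univ.filter (fun q : Fin (s + 1) => (q : ℕ) < s) =
      Finset.univ.filter (fun q : Fin (s + 1) => q < p) := by
    ext q
    simp [hp, Fin.lt_def]
  -- γ_p is not orthogonal to β_p, but the shift at stage s only uses the β_q with q < s, to which
  -- γ_p is orthogonal.
  have hright : ∀ x, S.form (S.shift s x) (S.shift s (S.gam p)) =
      S.form (S.shift s (S.gam p)) x := fun x => by
    rw [S.form_shift_left_of_lt s x fun q hq => by rw [form_shift_beta, hgb q hq], S.form_comm]
  have hγγ : S.form (S.shift s (S.gam p)) (S.shift s (S.gam p)) =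
      S.form (S.gam p) (S.gam p) := by
    rw [hright, S.form_shift_left_of_lt s _ hgb]
  have hleft : ∀ {x : V}, (∀ q, S.form x (S.beta q) = 0) →
      S.form (S.shift s x) (S.shift s (S.gam p)) = S.form x (S.gam p) := fun {x} hx => by
    rw [hright, S.form_shift_left s _ hx, S.form_comm]
  have hcoroot : ∀ v, S.form (coroot S.form (S.shift s (S.gam p))) v =
      2 / S.form (S.gam p) (S.gam p) * S.form (S.shift s (S.gam p)) v := fun v => by
    rw [coroot, hγγ, map_smul, LinearMap.smul_apply, smul_eq_mul]
  have harg : S.form (S.beta p) z + S.form (coroot S.form (S.shift s (S.gam p))) z =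
      S.factorArg p z := by
    rw [hcoroot, factorArg, add_assoc, shift_apply, hfilter]
    simp only [coroot, map_add, LinearMap.add_apply, map_sum, LinearMap.sum_apply, map_smul,
      LinearMap.smul_apply, smul_eq_mul, mul_add, Finset.mul_sum, mul_assoc]
  have hprod : ∏ q, S.factor σ lam q τ z = S.factor σ lam p τ z *
      ∏ q ∈ Finset.univ.filter (fun q : Fin (s + 1) => (q : ℕ) < s), S.factor σ lam q τ z := by
    rw [← Finset.prod_insert (f := fun q => S.factor σ lam q τ z) (a := p) (by simp [hp])]
    congr 1
    ext q
    simp only [Finset.mem_univ, Finset.mem_insert, Finset.mem_filter, true_and, true_iff, hp,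
      Fin.ext_iff]
    omega
  have hrest : S.stageRest s = S.coreLattice.map ((S.shift s).restrictScalars ℤ) :=
    S.span_stageVec s
  obtain ⟨N, hN, -, hmN⟩ := exists_odd_nat hodd p
  have h0 : S.modTheta σ lam τ z t = S.expansion PhiMod σ lam p τ z t *
      ∏ q ∈ Finset.univ.filter (fun q : Fin (s + 1) => (q : ℕ) < s), S.factor σ lam q τ z := by
    change S.modStage σ lam (s + 1) τ z t = _
    rw [modStage, dif_pos hs]
  rw [h0, hprod, ← mul_assoc]
  congr 1
  rw [expansion, hl]
  simp only [hvec, stageWeight_eq, hγγ, hleft hb, show ((p : Fin (s + 1)) : ℕ) = s from rfl,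
    stageT_top, Finset.prod_empty, div_one, harg]
  rw [mul_assoc (exp _) (S.thetaM _ _ _ _), S.thetaM_eq_tsum_coreLattice σ hb τ hw, ← tsum_mul_right]
  congr 1
  rw [hrest, S.tsum_map_shift s fun γ => S.eps σ γ *
      exp (2 * Real.pi * I * (τ * (S.form (S.shift s lam.bar + (S.k : ℂ) • γ)
        (S.shift s lam.bar + (S.k : ℂ) • γ) / (2 * S.k)))) *
      exp (2 * Real.pi * I * S.form (S.shift (s + 1) lam.bar + (S.k : ℂ) • γ) z) *
      PhiMod σ (S.k / 2 * (S.form (S.gam p) (S.gam p)).re) (S.form lam.bar (S.gam p)).re τ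
        (-S.form (S.beta p) z) (S.factorArg p z +
          τ * S.form γ (coroot S.form (S.shift s (S.gam p)) + (2 : ℂ) • S.beta p))]
  refine tsum_congr fun x => ?_
  have hx := S.form_coreLattice_beta x.2
  have hv : ∀ q, S.form (lam.bar + (S.k : ℂ) • (x : V)) (S.beta q) = 0 := fun q => by
    rw [map_add, LinearMap.add_apply, map_smul, LinearMap.smul_apply, hb, hx, smul_zero, add_zero]
  obtain ⟨a, ha⟩ := S.k_integral x (S.coreLattice_le x.2) _ (S.gam_mem p)
  have hre := S.ofReal_form (S.coreLattice_le x.2) (S.gam_mem p)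
  have hre' := S.ofReal_form (S.gam_mem p) (S.gam_mem p)
  have heps : S.eps σ (S.shift s x) = ((σ : ℤ) : ℂ) ^ ((S.k : ℂ) * S.form x x) := by
    simp only [eps, form_shift_beta, hx, S.form_comm (S.beta _), zero_smul, Finset.sum_const_zero,
      add_zero, zero_add, S.form_shift_shift s hx hx]
  set b : ℝ := 2 / (S.form (S.gam p) (S.gam p)).re * (S.form x (S.gam p)).re with hbdef
  have hbx : S.form (S.shift s x) (coroot S.form (S.shift s (S.gam p)) + (2 : ℂ) • S.beta p) =
      b := by
    rw [map_add, map_smul, form_shift_beta, hx, smul_zero, add_zero, S.form_comm, hcoroot,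
      S.form_comm _ (S.shift s x), hleft hx, hbdef]
    push_cast
    rw [hre, hre']
  -- The integrality that makes the displacement bτ an admissible quasi-period: m b = k(x|γ_p).
  have hma : S.k / 2 * (S.form (S.gam p) (S.gam p)).re * b = a := by
    have h1 : (S.form (S.gam p) (S.gam p)).re ≠ 0 := fun h1 => hγ0 (by rw [← hre', h1]; simp)
    have h2 : S.k * (S.form x (S.gam p)).re = a := by
      rw [← hre] at ha
      exact_mod_cast ha
    rw [← h2, hbdef]
    field_simp
  rw [hbx, mul_comm τ (b : ℂ), PhiMod_add_mul_of_int hN hmN h.1 σ _ (h.neg_ne p) _ hma, heps, ← map_smul,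
    ← map_add, S.form_shift_shift s hv hv]
  rw [factor_eq, show ∀ c e₁ e₂ e₃ F : ℂ, c * e₁ * e₂ * (e₃ * F) = c * (e₁ * e₂ * e₃) * F from
    fun _ _ _ _ _ => by ring, ← Complex.exp_add, ← Complex.exp_add]
  congr 3
  generalize S.form (lam.bar + (S.k : ℂ) • (x : V)) (lam.bar + (S.k : ℂ) • (x : V)) = Q
  -- The factor produced by quasi-periodicity is exactly the missing multiple of β_p between stage s
  -- and stage s + 1.
  rw [map_add (S.shift (s + 1)), map_smul (S.shift (s + 1)), S.shift_succ s hs x]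
  simp only [map_add, LinearMap.add_apply, map_smul, LinearMap.smul_apply, smul_eq_mul, ← ha]
  field_simp
  ring

/-- The modified mock theta function is the product of a theta function of `M` and of rank one
factors. -/
theorem modTheta_eq {m n : ℕ} (S : Setting V m n) (hodd : ∀ p : Fin n, S.gam p ∈ S.Lodd) (σ : ℤˣ)
    {lam : AffineDual V} (hl : lam.level = S.k) (hb : ∀ q, S.form lam.bar (S.beta q) = 0) {τ : ℂ}
    {z w : V} (h : S.Regular τ z) (hw : S.IsProjM z w) (t : ℂ) :
    S.modTheta σ lam τ z t = exp (2 * Real.pi * I * S.k * t) *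
      S.thetaM σ (S.shift n lam.bar) τ w * ∏ p, S.factor σ lam p τ z := by
  cases n with
  | zero => exact S.modTheta_eq_of_eq_zero σ hl τ hw t
  | succ s => exact S.modTheta_eq_of_eq_succ hodd σ hl hb h hw t

end Setting

namespace Setting

variable {V : Type*} [AddCommGroup V] [Module ℂ V] {m n : ℕ} {S : Setting V m n}

/-! ### Modular transformations of the modified mock theta functions -/

theorem Regular.neg_one_div {τ : ℂ} {z : V} (h : S.Regular τ z) :
    S.Regular (-1 / τ) (τ⁻¹ • z) := by
  have hτ := ne_zero_of_im_pos h.1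
  refine ⟨im_neg_one_div_pos h.1, fun p a b hab => h.2 p (-b) a ?_⟩
  rw [map_smul, smul_eq_mul] at hab
  field_simp at hab
  push_cast
  rw [hab]
  ring

theorem Regular.add_one {τ : ℂ} {z : V} (h : S.Regular τ z) : S.Regular (τ + 1) z := by
  refine ⟨by simpa using h.1, fun p a b hab => h.2 p (a + b) b ?_⟩
  rw [hab]
  push_cast
  ring

/-- Each of the n rank one factors contributes τ = i(-iτ), and M contributes (-iτ)^{(m-n)/2}. -/
theorem sFactor_eq {τ : ℂ} (hτ : 0 < τ.im) : S.sFactor τ =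
    τ ^ n * (((-I * τ) ^ (1 / 2 : ℂ)) ^ (m - n) * ((Real.sqrt (S.index : ℝ))⁻¹ : ℝ)) := by
  have hτ0 : -I * τ ≠ 0 := mul_ne_zero (by simp) (ne_zero_of_im_pos hτ)
  have h1 : τ = I * (-I * τ) := by rw [← mul_assoc, mul_neg, I_mul_I, neg_neg, one_mul]
  have h2 : ((Module.finrank ℂ V : ℂ) / 2) = (n : ℂ) + ((m - n : ℕ) : ℂ) * (1 / 2) := by
    rw [S.dim_eq, Nat.cast_sub S.n_le]
    push_cast
    ring
  have h3 : τ ^ n = I ^ n * (-I * τ) ^ n := by rw [← mul_pow, ← h1]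
  rw [sFactor, h2, cpow_add _ _ hτ0, cpow_natCast, cpow_nat_mul, h3]
  ring

theorem prod_factor_S (hodd : ∀ p : Fin n, S.gam p ∈ S.Lodd) {σ σ' : ℤˣ} {lam mu : AffineDual V}
    (hlam : S.HasType σ' lam) (hmu : S.HasType σ mu) {τ : ℂ} {z w : V} (h : S.Regular τ z)
    (hw : S.IsProjM z w) : ∏ p, S.factor σ lam p (-1 / τ) (τ⁻¹ • z) =
      τ ^ n * exp (Real.pi * I * S.k * (S.form z z - S.form w w) / τ) *
        ∏ p, S.factor σ' mu p τ z := by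
  rw [Finset.prod_congr rfl fun p _ => factor_S hodd hlam hmu h p, Finset.prod_mul_distrib,
    Finset.prod_mul_distrib, Finset.prod_const, Finset.card_univ, Fintype.card_fin,
    ← Complex.exp_sum]
  congr 3
  have h1 := hw.sum_factorArg
  simp only [mul_assoc (2 * (Real.pi : ℂ) * I)]
  rw [← Finset.sum_div, ← Finset.mul_sum, h1]
  ring

/-- The `S`-transformation of the modified mock theta functions. -/
theorem modTheta_S (hodd : ∀ p : Fin n, S.gam p ∈ S.Lodd) {A : Finset (AffineDual V)}
    (hA : S.IsRepresentatives A) {σ σ' : ℤˣ} {lam : AffineDual V} (hlam : S.HasType σ' lam)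
    {ρ : V} (hρ : ∀ mu ∈ S.PT, S.HasType σ (mu + (ρ, 0, 0))) {τ : ℂ} {z : V}
    (h : S.Regular τ z) (t : ℂ) :
    S.modTheta σ lam (-1 / τ) (τ⁻¹ • z) (t - S.form z z / (2 * τ)) =
      S.sFactor τ * ∑ mu ∈ A, exp (-(2 * Real.pi * I / S.k) * S.form lam.bar (mu.bar + ρ)) *
        S.modTheta σ' (mu + (ρ, 0, 0)) τ z t := by
  have hτ0 := ne_zero_of_im_pos h.1
  obtain ⟨w, hw, -⟩ := S.exists_unique_projM z
  have hρ0 : S.HasType σ (((0 : V), (S.k : ℂ), (0 : ℂ)) + (ρ, 0, 0)) :=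
    hρ _ (S.mem_PT_of_mem_Mdual (zero_mem _))
  have hbar : (((0 : V), (S.k : ℂ), (0 : ℂ)) + (ρ, (0 : ℂ), (0 : ℂ))).1 = ρ := by simp
  have hρβ : ∀ q, S.form ρ (S.beta q) = 0 := fun q => by
    have := hρ0.2.1 q
    rwa [AffineDual.bar, hbar] at this
  have hρM : ∀ x ∈ S.M, exp (2 * Real.pi * I * S.form (S.shift n ρ) x) =
      ((σ : ℤ) : ℂ) ^ (S.k * S.form x x) := fun x hx => by
    have := hρ0.exp_shift hx
    rwa [AffineDual.bar, hbar] at this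
  have hθ := S.thetaM_S hA (S.shift_mem_cM hlam.2.1) (fun x hx => hlam.exp_shift hx)
    (S.shift_mem_cM hρβ) hρM h.1 hw.1
  have hθ' : S.thetaM σ (S.shift n lam.bar) (-1 / τ) (τ⁻¹ • w) =
      exp (Real.pi * I * S.k * S.form w w / τ) *
        (exp (-(Real.pi * I * S.k * S.form w w / τ)) *
          S.thetaM σ (S.shift n lam.bar) (-1 / τ) (τ⁻¹ • w)) := by
    rw [← mul_assoc, ← Complex.exp_add, add_neg_cancel, Complex.exp_zero, one_mul]
  rw [S.modTheta_eq hodd σ hlam.1 hlam.2.1 h.neg_one_div (hw.smul τ⁻¹), hθ', hθ, sFactor_eq h.1,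
    Finset.mul_sum, Finset.mul_sum, Finset.mul_sum, Finset.mul_sum, Finset.sum_mul]
  refine Finset.sum_congr rfl fun mu hmu => ?_
  have hmu' := hρ mu (hA.1 mu hmu)
  have hmuβ := (hA.1 mu hmu).2
  have hbar' : (mu + (ρ, 0, 0)).bar = mu.bar + ρ := rfl
  have hsum : ∀ q, S.form (mu.bar + ρ) (S.beta q) = 0 := hmu'.2.1
  -- The translation of t compensates |z|², whose part along M comes from the theta series and whose
  -- orthogonal part comes from the rank one factors.
  have hexp : exp (2 * Real.pi * I * S.k * (t - S.form z z / (2 * τ))) *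
      exp (Real.pi * I * S.k * S.form w w / τ) *
      exp (Real.pi * I * S.k * (S.form z z - S.form w w) / τ) =
      exp (2 * Real.pi * I * S.k * t) := by
    rw [← Complex.exp_add, ← Complex.exp_add]
    congr 1
    field_simp
    ring
  rw [prod_factor_S hodd hlam hmu' h hw, S.modTheta_eq hodd σ' hmu'.1 hmu'.2.1 h hw, hbar',
    ← map_add (S.shift n), S.form_shift_shift n hlam.2.1 hsum, ← hexp]
  ring

/-- The `T`-transformation of the modified mock theta functions. -/
theorem modTheta_add_one (hodd : ∀ p : Fin n, S.gam p ∈ S.Lodd) (σ : ℤˣ) {σ' : ℤˣ}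
    {lam : AffineDual V} (hlam : S.HasType σ' lam) {τ : ℂ} {z : V} (h : S.Regular τ z) (t : ℂ) :
    S.modTheta σ lam (τ + 1) z t = exp (Real.pi * I / S.k * S.form lam.bar lam.bar) *
      S.modTheta (σ * -σ') lam τ z t := by
  obtain ⟨w, hw, -⟩ := S.exists_unique_projM z
  rw [S.modTheta_eq hodd _ hlam.1 hlam.2.1 h.add_one hw, S.modTheta_eq hodd _ hlam.1 hlam.2.1 h hw,
    S.thetaM_add_one (fun x hx => hlam.exp_shift hx), S.form_shift_shift n hlam.2.1 hlam.2.1,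
    Finset.prod_congr rfl fun p _ => factor_add_one hodd σ hlam τ z p]
  ring

end Setting

end SignedMock

end

/-! ### Specialization to the types 1 and -1 -/

open SignedMock in
theorem proposition3p3 {V : Type*} [AddCommGroup V] [Module ℂ V] [FiniteDimensional ℂ V]
    {m n : ℕ} (S : Setting V m n)
    (hodd : ∀ p : Fin n, S.gam p ∈ S.Lodd)
    (ξ₀ : V)
    (hξ_even : ∀ i : Fin m, S.gamma i ∈ S.Leven → ∃ a : ℤ, S.form ξ₀ (S.gamma i) = a)
    (hξ_odd : ∀ i : Fin m, S.gamma i ∈ S.Lodd → ∃ a : ℤ, S.form ξ₀ (S.gamma i) = 1 / 2 + a)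
    (hξ_T : ∀ j : Fin n, S.form ξ₀ (S.beta j) = 0)
    (lam : AffineDual V) (hlam : lam ∈ S.PT) :
    let ξ : AffineDual V := (ξ₀, 0, 0)
    -- the orthogonal projection to `ℂM` and a finite set of representatives exist
    (∀ z : V, ∃! w : V, S.IsProjM z w) ∧
    (∃ A : Finset (AffineDual V), S.IsRepresentatives A) ∧
    -- (a)
    (∀ (σ : ℤˣ) (τ : ℂ) (z w : V) (t : ℂ), S.Regular τ z → S.IsProjM z w →
      S.modTheta σ lam τ z t =
          S.signedTheta σ (S.stageWeight n lam) τ w t * ∏ p : Fin n, S.factor σ lam p τ z ∧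
      S.modTheta σ (lam + ξ) τ z t =
          S.signedTheta σ (S.stageWeight n lam + ξ) τ w t *
            ∏ p : Fin n, S.factor σ (lam + ξ) p τ z) ∧
    -- (b)
    (∀ (A : Finset (AffineDual V)), S.IsRepresentatives A →
      ∀ (τ : ℂ) (z : V) (t : ℂ), S.Regular τ z →
      S.modTheta 1 lam (-1 / τ) (τ⁻¹ • z) (t - S.form z z / (2 * τ)) =
        S.sFactor τ * ∑ mu ∈ A,
          exp (-(2 * Real.pi * I / S.k) * S.form lam.bar mu.bar) * S.modTheta 1 mu τ z t ∧
      S.modTheta (-1) lam (-1 / τ) (τ⁻¹ • z) (t - S.form z z / (2 * τ)) =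
        S.sFactor τ * ∑ mu ∈ A,
          exp (-(2 * Real.pi * I / S.k) * S.form lam.bar (mu.bar + ξ₀)) *
            S.modTheta 1 (mu + ξ) τ z t ∧
      S.modTheta 1 (lam + ξ) (-1 / τ) (τ⁻¹ • z) (t - S.form z z / (2 * τ)) =
        S.sFactor τ * ∑ mu ∈ A,
          exp (-(2 * Real.pi * I / S.k) * S.form (lam.bar + ξ₀) mu.bar) *
            S.modTheta (-1) mu τ z t ∧
      S.modTheta (-1) (lam + ξ) (-1 / τ) (τ⁻¹ • z) (t - S.form z z / (2 * τ)) =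
        S.sFactor τ * ∑ mu ∈ A,
          exp (-(2 * Real.pi * I / S.k) * S.form (lam.bar + ξ₀) (mu.bar + ξ₀)) *
            S.modTheta (-1) (mu + ξ) τ z t) ∧
    -- (c)
    (∀ (σ : ℤˣ) (τ : ℂ) (z : V) (t : ℂ), S.Regular τ z →
      S.modTheta σ lam (τ + 1) z t =
        exp (Real.pi * I / S.k * S.form lam.bar lam.bar) * S.modTheta (-σ) lam τ z t ∧
      S.modTheta σ (lam + ξ) (τ + 1) z t =
        exp (Real.pi * I / S.k * S.form (lam.bar + ξ₀) (lam.bar + ξ₀)) *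
          S.modTheta σ (lam + ξ) τ z t) := by
  intro ξ
  have h1 : S.HasType 1 lam := S.hasType_of_mem_PT hlam
  have hadd : ∀ mu ∈ S.PT, S.HasType (-1) (mu + ξ) :=
    fun mu hmu => S.hasType_add hξ_even hξ_odd hξ_T hmu
  -- Taking the translation vector 0 in place of ξ₀ lets the single statement `modTheta_S` cover the
  -- sums over unshifted weights.
  have hzero : ∀ mu : AffineDual V, mu + ((0 : V), (0 : ℂ), (0 : ℂ)) = mu := fun mu => add_zero mu
  have hadd0 : ∀ mu ∈ S.PT, S.HasType 1 (mu + ((0 : V), (0 : ℂ), (0 : ℂ))) := fun mu hmu => by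
    rw [hzero]
    exact S.hasType_of_mem_PT hmu
  have h2 : S.HasType (-1) (lam + ξ) := hadd lam hlam
  refine ⟨S.exists_unique_projM, S.exists_isRepresentatives, ?_, ?_, ?_⟩
  · intro σ τ z w t h hw
    constructor
    · rw [S.modTheta_eq hodd σ h1.1 h1.2.1 h hw, S.stageWeight_eq,
        S.signedTheta_eq σ (lam := (S.shift n lam.bar, lam.2)) h1.1]
    · have hν : ∀ q, S.form (lam.bar + ξ₀) (S.beta q) = 0 := h2.2.1
      have hν' : ∀ q, S.form (S.shift n lam.bar + ξ₀) (S.beta q) = 0 := fun q => by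
        rw [map_add, LinearMap.add_apply, S.form_shift_beta, h1.2.1, hξ_T, add_zero]
      -- λ_n + ξ₀ and (λ + ξ₀)_n may differ by a combination of the β_p, but they have the same
      -- image under the shift, hence the same norm and the same products with ℂM.
      have h3 : S.shift n (S.shift n lam.bar + ξ₀) = S.shift n (lam.bar + ξ₀) := by
        rw [map_add, map_add, S.shift_of_mem_cM (S.shift_mem_cM h1.2.1)]
      rw [S.modTheta_eq hodd σ h2.1 h2.2.1 h hw, S.stageWeight_eq,
        S.signedTheta_eq σ (lam := (S.shift n lam.bar, lam.2) + ξ) h2.1]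
      congr 2
      change S.thetaM σ (S.shift n (lam.bar + ξ₀)) τ w = S.thetaM σ (S.shift n lam.bar + ξ₀) τ w
      refine S.thetaM_congr σ ?_ (fun v hv => ?_) τ hw.1
      · rw [← h3, S.form_shift_shift n hν' hν']
      · rw [← h3, S.form_shift_left n _ fun q => S.form_cM_beta hv q]
  · intro A hA τ z t h
    refine ⟨?_, Setting.modTheta_S hodd hA h1 hadd h t, ?_, Setting.modTheta_S hodd hA h2 hadd h t⟩
    · simpa only [hzero, add_zero] using Setting.modTheta_S hodd hA h1 hadd0 h t
    · have h3 := Setting.modTheta_S hodd hA h2 hadd0 h t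
      simp only [hzero, add_zero] at h3
      exact h3
  · intro σ τ z t h
    refine ⟨?_, ?_⟩
    · simpa using Setting.modTheta_add_one hodd σ h1 h t
    · simpa using Setting.modTheta_add_one hodd σ h2 h t
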